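/- **Setting.** Let $E$ be a field with a valuation $v$ of arbitrary rank, with valuation ring $\mathcal O_v$ and residue field $Ev$, and let $F/E$ be a regular function field in one variable (a finite extension of $E(T)$ for some $T$ transcendental over $E$, with $E$ relatively algebraically closed in $F$). Valuations are written additively and identified when their valuation rings coincide; bars denote residues. For a field extension $F'/E$ let $\Omega_v(F')$ be the set of extensions $w$ of $v$ to $F'$ with $F'w/Ev$ transcendental, and $\Omega^*_v(F')$ the set of those $w\in\Omega_v(F')$ for which $F'w/Ev$ is not ruled; here $L/K$ is ruled if $L=K'(x)$ with $K'/K$ finite and $x\in L$. For $g=\sum_{i=0}^n a_it^i\in E[t]$ of degree $n$ and $X\in F\setminus E$ put $S_{g,X}(w)=\{i\le n: w(a_iX^i)=\min_j w(a_jX^j)\}$ and $\Omega_{S,g,X}=\{w\in\Omega_v(F): S_{g,X}(w)=S\}$. Let $\mathcal S(g,X)$ be the collection of all $S\subseteq\{0,\dots,n\}$ with $|S|\ge 2$ and $\Omega_{S,g,X}\ne\emptyset$. For $S\in\mathcal S(g,X)$ let $i_0=\min S$ and $d=\gcd\{i-i_0: i\in S\}$. There is $b\in E^\times$ with $w(bX^d)=0$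 for all $w\in\Omega_{S,g,X}$; let $e_S$ be the order of $v(b)/d$ in $vE^{\mathbb Q}/vE$, where $vE^{\mathbb Q}$ is the divisible hull of $vE$, and let $\mathcal C_g(S)$ be the set of $c\in E^\times$ with $w(cX^{e_S})=0$ for all $w\in\Omega_{S,g,X}$. For $c\in\mathcal C_g(S)$ put $$p_{S,g,c}(t)=\sum_{i\in S}\overline{a_ia_{i_0}^{-1}c^{-n_i}}\,t^{n_i}\in Ev[t],\qquad n_i=\frac{i-i_0}{e_S}.$$ Let $\mathsf{Mult}(S,g,X)$ be the set of multiplicities of the roots of $p_{S,g,c}$ in an algebraic closure of $Ev$ (it does not depend on $c$). For a monic irreducible factor $q$ of $p_{S,g,c}$ let $\Omega_{S,g,X,q}=\{w\in\Omega_{S,g,X}: q(\overline{cX^{e_S}})=0\text{ in }Fw\}$. A polynomial over a valuation ring is primitive if its residue polynomial is nonzero. **Statement.** Let $f=\sum_{i=0}^n a_it^i\in E[t]$ with $a_n\neq0$, let $X\in F\setminus E$, and assume $\operatorname{char}(Ev)=0$ or $\operatorname{char}(Ev)>n$. Let $S=\{0,1,\dots,r\}\in\mathcal S(f,X)$ and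 $c\in\mathcal C_f(S)$. Assume that $p_{S,f,c}$ is purely inseparable of degree $r$, i.e. it has degree $r$ and exactly one root in an algebraic closure of $Ev$, and let $q$ be its monic irreducible factor. Put $b_i=\frac{a_i}{a_0c^i}$ and $\theta=cX$. Then: 1. For every $w\in\Omega_{S,f,X,q}$ we have $\overline{\left(\frac{ra_rX}{a_{r-1}}\right)}=-1$ in $Fw$. 2. The polynomial $C(t)=\sum_{i=0}^{n-r+1}\binom{r-1+i}{i}b_{r-1+i}t^i$ lies in $\mathcal O_v[t]$ and is primitive, $\overline C(t)$ is linear, and $\overline C(\overline\theta)=0$ in $Fw$ for every $w\in\Omega_{S,f,X,q}$. 3. $C$ has a primitive factor $Q\in\mathcal O_v[t]$, irreducible over $E$, with $\overline Q=\overline C$. For every such $Q$: $Q$ is irreducible over $F$; let $F_Q=F[t]/(Q(t))$, let $\alpha\in F_Q$ be the class of $t$, and let $E_Q=E[\alpha]$. There is an extension $v_Q$ of $v$ to $E_Q$ with $v_Q(\alpha)=0$ such that, for every $w\in\Omega_{S,f,X,q}$, there is a unique extension $w_Q$ of $w$ to $F_Q$ with $w_Q(\alpha)=0$, and this $w_Q$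 extends $v_Q$ and satisfies $\overline\alpha=\overline\theta$ in $F_Qw_Q$, so that $w_Q(\theta-\alpha)>0$. Moreover (4) and (5) hold for these $Q$ and $v_Q$. 4. Let $X_1=\theta-\alpha$ and $g(t)=a_0^{-1}f\big(c^{-1}(t+\alpha)\big)\in E_Q[t]$. For $w\in\Omega_{S,f,X,q}$ and $S_1=S_{g,X_1}(w_Q)$ we have $\max S_1\le r$, and if $|S_1|\ge2$ then $\max\mathsf{Mult}(S_1,g,X_1)<r$. Here and in (5) the notions attached to $(g,X_1)$ are formed over the field $E_Q$ with the valuation $v_Q$ and the extension $F_Q/E_Q$. 5. Let $\Omega=\{w'\in\Omega_v(F_Q): w'|_F\in\Omega_{S,f,X,q},\ w'(\alpha)=0\}$. Then $|\Omega_{S,f,X,q}\cap\Omega^*_v(F)|=|\Omega\cap\Omega^*_v(F_Q)|$. If moreover $F=E(X)[\sqrt{f(X)}]$, then $$\Omega\cap\Omega_v^*(F_Q)\subseteq\bigcup_{\substack{S_1\in\mathcal S(g,X_1)\\ S_1\subseteq\{0,\dots,r\}}}\Omega_{S_1,g,X_1}.$$ -/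

import Mathlib

noncomputable section

namespace ResidueRuled

/-! Valuations are taken up to equivalence, i.e. a valuation of a field `K` is a
`ValuationSubring K` (of arbitrary rank), written multiplicatively: additive value `0` is
`valuation x = 1`, additive value `> 0` is `valuation x < 1`, and minima of additive values are
maxima of multiplicative ones. -/

section Basic

variable {E F : Type*} [Field E] [Field F] [Algebra E F]

/-- `F/E` is a regular function field in one variable: `F` is a finite extension of `E(T)` for
some `T` transcendental over `E`, and `E` is relatively algebraically closed in `F`. -/
def IsRegularFunctionField (E F : Type*) [Field E] [Field F] [Algebra E F] : Prop :=
  (∃ T : F, Transcendental E T ∧ FiniteDimensional (IntermediateField.adjoin E {T}) F) ∧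
    ∀ x : F, IsAlgebraic E x → x ∈ Set.range (algebraMap E F)

/-- `w` is an extension of `v` to `F`. -/
def IsExtension (v : ValuationSubring E) (w : ValuationSubring F) : Prop :=
  w.comap (algebraMap E F) = v

/-- The inclusion of valuation rings of an extension of valuations. -/
def ringMap (v : ValuationSubring E) (w : ValuationSubring F) (h : IsExtension v w) : v →+* w :=
  ((algebraMap E F).comp v.subtype).codRestrict w (fun a => by
    have ha : (a : E) ∈ w.comap (algebraMap E F) := by rw [h]; exact a.2
    exact ValuationSubring.mem_comap.1 ha)

theorem ringMap_isLocalHom (v : ValuationSubring E) (w : ValuationSubring F)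
    (h : IsExtension v w) : IsLocalHom (ringMap v w h) := by
  constructor
  intro a ha
  obtain ⟨b, hb⟩ := isUnit_iff_exists_inv.1 ha
  have hb' : algebraMap E F (a : E) * (b : F) = 1 := congrArg Subtype.val hb
  have ha0 : (a : E) ≠ 0 := by
    intro h0
    rw [h0, map_zero, zero_mul] at hb'
    exact zero_ne_one hb'
  have hbinv : (b : F) = algebraMap E F ((a : E)⁻¹) := by
    rw [map_inv₀]
    exact eq_inv_of_mul_eq_one_right hb'
  have hmem : (a : E)⁻¹ ∈ v := by
    have : (a : E)⁻¹ ∈ w.comap (algebraMap E F) := by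
      rw [ValuationSubring.mem_comap, ← hbinv]
      exact b.2
    rwa [h] at this
  exact isUnit_iff_exists_inv.2 ⟨⟨(a : E)⁻¹, hmem⟩, Subtype.ext (mul_inv_cancel₀ ha0)⟩

/-- The residue field extension `Ev → Fw` of an extension of valuations. -/
def residueMap (v : ValuationSubring E) (w : ValuationSubring F) (h : IsExtension v w) :
    IsLocalRing.ResidueField v →+* IsLocalRing.ResidueField w :=
  haveI := ringMap_isLocalHom v w h
  IsLocalRing.ResidueField.map (ringMap v w h)

open Classical in
/-- The residue of an element of the valuation ring (and `0` outside the valuation ring). -/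
def resid (w : ValuationSubring F) (x : F) : IsLocalRing.ResidueField w :=
  if h : x ∈ w then IsLocalRing.residue w ⟨x, h⟩ else 0

/-- `x` is in the valuation ring of the extension `w` of `v`, and its residue is a root of the
polynomial `p` over `Ev`. -/
def IsResidueRoot (v : ValuationSubring E) (w : ValuationSubring F)
    (p : Polynomial (IsLocalRing.ResidueField v)) (x : F) : Prop :=
  x ∈ w ∧ ∃ h : IsExtension v w, p.eval₂ (residueMap v w h) (resid w x) = 0

/-- `L/K` is ruled: `L = K'(x)` for some finite extension `K'/K` and some `x ∈ L`. -/
def IsRuled (K L : Type*) [Field K] [Field L] [Algebra K L] : Prop :=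
  ∃ K' : IntermediateField K L, FiniteDimensional K K' ∧
    ∃ x : L, IntermediateField.adjoin K' {x} = ⊤

/-- `Ω_v(F)`: the residually transcendental extensions of `v` to `F`. -/
def Omega (v : ValuationSubring E) (F : Type*) [Field F] [Algebra E F] :
    Set (ValuationSubring F) :=
  {w | ∃ h : IsExtension v w,
    letI := (residueMap v w h).toAlgebra
    Algebra.Transcendental (IsLocalRing.ResidueField v) (IsLocalRing.ResidueField w)}

/-- `Ω*_v(F)`: the residually transcendental extensions with non-ruled residue extension. -/
def OmegaStar (v : ValuationSubring E) (F : Type*) [Field F] [Algebra E F] :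
    Set (ValuationSubring F) :=
  {w | w ∈ Omega v F ∧ ∃ h : IsExtension v w,
    letI := (residueMap v w h).toAlgebra
    ¬ IsRuled (IsLocalRing.ResidueField v) (IsLocalRing.ResidueField w)}

open Classical in
/-- `S_{g,X}(w)`: the indices `i ≤ deg g` at which `w(a_i X^i)` attains its minimum, where
`g = ∑ a_i t^i`. -/
def minSet (g : Polynomial E) (X : F) (w : ValuationSubring F) : Finset ℕ :=
  (Finset.range (g.natDegree + 1)).filter fun i =>
    ∀ j ∈ Finset.range (g.natDegree + 1),
      w.valuation (algebraMap E F (g.coeff j) * X ^ j) ≤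
        w.valuation (algebraMap E F (g.coeff i) * X ^ i)

/-- `Ω_{S,g,X}`. -/
def OmegaS (v : ValuationSubring E) (S : Finset ℕ) (g : Polynomial E) (X : F) :
    Set (ValuationSubring F) :=
  {w | w ∈ Omega v F ∧ minSet g X w = S}

/-- `𝒮(g,X)`. -/
def indexSets (v : ValuationSubring E) (g : Polynomial E) (X : F) : Set (Finset ℕ) :=
  {S | S ⊆ Finset.range (g.natDegree + 1) ∧ 2 ≤ S.card ∧ (OmegaS v S g X).Nonempty}

/-- The least element `i₀` of `S`. -/
def minIdx (S : Finset ℕ) : ℕ := sInf (S : Set ℕ)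

/-- The greatest common divisor `d` of the differences `i - i₀`, `i ∈ S`. -/
def gcdIdx (S : Finset ℕ) : ℕ := S.gcd fun i => i - minIdx S

/-- `e_S`: the order of `v(b)/d` in `vE^ℚ / vE`, where `d = gcdIdx S` and `b ∈ Eˣ` is such that
`w(b X^d) = 0` for all `w ∈ Ω_{S,g,X}`; that is, the least `e ≥ 1` for which `e · v(b) = d · v(a)`
for some `a ∈ Eˣ`. -/
def ramIdx (v : ValuationSubring E) (S : Finset ℕ) (g : Polynomial E) (X : F) : ℕ :=
  sInf {e : ℕ | 0 < e ∧ ∃ b : E, b ≠ 0 ∧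
    (∀ w ∈ OmegaS v S g X, w.valuation (algebraMap E F b * X ^ gcdIdx S) = 1) ∧
    ∃ a : E, a ≠ 0 ∧ v.valuation b ^ e = v.valuation a ^ gcdIdx S}

/-- `𝒞_g(S)`: the `c ∈ Eˣ` with `w(c X^{e_S}) = 0` for all `w ∈ Ω_{S,g,X}`. -/
def scalars (v : ValuationSubring E) (S : Finset ℕ) (g : Polynomial E) (X : F) : Set E :=
  {c | c ≠ 0 ∧ ∀ w ∈ OmegaS v S g X, w.valuation (algebraMap E F c * X ^ ramIdx v S g X) = 1}

/-- The polynomial `p_{S,g,c}(t) = ∑_{i ∈ S} res(a_i a_{i₀}⁻¹ c^{-n_i}) t^{n_i}` over `Ev`, where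
`n_i = (i - i₀) / e_S`. -/
def residuePoly (v : ValuationSubring E) (S : Finset ℕ) (g : Polynomial E) (X : F) (c : E) :
    Polynomial (IsLocalRing.ResidueField v) :=
  ∑ i ∈ S, Polynomial.monomial ((i - minIdx S) / ramIdx v S g X)
    (resid v (g.coeff i * (g.coeff (minIdx S))⁻¹ *
      (c ^ ((i - minIdx S) / ramIdx v S g X))⁻¹))

/-- `Irrfac(p)`: the monic irreducible factors of `p`. -/
def irrFac {K : Type*} [Field K] (p : Polynomial K) : Set (Polynomial K) :=
  {q | q.Monic ∧ Irreducible q ∧ q ∣ p}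

/-- `p` is purely inseparable: it has exactly one root in an algebraic closure. -/
def IsPurelyInseparablePoly {K : Type*} [Field K] (p : Polynomial K) : Prop :=
  ∃! x : AlgebraicClosure K, p.aeval x = 0

/-- `Mult(S,g,X)`: the multiplicities of the roots of `p_{S,g,c}` in an algebraic closure of `Ev`
(independent of `c ∈ 𝒞_g(S)`). -/
def Mult (v : ValuationSubring E) (S : Finset ℕ) (g : Polynomial E) (X : F) : Set ℕ :=
  {m | ∃ c ∈ scalars v S g X, ∃ x : AlgebraicClosure (IsLocalRing.ResidueField v),
    (residuePoly v S g X c).aeval x = 0 ∧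
    m = ((residuePoly v S g X c).map (algebraMap _ _)).rootMultiplicity x}

/-- `Ω_{S,g,X,q}`. -/
def OmegaSq (v : ValuationSubring E) (S : Finset ℕ) (g : Polynomial E) (X : F) (c : E)
    (q : Polynomial (IsLocalRing.ResidueField v)) : Set (ValuationSubring F) :=
  {w | w ∈ OmegaS v S g X ∧
    IsResidueRoot v w q (algebraMap E F c * X ^ ramIdx v S g X)}

/-- `F = E(X)[√f(X)]`. -/
def IsSqrtExtension (f : Polynomial E) (X : F) : Prop :=
  ∃ Y : F, Y ^ 2 = f.aeval X ∧ IntermediateField.adjoin E {X, Y} = ⊤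

end Basic

section Translate

variable {E F : Type*} [Field E] [Field F] [Algebra E F]

/-- `C(t) = ∑_{i=0}^{n-r+1} binom(r-1+i, i) b_{r-1+i} t^i` with `b_j = a_j / (a_0 c^j)`, where
`f = ∑_{j ≤ n} a_j t^j` has degree `n`. -/
def binomPoly (f : Polynomial E) (c : E) (r : ℕ) : Polynomial E :=
  ∑ i ∈ Finset.range (f.natDegree - r + 2),
    Polynomial.monomial i (((r - 1 + i).choose i : E) *
      (f.coeff (r - 1 + i) / (f.coeff 0 * c ^ (r - 1 + i))))

/-- The residue polynomial of a polynomial over the valuation ring. -/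
def reduce (v : ValuationSubring E) (P : Polynomial v) :
    Polynomial (IsLocalRing.ResidueField v) :=
  P.map (IsLocalRing.residue v)

/-- A polynomial over the valuation ring is primitive if its residue polynomial is nonzero. -/
def IsPrimitivePoly (v : ValuationSubring E) (P : Polynomial v) : Prop :=
  reduce v P ≠ 0

/-- `Q` is a primitive factor of `P`, irreducible over `E`, with the same residue polynomial. -/
def IsResidualFactor (v : ValuationSubring E) (P Q : Polynomial v) : Prop :=
  Irreducible (Q.map v.subtype) ∧ Q ∣ P ∧ IsPrimitivePoly v Q ∧ reduce v Q = reduce v P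

/-- `Q` viewed as a polynomial over `F`. -/
def overField (v : ValuationSubring E) (F : Type*) [Field F] [Algebra E F] (Q : Polynomial v) :
    Polynomial F :=
  Q.map ((algebraMap E F).comp v.subtype)

/-- For `α` in an extension of `E`, the polynomial `g(t) = a_0⁻¹ f(c⁻¹ (t + α))` over `E(α)`. -/
def translate (f : Polynomial E) (c : E) (α : F) :
    Polynomial (IntermediateField.adjoin E {α}) :=
  Polynomial.C (algebraMap E _ (f.coeff 0)⁻¹) *
    (f.map (algebraMap E (IntermediateField.adjoin E {α}))).comp
      (Polynomial.C (algebraMap E _ c⁻¹) *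
        (Polynomial.X + Polynomial.C (IntermediateField.AdjoinSimple.gen E α)))

/-- The set of residually transcendental extensions `w'` of `v` to `F'` that restrict to an
element of `A` on `F` and satisfy `w'(α) = 0`. -/
def liftedSet (v : ValuationSubring E) (A : Set (ValuationSubring F))
    {F' : Type*} [Field F'] [Algebra E F'] [Algebra F F'] (α : F') : Set (ValuationSubring F') :=
  {w' | w' ∈ Omega v F' ∧ w'.comap (algebraMap F F') ∈ A ∧ w'.valuation α = 1}

end Translate

end ResidueRuled

end

/-! Scaling. Put h(t) = a₀⁻¹ f(c⁻¹t), with coefficients b_i. As θ = cX is a unit for the valuations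
in question, b_0, …, b_r are units and all later b_i lie in the maximal ideal (`IsInitialData`), so
p is the reduction of h. Having degree r and a single root ρ, p equals b̄_r (t - ρ)^r. The
coefficient of t^(r-1) gives rρ = -b̄_{r-1}/b̄_r, and r is invertible in Ev, so ρ lies in Ev and q =
t - ρ; this is (1). The polynomial C is the Hasse derivative of h of order r - 1. Its reduction
b̄_{r-1} + r b̄_r t is linear with the same root ρ, which is nonzero; this is (2).

Adjoining a root. Gauss's lemma yields the factor Q of C, and Q stays irreducible over F because the
coefficients of a monic factor are algebraic over E. The key point is a version of Hensel's lemma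
for `IsResiduallyLinearRoot`: if the reduction of Q is linear with nonzero root, a valuation extends
uniquely to the field generated by a root α of Q under the condition that α is a unit, and the
residue field does not grow. Existence is Chevalley's extension theorem. For uniqueness, α⁻¹ is
integral and the derivative D of its minimal polynomial is a unit at α⁻¹. By Euler's trace dual,
D(α⁻¹)u is a polynomial in α⁻¹ with integral coefficients for every integral u, so the residue of u
is forced; `exists_integral_horner` reduces arbitrary elements to integral ones. Over E this gives
v_Q, over F it gives w_Q.

Killing a coefficient. The coefficient of g at r - 1 is C(α) = 0, as in a Tschirnhaus
transformation. The coefficients of g are integral, the r-th is a unit and X₁ lies in the maximal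
ideal, so no index above r is minimal. A root x of multiplicity r would make the residue polynomial
a constant times (t - x)^r; the missing term of degree r - 1 forces x = 0, while the constant term
is 1. This is (4).

Counting. Since residue fields do not change along w_Q/w, restriction is a bijection on non-ruled
extensions. For the inclusion in (5), suppose S_1 is a singleton. Then Y² = a₀ g(X₁) agrees up to
residue one with a monomial in X₁, and the residue extension is shown to be ruled. The tool is a
normal form in K(x) relative to a key polynomial (`exists_normalForm`): the residue field of K(x) is
k₁(z) with k₁ finite, and a root of a monomial in z, up to squares, generates a ruled extension of
k₁(z) (`isRuled_of_sq_eq_monomial`). -/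

noncomputable section

namespace ResidueRuled

open Polynomial

/-! ### Arithmetic of residues. -/

section Resid

variable {F : Type*} [Field F] (w : ValuationSubring F)

theorem resid_of_mem {x : F} (h : x ∈ w) : resid w x = IsLocalRing.residue w ⟨x, h⟩ := by
  simp [resid, h]

theorem resid_add {x y : F} (hx : x ∈ w) (hy : y ∈ w) :
    resid w (x + y) = resid w x + resid w y := by
  rw [resid_of_mem w hx, resid_of_mem w hy, resid_of_mem w (add_mem hx hy), ← map_add]; rfl

theorem resid_mul {x y : F} (hx : x ∈ w) (hy : y ∈ w) :
    resid w (x * y) = resid w x * resid w y := by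
  rw [resid_of_mem w hx, resid_of_mem w hy, resid_of_mem w (mul_mem hx hy), ← map_mul]; rfl

theorem resid_sub {x y : F} (hx : x ∈ w) (hy : y ∈ w) :
    resid w (x - y) = resid w x - resid w y := by
  rw [resid_of_mem w hx, resid_of_mem w hy, resid_of_mem w (sub_mem hx hy), ← map_sub]; rfl

@[simp] theorem resid_one : resid w 1 = 1 := by
  rw [resid_of_mem w (one_mem w)]; exact map_one _

@[simp] theorem resid_zero : resid w 0 = 0 := by
  rw [resid_of_mem w (zero_mem w)]; exact map_zero _

theorem resid_pow {x : F} (hx : x ∈ w) (n : ℕ) : resid w (x ^ n) = resid w x ^ n := by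
  induction n with
  | zero => simp
  | succ n ih => rw [pow_succ, pow_succ, resid_mul w (pow_mem hx n) hx, ih]

theorem resid_sum {ι : Type*} (s : Finset ι) (g : ι → F) (hg : ∀ i ∈ s, g i ∈ w) :
    resid w (∑ i ∈ s, g i) = ∑ i ∈ s, resid w (g i) := by
  classical
  induction s using Finset.induction_on with
  | empty => simp
  | insert a s ha ih =>
    rw [Finset.sum_insert ha, Finset.sum_insert ha, resid_add w (hg a (by simp))
      (sum_mem fun i hi => hg i (by simp [hi])), ih fun i hi => hg i (by simp [hi])]

theorem mem_of_valuation_eq_one {x : F} (h : w.valuation x = 1) : x ∈ w :=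
  (w.valuation_le_one_iff x).1 h.le

theorem mem_of_valuation_lt_one {x : F} (h : w.valuation x < 1) : x ∈ w :=
  (w.valuation_le_one_iff x).1 h.le

theorem resid_eq_zero_iff {x : F} (hx : x ∈ w) : resid w x = 0 ↔ w.valuation x < 1 := by
  rw [resid_of_mem w hx, IsLocalRing.residue_eq_zero_iff, ValuationSubring.valuation_lt_one_iff]

theorem resid_ne_zero_iff {x : F} : resid w x ≠ 0 ↔ w.valuation x = 1 := by
  by_cases hx : x ∈ w
  · rw [Ne, resid_eq_zero_iff w hx, not_lt]
    exact ⟨fun h => le_antisymm ((w.valuation_le_one_iff x).2 hx) h, fun h => h.ge⟩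
  · have : resid w x = 0 := by simp [resid, hx]
    simp only [this, ne_eq, not_true, false_iff]
    exact fun h => hx (mem_of_valuation_eq_one w h)

theorem resid_of_valuation_lt_one {x : F} (h : w.valuation x < 1) : resid w x = 0 :=
  (resid_eq_zero_iff w (mem_of_valuation_lt_one w h)).2 h

theorem ne_zero_of_valuation_eq_one {x : F} (h : w.valuation x = 1) : x ≠ 0 := by
  rintro rfl; simp at h

theorem valuation_inv_eq_one {x : F} (h : w.valuation x = 1) : w.valuation x⁻¹ = 1 := by
  rw [map_inv₀, h, inv_one]

theorem resid_inv {x : F} (h : w.valuation x = 1) : resid w x⁻¹ = (resid w x)⁻¹ := by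
  refine eq_inv_of_mul_eq_one_right ?_
  rw [← resid_mul w (mem_of_valuation_eq_one w h)
    (mem_of_valuation_eq_one w (valuation_inv_eq_one w h)),
    mul_inv_cancel₀ (ne_zero_of_valuation_eq_one w h), resid_one]

theorem resid_div {x y : F} (hx : x ∈ w) (h : w.valuation y = 1) :
    resid w (x / y) = resid w x / resid w y := by
  rw [div_eq_mul_inv, div_eq_mul_inv, resid_mul w hx
    (mem_of_valuation_eq_one w (valuation_inv_eq_one w h)), resid_inv w h]

theorem resid_zpow {x : F} (h : w.valuation x = 1) (n : ℤ) :
    resid w (x ^ n) = resid w x ^ n := by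
  cases n with
  | ofNat n => simpa using resid_pow w (mem_of_valuation_eq_one w h) n
  | negSucc n =>
    rw [zpow_negSucc, zpow_negSucc, resid_inv w (by rw [map_pow, h, one_pow]),
      resid_pow w (mem_of_valuation_eq_one w h)]

theorem exists_resid_eq (y : IsLocalRing.ResidueField w) : ∃ x ∈ w, resid w x = y := by
  obtain ⟨a, rfl⟩ := IsLocalRing.residue_surjective y
  exact ⟨a, a.2, resid_of_mem w a.2⟩

theorem residue_eq_resid (a : w) : IsLocalRing.residue w a = resid w (a : F) :=
  (resid_of_mem w a.2).symm

theorem resid_eq_iff {x y : F} (hx : x ∈ w) (hy : y ∈ w) :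
    resid w x = resid w y ↔ w.valuation (x - y) < 1 := by
  rw [← sub_eq_zero, ← resid_sub w hx hy, resid_eq_zero_iff w (sub_mem hx hy)]

end Resid

/-! ### Extensions of valuations and their residue maps. -/

section Extension

variable {E F : Type*} [Field E] [Field F] [Algebra E F] {v : ValuationSubring E}
  {w : ValuationSubring F}

theorem IsExtension.mem_iff (h : IsExtension v w) (a : E) : algebraMap E F a ∈ w ↔ a ∈ v := by
  conv_rhs => rw [← h]
  exact ValuationSubring.mem_comap.symm

theorem IsExtension.valuation_le_one_iff (h : IsExtension v w) (a : E) :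
    w.valuation (algebraMap E F a) ≤ 1 ↔ v.valuation a ≤ 1 := by
  rw [ValuationSubring.valuation_le_one_iff, ValuationSubring.valuation_le_one_iff, h.mem_iff]

theorem IsExtension.valuation_lt_one_iff (h : IsExtension v w) (a : E) :
    w.valuation (algebraMap E F a) < 1 ↔ v.valuation a < 1 := by
  by_cases ha : a = 0
  · simp [ha]
  rw [← not_le, ← not_le, not_iff_not, ← inv_le_one₀, ← inv_le_one₀, ← map_inv₀, ← map_inv₀,
    ← map_inv₀, h.valuation_le_one_iff]
  · exact zero_lt_iff.2 ((Valuation.ne_zero_iff _).2 ha)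
  · exact zero_lt_iff.2 ((Valuation.ne_zero_iff _).2 (by simpa using ha))

theorem IsExtension.valuation_eq_one_iff (h : IsExtension v w) (a : E) :
    w.valuation (algebraMap E F a) = 1 ↔ v.valuation a = 1 := by
  have h1 := h.valuation_le_one_iff a
  have h2 := h.valuation_lt_one_iff a
  constructor
  · exact fun h' => le_antisymm (h1.1 h'.le) (not_lt.1 fun hl => (h2.2 hl).ne h')
  · exact fun h' => le_antisymm (h1.2 h'.le) (not_lt.1 fun hl => (h2.1 hl).ne h')

theorem residueMap_residue (h : IsExtension v w) (a : v) :
    residueMap v w h (IsLocalRing.residue v a) =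
      IsLocalRing.residue w (ringMap v w h a) := rfl

theorem residueMap_resid (h : IsExtension v w) {a : E} (ha : a ∈ v) :
    residueMap v w h (resid v a) = resid w (algebraMap E F a) := by
  rw [resid_of_mem v ha, residueMap_residue, residue_eq_resid]; rfl

theorem IsExtension.trans {L : Type*} [Field L] [Algebra E L] [Algebra F L] [IsScalarTower E F L]
    {W : ValuationSubring L} (h : IsExtension v w) (h' : IsExtension w W) : IsExtension v W := by
  ext a
  rw [ValuationSubring.mem_comap, IsScalarTower.algebraMap_apply E F L, h'.mem_iff, h.mem_iff]

theorem IsExtension.of_tower {L : Type*} [Field L] [Algebra E L] [Algebra F L]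
    [IsScalarTower E F L] {W : ValuationSubring L} (h : IsExtension v W) :
    IsExtension v (W.comap (algebraMap F L)) := by
  ext a
  rw [ValuationSubring.mem_comap, ValuationSubring.mem_comap,
    ← IsScalarTower.algebraMap_apply E F L, h.mem_iff]

theorem residueMap_comp {L : Type*} [Field L] [Algebra E L] [Algebra F L] [IsScalarTower E F L]
    {W : ValuationSubring L} (h : IsExtension v w) (h' : IsExtension w W)
    (h'' : IsExtension v W) (y : IsLocalRing.ResidueField v) :
    residueMap v W h'' y = residueMap w W h' (residueMap v w h y) := by
  obtain ⟨a, ha, rfl⟩ := exists_resid_eq v y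
  rw [residueMap_resid h ha, residueMap_resid h'' ha, residueMap_resid h' ((h.mem_iff a).2 ha),
    IsScalarTower.algebraMap_apply E F L]

theorem eval₂_residueMap_resid (h : IsExtension v w) (P : Polynomial v) {x : F} (hx : x ∈ w) :
    (reduce v P).eval₂ (residueMap v w h) (resid w x) =
      resid w (P.eval₂ ((algebraMap E F).comp v.subtype) x) := by
  rw [reduce, eval₂_map, eval₂_eq_sum_range, eval₂_eq_sum_range, resid_sum]
  · refine Finset.sum_congr rfl fun i _ => ?_
    have hm : algebraMap E F (P.coeff i : E) ∈ w := (h.mem_iff _).2 (P.coeff i).2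
    rw [RingHom.comp_apply, RingHom.comp_apply, ValuationSubring.subtype_apply,
      resid_mul w hm (pow_mem hx i), resid_pow w hx, ← residueMap_resid h (P.coeff i).2,
      residue_eq_resid]
  · exact fun i _ => mul_mem ((h.mem_iff _).2 (P.coeff i).2) (pow_mem hx i)

end Extension

/-! ### Primitive polynomials over a valuation ring and Gauss's lemma. -/

section Primitive

variable {K : Type*} [Field K] (v : ValuationSubring K)

theorem exists_map_subtype_eq {P : K[X]} (h : ∀ n, P.coeff n ∈ v) :
    ∃ P' : v[X], P'.map v.subtype = P := by
  have : P ∈ lifts v.subtype := (lifts_iff_coeff_lifts P).2 fun n => ⟨⟨P.coeff n, h n⟩, rfl⟩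
  exact this

theorem map_subtype_injective : Function.Injective (Polynomial.map v.subtype) :=
  Polynomial.map_injective _ Subtype.val_injective

theorem reduce_coeff (P : v[X]) (n : ℕ) :
    (reduce v P).coeff n = resid v (P.coeff n : K) := by
  rw [reduce, coeff_map, residue_eq_resid]

/-- Division by a coefficient of largest valuation turns that coefficient into 1. -/
theorem exists_primitive_scaling {P : K[X]} (hP : P ≠ 0) :
    ∃ d : K, d ≠ 0 ∧ ∃ P' : v[X], P'.map v.subtype = C d * P ∧ IsPrimitivePoly v P' := by
  obtain ⟨j, hj, hmax⟩ := Finset.exists_max_image P.support (fun i => v.valuation (P.coeff i))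
    (Polynomial.support_nonempty.2 hP)
  have hj0 : P.coeff j ≠ 0 := Polynomial.mem_support_iff.1 hj
  obtain ⟨P', hP'⟩ := exists_map_subtype_eq v (P := C (P.coeff j)⁻¹ * P) (fun n => by
    rw [coeff_C_mul, ← v.valuation_le_one_iff, map_mul, map_inv₀]
    by_cases hn : n ∈ P.support
    · refine (mul_le_mul_right (hmax n hn) _).trans (inv_mul_cancel₀ ?_).le
      exact (Valuation.ne_zero_iff _).2 hj0
    · rw [Polynomial.notMem_support_iff.1 hn]; simp)
  refine ⟨_, inv_ne_zero hj0, P', hP', fun h => ?_⟩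
  have h1 : (P'.coeff j : K) = 1 := by
    have := congrArg (fun p => p.coeff j) hP'
    simpa [hj0] using this
  have := reduce_coeff v P' j
  rw [h, h1] at this
  simp at this

theorem IsPrimitivePoly.mul {P Q : v[X]} (hP : IsPrimitivePoly v P) (hQ : IsPrimitivePoly v Q) :
    IsPrimitivePoly v (P * Q) := by
  unfold IsPrimitivePoly reduce at *
  rw [Polynomial.map_mul]
  exact mul_ne_zero hP hQ

theorem mem_of_C_mul_primitive {P : v[X]} (hP : IsPrimitivePoly v P) {d : K} {R : v[X]}
    (h : R.map v.subtype = C d * P.map v.subtype) : d ∈ v := by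
  obtain ⟨n, hn⟩ : ∃ n, (reduce v P).coeff n ≠ 0 := by
    by_contra! hc
    exact hP (Polynomial.ext hc)
  rw [reduce_coeff, resid_ne_zero_iff] at hn
  have h1 : (R.coeff n : K) = d * P.coeff n := by
    simpa using congrArg (fun p => p.coeff n) h
  rw [← v.valuation_le_one_iff]
  have := v.valuation_le_one (R.coeff n)
  rwa [h1, map_mul, hn, mul_one] at this

/-- Gauss's lemma: once the cofactor is scaled to be primitive, its product with Q is primitive, so
the scalar relating that product to G must lie in v. -/
theorem dvd_of_map_dvd_map {Q G : v[X]} (hQ : IsPrimitivePoly v Q)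
    (h : Q.map v.subtype ∣ G.map v.subtype) : Q ∣ G := by
  obtain ⟨H, hH⟩ := h
  by_cases hH0 : H = 0
  · have : G = 0 := map_subtype_injective v (by rw [hH, hH0]; simp)
    simp [this]
  obtain ⟨d, hd, H', hH', hprim⟩ := exists_primitive_scaling v hH0
  have h1 : G.map v.subtype = C d⁻¹ * (Q * H').map v.subtype := by
    rw [Polynomial.map_mul, hH', hH, mul_left_comm, ← mul_assoc (C d⁻¹), ← C_mul,
      inv_mul_cancel₀ hd]
    simp
  have hm := mem_of_C_mul_primitive v (hQ.mul v hprim) h1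
  refine ⟨C ⟨d⁻¹, hm⟩ * H', map_subtype_injective v ?_⟩
  rw [h1]
  simp only [Polynomial.map_mul, map_C, ValuationSubring.subtype_apply]
  ring

end Primitive

/-! ### Integral elements and Euler's trace dual. -/

section Hensel

variable {K L : Type*} [Field K] [Field L] [Algebra K L] (w : ValuationSubring K)

/-- The integral closure of a ring in a field is an intersection of valuation rings. -/
theorem isIntegral_of_forall_mem {x : L}
    (h : ∀ V : ValuationSubring L, (∀ a ∈ w, algebraMap K L a ∈ V) → x ∈ V) : IsIntegral w x := by
  by_contra hx
  have hx' : x ∉ (integralClosure w L).toSubring := hx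
  obtain ⟨V, hV, hxV⟩ := Subring.exists_le_valuationSubring_of_isIntegrallyClosedIn hx'
  exact hxV (h V fun a ha => hV (algebraMap_mem (integralClosure w L) (⟨a, ha⟩ : w)))

/-- Take a primitive equation of x and let j be the last index with a unit coefficient. The Horner
tail u, starting at that coefficient, lies in every valuation ring that contains x, and ux in every
one that contains x⁻¹. So x is a quotient of the integral elements ux and u, and whether x belongs
to an extension W of w can be read off from u alone. -/
theorem exists_integral_horner {x : L} (hx : IsAlgebraic K x) :
    ∃ u : L, IsIntegral w u ∧ IsIntegral w (u * x) ∧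
      ∀ W : ValuationSubring L, IsExtension w W → (W.valuation u = 1 ↔ x ∈ W) := by
  obtain ⟨P, hP0, hPx⟩ := hx
  obtain ⟨d, hd, h, hh, hprim⟩ := exists_primitive_scaling w hP0
  have hroot : aeval x h = 0 := by
    rw [← aeval_map_algebraMap K, show algebraMap w K = w.subtype from rfl, hh, map_mul, hPx,
      mul_zero]
  set j := (reduce w h).natDegree with hj
  have hjn : j ≤ h.natDegree := natDegree_map_le
  obtain ⟨m, hm⟩ := Nat.exists_eq_add_of_le hjn
  set a : ℕ → L := fun i => algebraMap K L (h.coeff i : K) with ha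
  have haj : w.valuation (h.coeff j : K) = 1 := by
    rw [← resid_ne_zero_iff, ← reduce_coeff]
    exact Polynomial.leadingCoeff_ne_zero.2 hprim
  have hagt : ∀ i, j < i → w.valuation (h.coeff i : K) < 1 := by
    intro i hi
    rw [← resid_eq_zero_iff w (h.coeff i).2, ← reduce_coeff]
    exact coeff_eq_zero_of_natDegree_lt hi
  set u : L := ∑ i ∈ Finset.range (m + 1), a (j + i) * x ^ i with hu
  set B : L := ∑ i ∈ Finset.range j, a i * x ^ i with hB
  have hBu : B + x ^ j * u = 0 := by
    rw [← hroot, aeval_eq_sum_range, hm, add_assoc, Finset.sum_range_add, hu, Finset.mul_sum]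
    congr 1
    · exact Finset.sum_congr rfl fun i _ => by rw [Algebra.smul_def]; rfl
    · refine Finset.sum_congr rfl fun i _ => ?_
      rw [pow_add, Algebra.smul_def]
      change _ = a (j + i) * _
      ring
  have key : ∀ V : ValuationSubring L, (∀ b ∈ w, algebraMap K L b ∈ V) →
      (x ∈ V → u ∈ V) ∧ (x⁻¹ ∈ V → u * x ∈ V) := by
    intro V hV
    refine ⟨fun hxV => sum_mem fun i _ => mul_mem (hV _ (h.coeff _).2) (pow_mem hxV i),
      fun hxV => ?_⟩
    by_cases hx0 : x = 0
    · simp [hx0, zero_mem]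
    rcases Nat.eq_zero_or_pos j with h0 | hpos
    · have hu0 : u = 0 := by
        have := hBu
        rw [hB, h0] at this
        simpa using this
      simp [hu0, zero_mem]
    -- The equation of x, divided by x^(j-1), expresses ux through x⁻¹.
    · have hux : u * x = -∑ i ∈ Finset.range j, a i * x⁻¹ ^ (j - 1 - i) := by
        have h1 : x ^ (j - 1) * (u * x) =
            x ^ (j - 1) * -∑ i ∈ Finset.range j, a i * x⁻¹ ^ (j - 1 - i) := by
          have h2 : x ^ (j - 1) * (u * x) = x ^ j * u := by
            conv_rhs => rw [← Nat.sub_add_cancel hpos, pow_succ]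
            ring
          rw [h2, eq_neg_of_add_eq_zero_right hBu, mul_neg, Finset.mul_sum]
          congr 1
          refine Finset.sum_congr rfl fun i hi => ?_
          have hi' : i ≤ j - 1 := by have := Finset.mem_range.1 hi; omega
          have h3 : x ^ (j - 1) = x ^ i * x ^ (j - 1 - i) := by rw [← pow_add]; congr 1; omega
          rw [h3, inv_pow]
          field_simp
        exact mul_left_cancel₀ (pow_ne_zero _ hx0) h1
      rw [hux]
      exact neg_mem (sum_mem fun i _ => mul_mem (hV _ (h.coeff _).2) (pow_mem hxV _))
  refine ⟨u, isIntegral_of_forall_mem w fun V hV => ?_, isIntegral_of_forall_mem w fun V hV => ?_,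
    fun W hW => ⟨fun hu1 => ?_, fun hxW => ?_⟩⟩
  · rcases V.mem_or_inv_mem x with hx | hx
    · exact (key V hV).1 hx
    · by_cases hxV : x ∈ V
      · exact (key V hV).1 hxV
      by_cases hx0 : x = 0
      · exact absurd (hx0 ▸ zero_mem V) hxV
      have := mul_mem ((key V hV).2 hx) hx
      rwa [mul_assoc, mul_inv_cancel₀ hx0, mul_one] at this
  · rcases V.mem_or_inv_mem x with hx | hx
    · exact mul_mem ((key V hV).1 hx) hx
    · exact (key V hV).2 hx
  · have hmem := (W.mem_or_inv_mem x).resolve_left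
    by_contra hxW
    have := (key W fun b hb => (hW.mem_iff b).2 hb).2 (hmem hxW)
    rw [← W.valuation_le_one_iff, map_mul, hu1, one_mul, W.valuation_le_one_iff] at this
    exact hxW this
  -- All coefficients after the j-th reduce to zero, so u has the residue of the j-th one.
  · rw [← resid_ne_zero_iff, hu, resid_sum W]
    · rw [Finset.sum_range_succ', Finset.sum_eq_zero, zero_add]
      · simp only [add_zero, pow_zero, mul_one]
        exact (resid_ne_zero_iff W).2 ((hW.valuation_eq_one_iff _).2 haj)
      · intro i _
        apply resid_of_valuation_lt_one
        rw [map_mul]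
        refine mul_lt_one_of_lt_of_le ((hW.valuation_lt_one_iff _).2 (hagt _ (by omega))) ?_
        rw [W.valuation_le_one_iff]
        exact pow_mem hxW _
    · exact fun i _ => mul_mem ((hW.mem_iff _).2 (h.coeff _).2) (pow_mem hxW i)

theorem isSeparable_of_adjoin_eq_top {α : L} (htop : Algebra.adjoin K {α} = ⊤)
    (hα : IsSeparable K α) : Algebra.IsSeparable K L ∧ FiniteDimensional K L := by
  have hint : IsIntegral K α := hα.isIntegral
  have h1 : IntermediateField.adjoin K {α} = ⊤ := by
    rw [← IntermediateField.toSubalgebra_inj,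
      IntermediateField.adjoin_simple_toSubalgebra_of_isAlgebraic hint.isAlgebraic, htop]
    rfl
  have h2 : Algebra.IsSeparable K (IntermediateField.adjoin K {α}) :=
    (IntermediateField.isSeparable_adjoin_simple_iff_isSeparable K L).2 hα
  have h3 : FiniteDimensional K (IntermediateField.adjoin K {α}) :=
    IntermediateField.adjoin.finiteDimensional hint
  rw [h1] at h2 h3
  exact ⟨AlgEquiv.Algebra.isSeparable (IntermediateField.topEquiv (F := K) (E := L)),
    (IntermediateField.topEquiv (F := K) (E := L)).toLinearEquiv.finiteDimensional⟩

/-- By Euler's formula the trace dual of w[β] is w[β] divided by the derivative of the minimal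
polynomial at β, and an integral u lies in this dual because traces of integral elements are in w.
-/
theorem exists_aeval_eq_derivative_minpoly_mul [FiniteDimensional K L] [Algebra.IsSeparable K L]
    {β : L} (htop : Algebra.adjoin K {β} = ⊤) (hβ : IsIntegral w β) {u : L}
    (hu : IsIntegral w u) :
    ∃ G : w[X], aeval β G = aeval β (derivative (minpoly w β)) * u := by
  have hmem : u ∈ (Algebra.traceForm K L).dualSubmodule
      (Subalgebra.toSubmodule (Algebra.adjoin w {β})) := by
    rw [LinearMap.BilinForm.mem_dualSubmodule]
    intro y hy
    have hy' : IsIntegral w y := by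
      have : Algebra.adjoin w {β} ≤ integralClosure w L :=
        Algebra.adjoin_le (Set.singleton_subset_iff.2 hβ)
      exact this hy
    have h1 : IsIntegral w (Algebra.trace K L (u * y)) := Algebra.isIntegral_trace (hu.mul hy')
    obtain ⟨a, ha⟩ := IsIntegrallyClosed.isIntegral_iff.1 h1
    rw [Algebra.traceForm_apply, Submodule.mem_one]
    exact ⟨a, ha⟩
  rw [traceForm_dualSubmodule_adjoin w K htop hβ] at hmem
  obtain ⟨y, hy, hyu⟩ := hmem
  rw [SetLike.mem_coe, Subalgebra.mem_toSubmodule, Algebra.adjoin_singleton_eq_range_aeval] at hy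
  obtain ⟨G, rfl⟩ := hy
  refine ⟨G, ?_⟩
  have hne : aeval β (derivative (minpoly K β)) ≠ 0 :=
    (Algebra.IsSeparable.isSeparable K β).aeval_derivative_ne_zero (minpoly.aeval K β)
  have h2 : aeval β (derivative (minpoly w β)) = aeval β (derivative (minpoly K β)) := by
    rw [minpoly.isIntegrallyClosed_eq_field_fractions' K hβ, derivative_map,
      aeval_map_algebraMap]
  rw [h2, ← hyu]
  change _ = _ * ((aeval β (derivative (minpoly K β)))⁻¹ * _)
  rw [mul_inv_cancel_left₀ hne]
  rfl

end Hensel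

/-! ### Unique extension of a valuation to a residually simple root. -/

section ResiduallyLinear

variable {K L : Type*} [Field K] [Field L] [Algebra K L]

/-- `L = K(α)`, where `α` is a root of the irreducible polynomial `Q` over the valuation ring of
`w` whose residue polynomial is linear with a nonzero root. -/
structure IsResiduallyLinearRoot (w : ValuationSubring K) (Q : w[X]) (α : L) : Prop where
  irreducible : Irreducible (Q.map w.subtype)
  aeval_eq_zero : aeval α Q = 0
  adjoin_eq_top : Algebra.adjoin K {α} = ⊤
  natDegree_reduce : (reduce w Q).natDegree = 1
  coeff_zero_ne_zero : (reduce w Q).coeff 0 ≠ 0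

/-- The root of a linear polynomial. -/
def linearRoot {k : Type*} [Field k] (p : k[X]) : k := -(p.coeff 0 / p.coeff 1)

theorem coeff_one_ne_zero {k : Type*} [Field k] {p : k[X]} (hp : p.natDegree = 1) :
    p.coeff 1 ≠ 0 := by
  rw [← hp]
  exact leadingCoeff_ne_zero.2 (by rintro rfl; simp at hp)

theorem eval₂_eq_zero_iff_of_natDegree_eq_one {k l : Type*} [Field k] [Field l] (g : k →+* l)
    {p : k[X]} (hp : p.natDegree = 1) (y : l) :
    p.eval₂ g y = 0 ↔ y = g (linearRoot p) := by
  have h1 : g (p.coeff 1) ≠ 0 := (map_ne_zero g).2 (coeff_one_ne_zero hp)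
  rw [eq_X_add_C_of_natDegree_le_one hp.le]
  simp only [eval₂_add, eval₂_mul, eval₂_C, eval₂_X, linearRoot, map_neg, map_div₀]
  rw [← eq_X_add_C_of_natDegree_le_one hp.le, eq_neg_iff_add_eq_zero]
  field_simp
  rw [mul_zero]

namespace IsResiduallyLinearRoot

variable {w : ValuationSubring K} {Q : w[X]} {α : L}

theorem isPrimitive (hQ : IsResiduallyLinearRoot w Q α) : IsPrimitivePoly w Q := fun h => by
  have := hQ.natDegree_reduce
  rw [h] at this
  simp at this

theorem linearRoot_ne_zero (hQ : IsResiduallyLinearRoot w Q α) :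
    linearRoot (reduce w Q) ≠ 0 :=
  neg_ne_zero.2 (div_ne_zero hQ.coeff_zero_ne_zero (coeff_one_ne_zero hQ.natDegree_reduce))

theorem aeval_map_eq_zero (hQ : IsResiduallyLinearRoot w Q α) :
    aeval α (Q.map w.subtype) = 0 := by
  exact (aeval_map_algebraMap K α Q).trans hQ.aeval_eq_zero

theorem isAlgebraic (hQ : IsResiduallyLinearRoot w Q α) : IsAlgebraic K α :=
  ⟨_, hQ.irreducible.ne_zero, hQ.aeval_map_eq_zero⟩

/-- Since Q is primitive, divisibility over the field descends to the valuation ring. Thus w[α] is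
w[X]/(Q), and maps out of it can be defined by any root of Q. -/
theorem dvd_of_aeval_eq_zero (hQ : IsResiduallyLinearRoot w Q α) {G : w[X]}
    (hG : aeval α G = 0) : Q ∣ G := by
  apply dvd_of_map_dvd_map w hQ.isPrimitive
  refine Dvd.dvd.trans ?_ (minpoly.dvd K α (p := G.map w.subtype) ?_)
  · exact Dvd.intro _ (minpoly.eq_of_irreducible hQ.irreducible hQ.aeval_map_eq_zero)
  · exact (aeval_map_algebraMap K α G).trans hG

theorem resid_eq (hQ : IsResiduallyLinearRoot w Q α) {W : ValuationSubring L}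
    (h : IsExtension w W) (hα : α ∈ W) :
    resid W α = residueMap w W h (linearRoot (reduce w Q)) := by
  rw [← eval₂_eq_zero_iff_of_natDegree_eq_one _ hQ.natDegree_reduce,
    eval₂_residueMap_resid h Q hα]
  have := hQ.aeval_eq_zero
  rw [aeval_def] at this
  exact (congrArg (resid W) this).trans (resid_zero W)

theorem ne_zero (hQ : IsResiduallyLinearRoot w Q α) : α ≠ 0 := by
  rintro rfl
  have h := hQ.aeval_eq_zero
  rw [← coeff_zero_eq_aeval_zero'] at h
  have h0 : ((Q.coeff 0 : w) : K) = 0 := (algebraMap K L).injective (by rw [map_zero]; exact h)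
  apply hQ.coeff_zero_ne_zero
  rw [reduce_coeff, h0, resid_zero]

/-- Sending α to the root of the reduction of Q is a well defined homomorphism from w[α] to the
residue field of w; Chevalley's theorem yields a valuation ring in which its kernel consists of
nonunits. -/
theorem exists_extension (hQ : IsResiduallyLinearRoot w Q α) :
    ∃ W : ValuationSubring L, IsExtension w W ∧ W.valuation α = 1 := by
  let φ : w[X] →+* L := (aeval α : w[X] →ₐ[w] L).toRingHom
  let ψ : w[X] →+* IsLocalRing.ResidueField w :=
    (evalRingHom (linearRoot (reduce w Q))).comp (mapRingHom (IsLocalRing.residue w))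
  have hψQ : ψ Q = 0 := by
    have := (eval₂_eq_zero_iff_of_natDegree_eq_one (RingHom.id _) hQ.natDegree_reduce
      (linearRoot (reduce w Q))).2 rfl
    exact this
  have hker : ∀ G, φ G = 0 → ψ G = 0 := by
    intro G hG
    obtain ⟨H, rfl⟩ := hQ.dvd_of_aeval_eq_zero hG
    rw [map_mul, hψQ, zero_mul]
  let I : Ideal φ.range := Ideal.map φ.rangeRestrict (RingHom.ker ψ)
  have hmemI : ∀ G : w[X], ψ G = 0 → φ.rangeRestrict G ∈ I := fun G hG =>
    Ideal.mem_map_of_mem _ ((RingHom.mem_ker).2 hG)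
  have hI : I ≠ ⊤ := by
    intro hI
    have h1 : (1 : φ.range) ∈ I := by rw [hI]; trivial
    obtain ⟨G, hG, hG1⟩ := (Ideal.mem_map_iff_of_surjective _ φ.rangeRestrict_surjective).1 h1
    have h2 : φ G = 1 := congrArg Subtype.val hG1
    have h3 := hker (G - 1) (by rw [map_sub, h2, map_one, sub_self])
    rw [map_sub, map_one, (RingHom.mem_ker).1 hG] at h3
    simp at h3
  obtain ⟨W, hW, hIW⟩ := Ideal.image_subset_nonunits_valuationSubring I hI
  have hmem : ∀ a ∈ w, algebraMap K L a ∈ W := fun a ha =>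
    hW ⟨C ⟨a, ha⟩, aeval_C (R := w) (A := L) α ⟨a, ha⟩⟩
  have hlt : ∀ G, ψ G = 0 → W.valuation (φ G) < 1 := fun G hG =>
    (ValuationSubring.mem_nonunits_iff W).1 (hIW ⟨_, hmemI G hG, rfl⟩)
  -- The inverse of an element outside w has residue zero, hence is a nonunit of W, so W meets K in
  -- nothing more than w.
  have hext : IsExtension w W := by
    ext a
    rw [ValuationSubring.mem_comap]
    refine ⟨fun h => ?_, hmem a⟩
    by_contra ha
    have ha0 : a ≠ 0 := fun h0 => ha (h0 ▸ zero_mem w)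
    have hinv : a⁻¹ ∈ w := (w.mem_or_inv_mem a).resolve_left ha
    have hr : resid w a⁻¹ = 0 := by
      by_contra hne
      have h1 := valuation_inv_eq_one w ((resid_ne_zero_iff w).1 hne)
      rw [inv_inv] at h1
      exact ha (mem_of_valuation_eq_one w h1)
    have h2 := hlt (C ⟨a⁻¹, hinv⟩) (by
      simp only [ψ, RingHom.comp_apply, coe_mapRingHom, map_C, coe_evalRingHom, eval_C]
      rw [residue_eq_resid]; exact hr)
    have h3 : φ (C ⟨a⁻¹, hinv⟩) = (algebraMap K L a)⁻¹ := by
      rw [← map_inv₀]; exact aeval_C (R := w) (A := L) α ⟨a⁻¹, hinv⟩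
    rw [h3, map_inv₀] at h2
    have h4 := (W.valuation_le_one_iff _).2 h
    have hpos : W.valuation (algebraMap K L a) ≠ 0 :=
      (Valuation.ne_zero_iff _).2 ((_root_.map_ne_zero _).2 ha0)
    have h5 := mul_lt_one_of_lt_of_le h2 h4
    rw [inv_mul_cancel₀ hpos] at h5
    exact lt_irrefl _ h5
  refine ⟨W, hext, ?_⟩
  -- A lift g of the root is a unit, and α differs from it by an element of valuation less than one.
  obtain ⟨g, hg⟩ := IsLocalRing.residue_surjective (linearRoot (reduce w Q))
  have h1 := hlt (X - C g) (by simp [ψ, hg])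
  have h2 : φ (X - C g) = α - algebraMap K L g := by
    rw [map_sub]
    exact congrArg₂ (· - ·) (aeval_X (R := w) α) (aeval_C (R := w) (A := L) α g)
  rw [h2] at h1
  have h3 : W.valuation (algebraMap K L g) = 1 := by
    rw [hext.valuation_eq_one_iff, ← resid_ne_zero_iff, ← residue_eq_resid, hg]
    exact hQ.linearRoot_ne_zero
  have h4 := Valuation.map_eq_of_sub_lt W.valuation (x := algebraMap K L g) (y := α)
    (by rw [h3]; exact h1)
  rw [h4, h3]

/-- The linear coefficient of Q is a unit, so the derivative of Q is not zero. -/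
theorem isSeparable (hQ : IsResiduallyLinearRoot w Q α) : IsSeparable K α := by
  have hder : derivative (Q.map w.subtype) ≠ 0 := by
    intro h0
    have h1 : (Q.coeff 1 : K) = 0 := by
      simpa [coeff_derivative] using congrArg (fun p => p.coeff 0) h0
    apply coeff_one_ne_zero hQ.natDegree_reduce
    rw [reduce_coeff, h1, resid_zero]
  exact ((separable_iff_derivative_ne_zero hQ.irreducible).2 hder).of_dvd
    (minpoly.dvd K α hQ.aeval_map_eq_zero)

theorem adjoin_inv_eq_top (hQ : IsResiduallyLinearRoot w Q α) :
    Algebra.adjoin K {α⁻¹} = ⊤ := by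
  have h1 : IsAlgebraic K α⁻¹ := hQ.isAlgebraic.inv
  rw [← IntermediateField.adjoin_simple_toSubalgebra_of_isAlgebraic h1, eq_top_iff,
    ← hQ.adjoin_eq_top]
  refine Algebra.adjoin_le (Set.singleton_subset_iff.2 ?_)
  change α ∈ IntermediateField.adjoin K {α⁻¹}
  have := inv_mem (IntermediateField.mem_adjoin_simple_self K α⁻¹)
  rwa [inv_inv] at this

/-- The reversed polynomial of Q, divided by the unit Q(0), is monic with root α⁻¹. The element α
itself need not be integral, as the leading coefficient of Q may be a nonunit. -/
theorem exists_monic (hQ : IsResiduallyLinearRoot w Q α) :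
    ∃ P : w[X], P.Monic ∧ aeval α⁻¹ P = 0 ∧
      ∃ n : ℕ, ∃ a : IsLocalRing.ResidueField w, reduce w P = X ^ n * (X + C a) := by
  have hu : IsUnit (Q.coeff 0) := by
    rw [← IsLocalRing.residue_ne_zero_iff_isUnit, residue_eq_resid, ← reduce_coeff]
    exact hQ.coeff_zero_ne_zero
  obtain ⟨c, hc⟩ := hu.exists_left_inv
  obtain ⟨n, hn⟩ : ∃ n, Q.natDegree = n + 1 := by
    refine Nat.exists_eq_succ_of_ne_zero fun h0 => ?_
    have : (reduce w Q).natDegree ≤ Q.natDegree := natDegree_map_le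
    rw [hQ.natDegree_reduce, h0] at this
    omega
  have hα0 := hQ.ne_zero
  refine ⟨X ^ (n + 1) + ∑ i ∈ Finset.range (n + 1), C (c * Q.coeff (i + 1)) * X ^ (n - i),
    monic_X_pow_add ?_, ?_, n, IsLocalRing.residue w (c * Q.coeff 1), ?_⟩
  · refine lt_of_le_of_lt (degree_sum_le _ _) ((Finset.sup_lt_iff (WithBot.bot_lt_coe _)).2 ?_)
    intro i _
    refine (degree_C_mul_X_pow_le _ _).trans_lt ?_
    exact_mod_cast (by omega : n - i < n + 1)
  · have h1 : algebraMap w L c * aeval α Q = 0 := by rw [hQ.aeval_eq_zero, mul_zero]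
    rw [aeval_eq_sum_range, hn, Finset.sum_range_succ', mul_add, Finset.mul_sum] at h1
    have h2 : algebraMap w L c * (Q.coeff 0 • α ^ 0) = 1 := by
      rw [pow_zero, Algebra.smul_def, mul_one, ← map_mul, hc, map_one]
    rw [h2] at h1
    have h3 : aeval α⁻¹ (X ^ (n + 1) +
        ∑ i ∈ Finset.range (n + 1), C (c * Q.coeff (i + 1)) * X ^ (n - i)) =
        α⁻¹ ^ (n + 1) * (∑ i ∈ Finset.range (n + 1),
          algebraMap w L c * (Q.coeff (i + 1) • α ^ (i + 1)) + 1) := by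
      rw [mul_add, mul_one, add_comm, map_add, map_pow, aeval_X, map_sum, Finset.mul_sum]
      congr 1
      refine Finset.sum_congr rfl fun i hi => ?_
      have hi' : i ≤ n := by have := Finset.mem_range.1 hi; omega
      have h4 : α ^ (n + 1) = α ^ (n - i) * α ^ (i + 1) := by rw [← pow_add]; congr 1; omega
      rw [map_mul, aeval_C, map_pow, aeval_X, map_mul, Algebra.smul_def, inv_pow, inv_pow, h4]
      field_simp
    rw [h3, h1, mul_zero]
  · have h0 : ∀ i, IsLocalRing.residue w (Q.coeff (i + 2)) = 0 := fun i => by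
      rw [residue_eq_resid, ← reduce_coeff]
      exact coeff_eq_zero_of_natDegree_lt (by rw [hQ.natDegree_reduce]; omega)
    rw [reduce, Polynomial.map_add, Polynomial.map_pow, map_X, Polynomial.map_sum,
      Finset.sum_range_succ', Finset.sum_eq_zero]
    · simp only [Polynomial.map_mul, map_C, Polynomial.map_pow, map_X, zero_add, Nat.sub_zero]
      ring
    · intro i _
      rw [Polynomial.map_mul, map_C, map_mul, h0]
      simp

/-- The residue of α⁻¹ is nonzero, so it is a simple root of X^n(X + a). The derivative of P at α⁻¹
is therefore a unit, and it is a multiple of the derivative of the minimal polynomial. -/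
theorem valuation_derivative_minpoly (hQ : IsResiduallyLinearRoot w Q α)
    {W : ValuationSubring L} (h : IsExtension w W) (hα : W.valuation α = 1) :
    W.valuation (aeval α⁻¹ (derivative (minpoly w α⁻¹))) = 1 := by
  obtain ⟨P, hPm, hP0, n, a, hP⟩ := hQ.exists_monic
  have hint : IsIntegral w α⁻¹ := ⟨P, hPm, hP0⟩
  obtain ⟨N, hN⟩ := minpoly.isIntegrallyClosed_dvd hint hP0
  have hβ : W.valuation α⁻¹ = 1 := valuation_inv_eq_one W hα
  have hβm := mem_of_valuation_eq_one W hβ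
  have hmem : ∀ G : w[X], aeval α⁻¹ G ∈ W := by
    intro G
    rw [aeval_eq_sum_range]
    refine sum_mem fun i _ => ?_
    rw [Algebra.smul_def]
    exact mul_mem ((h.mem_iff _).2 (G.coeff i).2) (pow_mem hβm i)
  have hres : ∀ G : w[X], resid W (aeval α⁻¹ G) =
      (reduce w G).eval₂ (residueMap w W h) (resid W α⁻¹) := fun G =>
    (eval₂_residueMap_resid h G hβm).symm
  have hb0 : resid W α⁻¹ ≠ 0 := (resid_ne_zero_iff W).2 hβ
  have hroot : resid W α⁻¹ + residueMap w W h a = 0 := by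
    have h1 := hres P
    rw [hP0, resid_zero, hP, eval₂_mul, eval₂_pow, eval₂_add, eval₂_X, eval₂_C] at h1
    exact (mul_eq_zero.1 h1.symm).resolve_left (pow_ne_zero _ hb0)
  have hder : resid W (aeval α⁻¹ (derivative P)) ≠ 0 := by
    rw [hres, reduce, ← derivative_map]
    change eval₂ _ _ (derivative (reduce w P)) ≠ 0
    rw [hP, derivative_mul, eval₂_add, eval₂_mul, eval₂_mul, eval₂_add, eval₂_X, eval₂_C, hroot]
    simpa using pow_ne_zero n hb0
  rw [← resid_ne_zero_iff]
  intro h0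
  apply hder
  rw [hN, derivative_mul, map_add, map_mul, map_mul, minpoly.aeval, zero_mul, add_zero,
    resid_mul W (hmem _) (hmem _), h0, zero_mul]

theorem isIntegral_inv (hQ : IsResiduallyLinearRoot w Q α) : IsIntegral w α⁻¹ := by
  obtain ⟨P, hPm, hP0, -⟩ := hQ.exists_monic
  exact ⟨P, hPm, hP0⟩

/-- The residues of an element integral over `w` are given by the same element of the residue
field of `w` in all extensions in which `α` is a unit. -/
theorem exists_resid_of_isIntegral (hQ : IsResiduallyLinearRoot w Q α) {u : L}
    (hu : IsIntegral w u) :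
    ∃ G : w[X], ∀ W : ValuationSubring L, ∀ h : IsExtension w W, W.valuation α = 1 →
      u ∈ W ∧ residueMap w W h ((reduce w G).eval (linearRoot (reduce w Q))⁻¹) =
        resid W (aeval α⁻¹ (derivative (minpoly w α⁻¹))) * resid W u := by
  obtain ⟨_, _⟩ := isSeparable_of_adjoin_eq_top hQ.adjoin_eq_top hQ.isSeparable
  -- G writes u times the derivative as a polynomial in α⁻¹; its residue depends only on that of
  -- α⁻¹, which is the same for all W.
  obtain ⟨G, hG⟩ := exists_aeval_eq_derivative_minpoly_mul w hQ.adjoin_inv_eq_top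
    hQ.isIntegral_inv hu
  refine ⟨G, fun W h hα => ?_⟩
  have huW : u ∈ W := by
    obtain ⟨p, hpm, hp0⟩ := hu
    have : IsIntegral W u := by
      refine ⟨p.map (ringMap w W h), hpm.map _, ?_⟩
      rw [eval₂_map, ← hp0]
      rfl
    obtain ⟨y, hy⟩ := IsIntegrallyClosed.isIntegral_iff.1 this
    exact hy ▸ y.2
  refine ⟨huW, ?_⟩
  rw [← resid_mul W (mem_of_valuation_eq_one W (hQ.valuation_derivative_minpoly h hα)) huW, ← hG]
  have h2 := hQ.resid_eq h (mem_of_valuation_eq_one W hα)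
  have h3 := valuation_inv_eq_one W hα
  rw [← eval₂_at_apply, map_inv₀, ← h2, ← resid_inv W hα,
    eval₂_residueMap_resid h G (mem_of_valuation_eq_one W h3)]
  rfl

/-- Membership of x is decided by whether the integral element u is a unit, that is, by one element
of the residue field of w that does not depend on the extension. -/
theorem extension_le (hQ : IsResiduallyLinearRoot w Q α) {W₁ W₂ : ValuationSubring L}
    (h₁ : IsExtension w W₁) (h₂ : IsExtension w W₂) (hα₁ : W₁.valuation α = 1)
    (hα₂ : W₂.valuation α = 1) : W₁ ≤ W₂ := by
  intro x hx
  obtain ⟨_, _⟩ := isSeparable_of_adjoin_eq_top hQ.adjoin_eq_top hQ.isSeparable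
  obtain ⟨u, hu, -, hux⟩ := exists_integral_horner w (Algebra.IsAlgebraic.isAlgebraic (R := K) x)
  obtain ⟨G, hG⟩ := hQ.exists_resid_of_isIntegral hu
  rw [← hux W₂ h₂]
  have hu₁ := (hux W₁ h₁).2 hx
  obtain ⟨-, hG₁⟩ := hG W₁ h₁ hα₁
  obtain ⟨-, hG₂⟩ := hG W₂ h₂ hα₂
  rw [← resid_ne_zero_iff] at hu₁ ⊢
  intro h0
  rw [h0, mul_zero, map_eq_zero] at hG₂
  rw [hG₂, map_zero] at hG₁
  exact mul_ne_zero ((resid_ne_zero_iff W₁).2 (hQ.valuation_derivative_minpoly h₁ hα₁)) hu₁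
    hG₁.symm

theorem existsUnique_extension (hQ : IsResiduallyLinearRoot w Q α) :
    ∃! W : ValuationSubring L, IsExtension w W ∧ W.valuation α = 1 := by
  obtain ⟨W, h, hα⟩ := hQ.exists_extension
  exact ⟨W, ⟨h, hα⟩, fun W' ⟨h', hα'⟩ =>
    le_antisymm (hQ.extension_le h' h hα' hα) (hQ.extension_le h h' hα hα')⟩

/-- The residue of x is the quotient of those of ux and u; in it the unknown residue of the
derivative cancels. -/
theorem residueMap_surjective (hQ : IsResiduallyLinearRoot w Q α) {W : ValuationSubring L}
    (h : IsExtension w W) (hα : W.valuation α = 1) :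
    Function.Surjective (residueMap w W h) := by
  intro y
  obtain ⟨x, hx, rfl⟩ := exists_resid_eq W y
  obtain ⟨_, _⟩ := isSeparable_of_adjoin_eq_top hQ.adjoin_eq_top hQ.isSeparable
  obtain ⟨u, hu, hu', hux⟩ :=
    exists_integral_horner w (Algebra.IsAlgebraic.isAlgebraic (R := K) x)
  obtain ⟨G, hG⟩ := hQ.exists_resid_of_isIntegral hu
  obtain ⟨G', hG'⟩ := hQ.exists_resid_of_isIntegral hu'
  obtain ⟨huW, hG⟩ := hG W h hα
  obtain ⟨-, hG'⟩ := hG' W h hα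
  have hu1 := (resid_ne_zero_iff W).2 ((hux W h).2 hx)
  have hd := (resid_ne_zero_iff W).2 (hQ.valuation_derivative_minpoly h hα)
  rw [resid_mul W huW hx, ← mul_assoc, ← hG] at hG'
  have hne : residueMap w W h ((reduce w G).eval (linearRoot (reduce w Q))⁻¹) ≠ 0 := by
    rw [hG]; exact mul_ne_zero hd hu1
  exact ⟨(reduce w G').eval (linearRoot (reduce w Q))⁻¹ / (reduce w G).eval (linearRoot (reduce w Q))⁻¹,
    by rw [map_div₀, hG', mul_div_cancel_left₀ _ hne]⟩

end IsResiduallyLinearRoot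
end ResiduallyLinear

/-! ### Equality up to a factor of residue one. -/

section Sim

variable {L : Type*} [Field L] (W : ValuationSubring L)

/-- `a` and `b` differ by a factor with residue one. -/
def Sim (a b : L) : Prop := resid W (a / b) = 1

variable {W}

theorem Sim.valuation_div {a b : L} (h : Sim W a b) : W.valuation (a / b) = 1 :=
  (resid_ne_zero_iff W).1 (by rw [h]; exact one_ne_zero)

theorem Sim.left_ne_zero {a b : L} (h : Sim W a b) : a ≠ 0 := by
  rintro rfl; simpa using h.valuation_div

theorem Sim.right_ne_zero {a b : L} (h : Sim W a b) : b ≠ 0 := by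
  rintro rfl; simpa using h.valuation_div

theorem Sim.refl {a : L} (ha : a ≠ 0) : Sim W a a := by
  rw [Sim, div_self ha, resid_one]

theorem Sim.valuation_eq {a b : L} (h : Sim W a b) : W.valuation a = W.valuation b := by
  have := h.valuation_div
  rwa [map_div₀, div_eq_one_iff_eq ((Valuation.ne_zero_iff _).2 h.right_ne_zero)] at this

theorem Sim.mul {a b c d : L} (h : Sim W a b) (h' : Sim W c d) : Sim W (a * c) (b * d) := by
  rw [Sim, mul_div_mul_comm, resid_mul W (mem_of_valuation_eq_one W h.valuation_div)
    (mem_of_valuation_eq_one W h'.valuation_div), h, h', one_mul]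

theorem Sim.inv {a b : L} (h : Sim W a b) : Sim W a⁻¹ b⁻¹ := by
  rw [Sim, show a⁻¹ / b⁻¹ = (a / b)⁻¹ by rw [inv_div_inv, inv_div], resid_inv W h.valuation_div,
    h, inv_one]

theorem Sim.symm {a b : L} (h : Sim W a b) : Sim W b a := by
  rw [Sim, ← inv_div, resid_inv W h.valuation_div, h, inv_one]

theorem Sim.trans {a b c : L} (h : Sim W a b) (h' : Sim W b c) : Sim W a c := by
  rw [Sim, ← div_mul_div_cancel₀ h.right_ne_zero,
    resid_mul W (mem_of_valuation_eq_one W h.valuation_div)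
    (mem_of_valuation_eq_one W h'.valuation_div), h, h', one_mul]

theorem Sim.resid_eq {a b : L} (h : Sim W a b) (hb : W.valuation b = 1) :
    resid W a = resid W b := by
  rw [← div_mul_cancel₀ a h.right_ne_zero, resid_mul W
    (mem_of_valuation_eq_one W h.valuation_div) (mem_of_valuation_eq_one W hb), h, one_mul]

theorem Sim.of_sub {a b : L} (h : W.valuation (a - b) < W.valuation b) : Sim W a b := by
  have hb : b ≠ 0 := by rintro rfl; simp at h
  have h1 : W.valuation (a / b - 1) < 1 := by
    rw [div_sub_one hb, map_div₀]
    exact (div_lt_one₀ (zero_lt_iff.2 ((Valuation.ne_zero_iff _).2 hb))).2 h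
  have h2 : a / b ∈ W := by
    have := add_mem (mem_of_valuation_lt_one W h1) (one_mem W)
    rwa [sub_add_cancel] at this
  rw [Sim, ← resid_one W, resid_eq_iff W h2 (one_mem W)]
  exact h1

end Sim

/-! ### Elements that are residually algebraic after a power and a scaling. -/

section ResiduallyAlgebraic

variable {K L : Type*} [Field K] [Field L] [Algebra K L] (v : ValuationSubring K)
  (W : ValuationSubring L) [Algebra (IsLocalRing.ResidueField v) (IsLocalRing.ResidueField W)]

/-- Some power of `a` becomes, after scaling by a constant, a unit with algebraic residue. -/
def ResiduallyAlgebraic (a : L) : Prop :=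
  ∃ m : ℕ, 0 < m ∧ ∃ c : K, W.valuation (a ^ m * algebraMap K L c) = 1 ∧
    IsAlgebraic (IsLocalRing.ResidueField v) (resid W (a ^ m * algebraMap K L c))

/-- The algebra structure on the residue field is the one coming from the extension of
valuations. -/
structure IsResidueAlgebra : Prop where
  isExtension : IsExtension v W
  algebraMap_resid : ∀ a ∈ v, algebraMap (IsLocalRing.ResidueField v)
    (IsLocalRing.ResidueField W) (resid v a) = resid W (algebraMap K L a)

variable {v W}

namespace ResiduallyAlgebraic

theorem ne_zero {a : L} (h : ResiduallyAlgebraic v W a) : a ≠ 0 := by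
  obtain ⟨m, hm, c, h1, -⟩ := h
  rintro rfl
  simp [hm.ne'] at h1

theorem algebraMap_of_ne_zero {c : K} (hc : c ≠ 0) :
    ResiduallyAlgebraic v W (algebraMap K L c) := by
  have : algebraMap K L c ^ 1 * algebraMap K L c⁻¹ = 1 := by
    rw [pow_one, ← map_mul, mul_inv_cancel₀ hc, map_one]
  refine ⟨1, one_pos, c⁻¹, ?_, ?_⟩
  · rw [this, map_one]
  · rw [this, resid_one]; exact isAlgebraic_one

theorem mul {a b : L} (ha : ResiduallyAlgebraic v W a) (hb : ResiduallyAlgebraic v W b) :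
    ResiduallyAlgebraic v W (a * b) := by
  obtain ⟨m, hm, c, h1, h2⟩ := ha
  obtain ⟨n, hn, d, h3, h4⟩ := hb
  have key : (a * b) ^ (m * n) * algebraMap K L (c ^ n * d ^ m) =
      (a ^ m * algebraMap K L c) ^ n * (b ^ n * algebraMap K L d) ^ m := by
    rw [map_mul, map_pow, map_pow]; ring
  refine ⟨m * n, Nat.mul_pos hm hn, c ^ n * d ^ m, ?_, ?_⟩
  · rw [key, map_mul, map_pow, map_pow, h1, h3, one_pow, one_pow, one_mul]
  · have h1' := mem_of_valuation_eq_one W h1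
    have h3' := mem_of_valuation_eq_one W h3
    rw [key, resid_mul W (pow_mem h1' _) (pow_mem h3' _), resid_pow W h1', resid_pow W h3']
    exact (h2.pow n).mul (h4.pow m)

theorem inv {a : L} (ha : ResiduallyAlgebraic v W a) : ResiduallyAlgebraic v W a⁻¹ := by
  obtain ⟨m, hm, c, h1, h2⟩ := ha
  have key : a⁻¹ ^ m * algebraMap K L c⁻¹ = (a ^ m * algebraMap K L c)⁻¹ := by
    rw [map_inv₀, mul_inv, inv_pow]
  refine ⟨m, hm, c⁻¹, ?_, ?_⟩
  · rw [key, map_inv₀, h1, inv_one]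
  · rw [key, resid_inv W h1]; exact h2.inv

theorem of_sim {a b : L} (ha : ResiduallyAlgebraic v W a) (h : Sim W b a) :
    ResiduallyAlgebraic v W b := by
  obtain ⟨m, hm, c, h1, h2⟩ := ha
  have key : b ^ m * algebraMap K L c = (b / a) ^ m * (a ^ m * algebraMap K L c) := by
    rw [div_pow, ← mul_assoc, div_mul_cancel₀ _ (pow_ne_zero m h.right_ne_zero)]
  have h3 := mem_of_valuation_eq_one W h.valuation_div
  refine ⟨m, hm, c, ?_, ?_⟩
  · rw [key, map_mul, map_pow, h.valuation_div, one_pow, one_mul, h1]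
  · rw [key, resid_mul W (pow_mem h3 _) (mem_of_valuation_eq_one W h1), resid_pow W h3, h,
      one_pow, one_mul]
    exact h2

theorem of_pow {a : L} {e : ℕ} (he : 0 < e) (h : ResiduallyAlgebraic v W (a ^ e)) :
    ResiduallyAlgebraic v W a := by
  obtain ⟨m, hm, c, h1, h2⟩ := h
  rw [← pow_mul] at h1 h2
  exact ⟨e * m, Nat.mul_pos he hm, c, h1, h2⟩

theorem of_isAlgebraic {a : L} (h1 : W.valuation a = 1)
    (h2 : IsAlgebraic (IsLocalRing.ResidueField v) (resid W a)) : ResiduallyAlgebraic v W a :=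
  ⟨1, one_pos, 1, by simpa using h1, by simpa using h2⟩

theorem neg {a : L} (ha : ResiduallyAlgebraic v W a) : ResiduallyAlgebraic v W (-a) := by
  have := (algebraMap_of_ne_zero (v := v) (W := W) (neg_ne_zero.2 (one_ne_zero (α := K)))).mul ha
  simpa using this

theorem isAlgebraic (hk : IsResidueAlgebra v W) {a : L} (h : ResiduallyAlgebraic v W a)
    (h1 : W.valuation a = 1) : IsAlgebraic (IsLocalRing.ResidueField v) (resid W a) := by
  obtain ⟨m, hm, c, h2, h3⟩ := h
  rw [map_mul, map_pow, h1, one_pow, one_mul] at h2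
  have hc := (hk.isExtension.valuation_eq_one_iff c).1 h2
  have ha := mem_of_valuation_eq_one W h1
  rw [resid_mul W (pow_mem ha m) (mem_of_valuation_eq_one W h2), resid_pow W ha] at h3
  have hc0 := (resid_ne_zero_iff W).2 h2
  have h4 : IsAlgebraic (IsLocalRing.ResidueField v) (resid W (algebraMap K L c)) := by
    rw [← hk.algebraMap_resid c (mem_of_valuation_eq_one v hc)]
    exact isAlgebraic_algebraMap _
  refine IsAlgebraic.of_pow hm ?_
  have := h3.mul h4.inv
  rwa [mul_assoc, mul_inv_cancel₀ hc0, mul_one] at this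

/-- Put T = bF, which is not residually algebraic. If T were not strictly dominated by c, then
either T agrees with -a up to residue one, or T/c is a unit whose residue is 1 minus the algebraic
residue of a/c. Both make T residually algebraic. -/
theorem valuation_lt (hk : IsResidueAlgebra v W) {a b c F : L}
    (ha : a = 0 ∨ ResiduallyAlgebraic v W a) (hb : ResiduallyAlgebraic v W b)
    (hc : ResiduallyAlgebraic v W c) (hF0 : F ≠ 0) (hF : ¬ ResiduallyAlgebraic v W F)
    (h : c = a + b * F) : W.valuation (b * F) < W.valuation c := by
  set T := b * F with hT
  have hT0 : T ≠ 0 := mul_ne_zero hb.ne_zero hF0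
  have hTF : ¬ ResiduallyAlgebraic v W T := fun h' => hF (by
    have := hb.inv.mul h'
    rwa [hT, inv_mul_cancel_left₀ hb.ne_zero] at this)
  by_contra hle
  rw [not_lt] at hle
  have hpos : W.valuation T ≠ 0 := (Valuation.ne_zero_iff _).2 hT0
  have hcT : c / T ∈ W := by
    rw [← W.valuation_le_one_iff, map_div₀]
    exact div_le_one_of_le₀ hle zero_le
  have haT : -a / T = 1 - c / T := by rw [h]; field_simp; ring
  by_cases h0 : resid W (c / T) = 0
  · have h1 : Sim W (-a) T := by
      rw [Sim, haT, resid_sub W (one_mem W) hcT, h0, sub_zero, resid_one]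
    have ha0 : a ≠ 0 := fun h0 => h1.left_ne_zero (by simp [h0])
    exact hTF (((ha.resolve_left ha0).neg).of_sim h1.symm)
  · have h1 : W.valuation (c / T) = 1 := (resid_ne_zero_iff W).1 h0
    have h2 : W.valuation (T / c) = 1 := by rw [← inv_div, map_inv₀, h1, inv_one]
    have h2' := mem_of_valuation_eq_one W h2
    have h3 : a / c = 1 - T / c := by
      have := hc.ne_zero
      rw [eq_sub_iff_add_eq, ← add_div, ← h, div_self this]
    have h4 : a / c ∈ W := h3 ▸ sub_mem (one_mem W) h2'
    have h5 : IsAlgebraic (IsLocalRing.ResidueField v) (resid W (a / c)) := by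
      rcases ha with rfl | ha
      · simpa using isAlgebraic_zero
      by_cases h6 : resid W (a / c) = 0
      · rw [h6]; exact isAlgebraic_zero
      · rw [div_eq_mul_inv] at h6 ⊢
        exact (ha.mul hc.inv).isAlgebraic hk ((resid_ne_zero_iff W).1 h6)
    have h6 : IsAlgebraic (IsLocalRing.ResidueField v) (resid W (T / c)) := by
      have h7 : T / c = 1 - a / c := by rw [h3]; ring
      rw [h7, resid_sub W (one_mem W) h4, resid_one]
      exact isAlgebraic_one.sub h5
    have h8 := (of_isAlgebraic h2 h6).mul hc
    rw [div_mul_cancel₀ _ hc.ne_zero] at h8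
    exact hTF h8

end ResiduallyAlgebraic

end ResiduallyAlgebraic

/-! ### Key polynomials and the field of low residues. -/

section KeyPolynomial

variable {K L : Type*} [Field K] [Field L] [Algebra K L] (v : ValuationSubring K)
  (W : ValuationSubring L) [Algebra (IsLocalRing.ResidueField v) (IsLocalRing.ResidueField W)]

/-- `f` has least degree among the polynomials whose value at `x` is not residually algebraic. -/
structure IsKeyPolynomial (x : L) (f : K[X]) : Prop where
  isResidueAlgebra : IsResidueAlgebra v W
  transcendental : Transcendental K x
  ne_zero : f ≠ 0
  not_residuallyAlgebraic : ¬ ResiduallyAlgebraic v W (aeval x f)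
  residuallyAlgebraic : ∀ g : K[X], g ≠ 0 → g.degree < f.degree →
    ResiduallyAlgebraic v W (aeval x g)

/-- `a` agrees up to a factor of residue one with a polynomial of degree less than that of `f`. -/
def Low {K L : Type*} [Field K] [Field L] [Algebra K L] (W : ValuationSubring L) (x : L)
    (f : K[X]) (a : L) : Prop :=
  ∃ g : K[X], g ≠ 0 ∧ g.degree < f.degree ∧ Sim W a (aeval x g)

variable {v W}

theorem natDegree_div_lt {f P : K[X]} (hf : 0 < f.natDegree) (hP : P.natDegree < 2 * f.natDegree) :
    (P / f).natDegree < f.natDegree := by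
  have hf0 : f ≠ 0 := by rintro rfl; simp at hf
  by_cases hq : P / f = 0
  · simpa [hq] using hf
  have h1 : (f * (P / f)).natDegree < 2 * f.natDegree := by
    rw [eq_sub_of_add_eq (EuclideanDomain.div_add_mod P f)]
    refine (natDegree_sub_le _ _).trans_lt (max_lt hP ?_)
    exact (natDegree_mod_lt P hf.ne').trans (by omega)
  rw [natDegree_mul hf0 hq] at h1
  omega

/-- Residually algebraic elements are closed under quotients, so a transcendental residue in K(x)
requires a polynomial that is not residually algebraic. The final alternative is used later to write
x itself in normal form. -/
theorem exists_isKeyPolynomial {x : L} (hk : IsResidueAlgebra v W) (hx : Transcendental K x)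
    (hu : ∃ u ∈ IntermediateField.adjoin K {x},
      ¬ IsAlgebraic (IsLocalRing.ResidueField v) (resid W u)) :
    ∃ f : K[X], IsKeyPolynomial v W x f ∧ (ResiduallyAlgebraic v W x ∨ f = X) := by
  have hex : ∃ f : K[X], f ≠ 0 ∧ ¬ ResiduallyAlgebraic v W (aeval x f) := by
    by_contra! hall
    obtain ⟨u, hu, hualg⟩ := hu
    have hu0 : resid W u ≠ 0 := fun h0 => hualg (h0 ▸ isAlgebraic_zero)
    have hu1 := (resid_ne_zero_iff W).1 hu0
    obtain ⟨r, s, rfl⟩ := (IntermediateField.mem_adjoin_simple_iff K u).1 hu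
    have hr : r ≠ 0 := by rintro rfl; simp at hu0
    have hs : s ≠ 0 := by rintro rfl; simp at hu0
    apply hualg
    rw [div_eq_mul_inv] at hu1 ⊢
    exact ((hall r hr).mul (hall s hs).inv).isAlgebraic hk hu1
  by_cases hxa : ResiduallyAlgebraic v W x
  · obtain ⟨f, hf, hmin⟩ := WellFounded.has_min (measure (natDegree (R := K))).wf
      {f | f ≠ 0 ∧ ¬ ResiduallyAlgebraic v W (aeval x f)} hex
    refine ⟨f, ⟨hk, hx, hf.1, hf.2, fun g hg0 hg => ?_⟩, Or.inl hxa⟩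
    by_contra hga
    exact hmin g ⟨hg0, hga⟩ (natDegree_lt_natDegree hg0 hg)
  · refine ⟨X, ⟨hk, hx, X_ne_zero, by simpa using hxa, fun g hg0 hg => ?_⟩, Or.inr rfl⟩
    have hdeg := natDegree_lt_natDegree hg0 hg
    rw [natDegree_X, Nat.lt_one_iff] at hdeg
    obtain ⟨c, rfl⟩ := natDegree_eq_zero.1 hdeg
    rw [aeval_C]
    exact ResiduallyAlgebraic.algebraMap_of_ne_zero (fun hc => hg0 (by rw [hc, map_zero]))

namespace IsKeyPolynomial

variable {x : L} {f : K[X]}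

theorem aeval_ne_zero (hf : IsKeyPolynomial v W x f) {g : K[X]} (hg : g ≠ 0) :
    aeval x g ≠ 0 := fun h => hf.transcendental ⟨g, hg, h⟩

theorem natDegree_pos (hf : IsKeyPolynomial v W x f) : 0 < f.natDegree := by
  rw [Nat.pos_iff_ne_zero]
  intro h0
  obtain ⟨c, rfl⟩ := natDegree_eq_zero.1 h0
  apply hf.not_residuallyAlgebraic
  rw [aeval_C]
  exact ResiduallyAlgebraic.algebraMap_of_ne_zero (fun hc => hf.ne_zero (by simp [hc]))

theorem degree_lt_iff (hf : IsKeyPolynomial v W x f) (g : K[X]) :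
    g.degree < f.degree ↔ g.natDegree < f.natDegree := by
  by_cases hg : g = 0
  · simp [hg, hf.natDegree_pos, hf.ne_zero, bot_lt_iff_ne_bot]
  · exact ⟨natDegree_lt_natDegree hg, degree_lt_degree⟩

theorem residuallyAlgebraic_of_low (hf : IsKeyPolynomial v W x f) {a : L} (ha : Low W x f a) :
    ResiduallyAlgebraic v W a := by
  obtain ⟨g, hg0, hg, h⟩ := ha
  exact (hf.residuallyAlgebraic g hg0 hg).of_sim h

theorem low_aeval (hf : IsKeyPolynomial v W x f) {g : K[X]} (hg0 : g ≠ 0)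
    (hg : g.degree < f.degree) : Low W x f (aeval x g) :=
  ⟨g, hg0, hg, Sim.refl (hf.aeval_ne_zero hg0)⟩

/-- The degree bound makes the quotient by f residually algebraic, so
`ResiduallyAlgebraic.valuation_lt` shows that the multiple of f(x) is negligible against P(x). -/
theorem sim_mod (hf : IsKeyPolynomial v W x f) {P : K[X]}
    (hdeg : P.natDegree < 2 * f.natDegree) (hP : ResiduallyAlgebraic v W (aeval x P)) :
    Sim W (aeval x P) (aeval x (P % f)) := by
  have hdiv := EuclideanDomain.div_add_mod P f
  by_cases hq : P / f = 0
  · rw [hq, mul_zero, zero_add] at hdiv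
    rw [hdiv]
    exact Sim.refl hP.ne_zero
  have h1 : aeval x P = aeval x (P % f) + aeval x (P / f) * aeval x f := by
    conv_lhs => rw [← hdiv]
    rw [map_add, map_mul]; ring
  have hr : aeval x (P % f) = 0 ∨ ResiduallyAlgebraic v W (aeval x (P % f)) := by
    by_cases h0 : P % f = 0
    · left; rw [h0, map_zero]
    · exact Or.inr (hf.residuallyAlgebraic _ h0 (degree_mod_lt _ hf.ne_zero))
  have h2 := ResiduallyAlgebraic.valuation_lt hf.isResidueAlgebra hr
    (hf.residuallyAlgebraic _ hq
      ((hf.degree_lt_iff _).2 (natDegree_div_lt hf.natDegree_pos hdeg))) hP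
    (hf.aeval_ne_zero hf.ne_zero) hf.not_residuallyAlgebraic h1
  refine (Sim.of_sub ?_).symm
  rwa [h1, sub_add_cancel_left, Valuation.map_neg, ← h1]

theorem low_of_natDegree_lt (hf : IsKeyPolynomial v W x f) {P : K[X]}
    (hdeg : P.natDegree < 2 * f.natDegree) (hP : ResiduallyAlgebraic v W (aeval x P)) :
    Low W x f (aeval x P) := by
  have h := hf.sim_mod hdeg hP
  exact ⟨P % f, fun h0 => h.right_ne_zero (by rw [h0, map_zero]), degree_mod_lt _ hf.ne_zero, h⟩

theorem low_mul (hf : IsKeyPolynomial v W x f) {a b : L} (ha : Low W x f a)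
    (hb : Low W x f b) : Low W x f (a * b) := by
  obtain ⟨g, hg0, hg, h⟩ := ha
  obtain ⟨g', hg0', hg', h'⟩ := hb
  obtain ⟨r, hr0, hr, hs⟩ := hf.low_of_natDegree_lt (P := g * g') (by
    rw [natDegree_mul hg0 hg0']
    have := (hf.degree_lt_iff _).1 hg
    have := (hf.degree_lt_iff _).1 hg'
    omega) (by
    rw [map_mul]
    exact (hf.residuallyAlgebraic g hg0 hg).mul (hf.residuallyAlgebraic g' hg0' hg'))
  rw [map_mul] at hs
  exact ⟨r, hr0, hr, (h.mul h').trans hs⟩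

/-- Proper factors have smaller degree, hence residually algebraic values, and these are closed
under products. -/
theorem irreducible (hf : IsKeyPolynomial v W x f) : Irreducible f := by
  refine ⟨fun hu => hf.natDegree_pos.ne' (natDegree_eq_zero_of_isUnit hu), fun a b hab => ?_⟩
  by_contra! hc
  have h0 : a * b ≠ 0 := hab ▸ hf.ne_zero
  have ha0 := left_ne_zero_of_mul h0
  have hb0 := right_ne_zero_of_mul h0
  have hdeg : f.natDegree = a.natDegree + b.natDegree := by rw [hab, natDegree_mul ha0 hb0]
  have ha : 0 < a.natDegree := natDegree_pos_iff_degree_pos.2 (degree_pos_of_ne_zero_of_nonunit ha0 hc.1)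
  have hb : 0 < b.natDegree := natDegree_pos_iff_degree_pos.2 (degree_pos_of_ne_zero_of_nonunit hb0 hc.2)
  apply hf.not_residuallyAlgebraic
  rw [hab, map_mul]
  exact (hf.residuallyAlgebraic a ha0 ((hf.degree_lt_iff _).2 (by omega))).mul
    (hf.residuallyAlgebraic b hb0 ((hf.degree_lt_iff _).2 (by omega)))

/-- Invert modulo the irreducible f: if gs leaves remainder 1, then `sim_mod` makes s(x) an inverse
of g(x) up to residue one. -/
theorem low_inv (hf : IsKeyPolynomial v W x f) {a : L} (ha : Low W x f a) :
    Low W x f a⁻¹ := by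
  obtain ⟨g, hg0, hg, h⟩ := ha
  have hndvd : ¬ f ∣ g := fun hd => absurd (degree_le_of_dvd hd hg0) (not_le.2 hg)
  obtain ⟨t, s, hst⟩ := (hf.irreducible.coprime_iff_not_dvd).2 hndvd
  have h1d : (1 : K[X]).degree < f.degree := by
    rw [hf.degree_lt_iff, natDegree_one]; exact hf.natDegree_pos
  have hmod : (g * (s % f)) % f = 1 := by
    have h2 : (g * (s % f) - 1) % f = 0 := by
      rw [EuclideanDomain.mod_eq_zero]
      refine ⟨-(t + g * (s / f)), ?_⟩
      have := EuclideanDomain.div_add_mod s f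
      linear_combination g * this + hst
    rw [sub_mod, (mod_eq_self_iff hf.ne_zero).2 h1d, sub_eq_zero] at h2
    exact h2
  have hs0 : s % f ≠ 0 := by
    intro h0
    rw [h0, mul_zero, EuclideanDomain.zero_mod] at hmod
    exact zero_ne_one hmod
  have hsd := degree_mod_lt s hf.ne_zero
  have hsim := hf.sim_mod (P := g * (s % f)) (by
    rw [natDegree_mul hg0 hs0]
    have := (hf.degree_lt_iff _).1 hg
    have := (hf.degree_lt_iff _).1 hsd
    omega) (by
    rw [map_mul]
    exact (hf.residuallyAlgebraic g hg0 hg).mul (hf.residuallyAlgebraic _ hs0 hsd))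
  rw [hmod, map_one, map_mul] at hsim
  refine ⟨s % f, hs0, hsd, h.inv.trans ?_⟩
  have := hsim.symm.mul (Sim.refl (W := W) (inv_ne_zero (hf.aeval_ne_zero hg0)))
  rwa [one_mul, mul_comm (aeval x g), mul_inv_cancel_right₀ (hf.aeval_ne_zero hg0)] at this

theorem low_algebraMap (hf : IsKeyPolynomial v W x f) {c : K} (hc : c ≠ 0) :
    Low W x f (algebraMap K L c) := by
  rw [← aeval_C x c]
  refine hf.low_aeval (C_ne_zero.2 hc) ?_
  rw [hf.degree_lt_iff, natDegree_C]
  exact hf.natDegree_pos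

theorem low_pow (hf : IsKeyPolynomial v W x f) {a : L} (ha : Low W x f a) (n : ℕ) :
    Low W x f (a ^ n) := by
  induction n with
  | zero => simpa using hf.low_algebraMap (one_ne_zero (α := K))
  | succ n ih => rw [pow_succ]; exact hf.low_mul ih ha

theorem low_zpow (hf : IsKeyPolynomial v W x f) {a : L} (ha : Low W x f a) (n : ℤ) :
    Low W x f (a ^ n) := by
  cases n with
  | ofNat n => simpa using hf.low_pow ha n
  | negSucc n => rw [zpow_negSucc]; exact hf.low_inv (hf.low_pow ha _)

/-- The field of residues of the polynomials in `x` of degree less than that of `f`. -/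
def lowField (hf : IsKeyPolynomial v W x f) :
    IntermediateField (IsLocalRing.ResidueField v) (IsLocalRing.ResidueField W) where
  carrier := {y | ∃ g : K[X], g.degree < f.degree ∧ aeval x g ∈ W ∧ resid W (aeval x g) = y}
  mul_mem' := by
    rintro _ _ ⟨g, hg, hgW, rfl⟩ ⟨g', hg', hgW', rfl⟩
    rw [← resid_mul W hgW hgW']
    by_cases h0 : resid W (aeval x g * aeval x g') = 0
    · exact ⟨0, (degree_zero (R := K)).trans_lt (bot_lt_iff_ne_bot.2 (degree_ne_bot.2 hf.ne_zero)),
        by simp [zero_mem], by simp [h0]⟩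
    have hne := (ne_zero_of_valuation_eq_one W ((resid_ne_zero_iff W).1 h0))
    have hg0 : g ≠ 0 := by rintro rfl; simp at hne
    have hg0' : g' ≠ 0 := by rintro rfl; simp at hne
    obtain ⟨r, hr0, hr, hs⟩ := hf.low_mul (hf.low_aeval hg0 hg) (hf.low_aeval hg0' hg')
    have hv : W.valuation (aeval x r) = 1 := by
      rw [← hs.valuation_eq]; exact (resid_ne_zero_iff W).1 h0
    exact ⟨r, hr, mem_of_valuation_eq_one W hv, (hs.resid_eq hv).symm⟩
  add_mem' := by
    rintro _ _ ⟨g, hg, hgW, rfl⟩ ⟨g', hg', hgW', rfl⟩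
    refine ⟨g + g', (degree_add_le _ _).trans_lt (max_lt hg hg'), ?_, ?_⟩
    · rw [map_add]; exact add_mem hgW hgW'
    · rw [map_add, resid_add W hgW hgW']
  algebraMap_mem' := by
    intro y
    obtain ⟨a, ha, rfl⟩ := exists_resid_eq v y
    refine ⟨C a, ?_, ?_, ?_⟩
    · rw [hf.degree_lt_iff, natDegree_C]; exact hf.natDegree_pos
    · rw [aeval_C, hf.isResidueAlgebra.isExtension.mem_iff]; exact ha
    · rw [aeval_C, hf.isResidueAlgebra.algebraMap_resid a ha]
  inv_mem' := by
    rintro _ ⟨g, hg, hgW, rfl⟩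
    by_cases h0 : resid W (aeval x g) = 0
    · exact ⟨0, (degree_zero (R := K)).trans_lt (bot_lt_iff_ne_bot.2 (degree_ne_bot.2 hf.ne_zero)),
        by simp [zero_mem], by simp [h0]⟩
    have h1 := (resid_ne_zero_iff W).1 h0
    have hg0 : g ≠ 0 := by rintro rfl; simp at h0
    obtain ⟨r, hr0, hr, hs⟩ := hf.low_inv (hf.low_aeval hg0 hg)
    have hv : W.valuation (aeval x r) = 1 := by
      rw [← hs.valuation_eq]; exact valuation_inv_eq_one W h1
    exact ⟨r, hr, mem_of_valuation_eq_one W hv, by rw [← hs.resid_eq hv, resid_inv W h1]⟩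

theorem mem_lowField (hf : IsKeyPolynomial v W x f) {y : IsLocalRing.ResidueField W} :
    y ∈ hf.lowField ↔
      ∃ g : K[X], g.degree < f.degree ∧ aeval x g ∈ W ∧ resid W (aeval x g) = y :=
  Iff.rfl

theorem resid_mem_lowField (hf : IsKeyPolynomial v W x f) {a : L} (ha : Low W x f a)
    (h1 : W.valuation a = 1) : resid W a ∈ hf.lowField := by
  obtain ⟨g, -, hg, h⟩ := ha
  have hv : W.valuation (aeval x g) = 1 := by rw [← h.valuation_eq, h1]
  exact ⟨g, hg, mem_of_valuation_eq_one W hv, (h.resid_eq hv).symm⟩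

/-- Independent residues come from independent polynomials of degree less than deg f, so the
dimension is at most deg f. -/
theorem finiteDimensional_lowField (hf : IsKeyPolynomial v W x f) :
    FiniteDimensional (IsLocalRing.ResidueField v) hf.lowField := by
  have hrank : Module.rank (IsLocalRing.ResidueField v) hf.lowField ≤ (f.natDegree : ℕ) := by
    refine rank_le fun s hs => ?_
    choose g hg hgW hgr using fun y : s => hf.mem_lowField.1 y.1.2
    have hmem : ∀ y : s, g y ∈ degreeLT K f.natDegree := fun y => by
      rw [mem_degreeLT, ← degree_eq_natDegree hf.ne_zero]; exact hg y
    have hli : LinearIndependent K (fun y : s => (⟨g y, hmem y⟩ : degreeLT K f.natDegree)) := by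
      rw [Fintype.linearIndependent_iff]
      by_contra! hc
      obtain ⟨c, hc0, i, hi⟩ := hc
      -- Dividing the relation by a coefficient of largest valuation makes it integral, with one
      -- coefficient equal to 1, so it reduces to a nontrivial relation.
      obtain ⟨j, -, hj⟩ := Finset.exists_max_image Finset.univ (fun y => v.valuation (c y))
        ⟨i, Finset.mem_univ i⟩
      have hj0 : c j ≠ 0 := by
        intro h0
        have := hj i (Finset.mem_univ i)
        rw [h0, map_zero] at this
        exact (Valuation.ne_zero_iff v.valuation).2 hi (le_antisymm this zero_le)
      have hcv : ∀ y, c y / c j ∈ v := fun y => by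
        rw [← v.valuation_le_one_iff, map_div₀]
        exact div_le_one_of_le₀ (hj y (Finset.mem_univ y)) zero_le
      have hsum : ∑ y, algebraMap K L (c y / c j) * aeval x (g y) = 0 := by
        have h1 : ∑ y, C (c y) * g y = 0 := by
          have := congrArg Subtype.val hc0
          simpa [smul_eq_C_mul] using this
        have h2 := congrArg (fun p => algebraMap K L (c j)⁻¹ * aeval x p) h1
        simp only [map_sum, Finset.mul_sum, map_mul, aeval_C, map_zero, mul_zero] at h2
        rw [← h2]
        refine Finset.sum_congr rfl fun y _ => ?_
        rw [map_div₀, map_inv₀]; ring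
      have hres := congrArg (resid W) hsum
      have hcW : ∀ y, algebraMap K L (c y / c j) ∈ W := fun y =>
        (hf.isResidueAlgebra.isExtension.mem_iff _).2 (hcv y)
      rw [resid_zero, resid_sum W _ _ fun y _ => mul_mem (hcW y) (hgW y)] at hres
      have hzero := Fintype.linearIndependent_iff.1 hs (fun y => resid v (c y / c j)) (by
        apply Subtype.ext
        rw [AddSubmonoidClass.coe_finsetSum, ZeroMemClass.coe_zero, ← hres]
        refine Finset.sum_congr rfl fun y _ => ?_
        rw [resid_mul W (hcW y) (hgW y), hgr, ← hf.isResidueAlgebra.algebraMap_resid _ (hcv y),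
          IntermediateField.coe_smul, Algebra.smul_def]) j
      rw [div_self hj0, resid_one] at hzero
      exact one_ne_zero hzero
    have := hli.fintype_card_le_finrank
    rwa [Fintype.card_coe, Module.finrank_eq_card_basis (degreeLT.basis K f.natDegree),
      Fintype.card_fin] at this
  exact Module.rank_lt_aleph0_iff.1 (hrank.trans_lt (Cardinal.natCast_lt_aleph0))

end IsKeyPolynomial
end KeyPolynomial

/-! ### Normal forms in K(x) and the residue field of K(x). -/

section NormalForm

variable {K L : Type*} [Field K] [Field L] [Algebra K L] {v : ValuationSubring K}
  {W : ValuationSubring L} [Algebra (IsLocalRing.ResidueField v) (IsLocalRing.ResidueField W)]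

/-- `e` generates the group of exponents `m` for which `f(x)^m` has the value of a low element,
and `f(x)^e` has the value of the low element `g`. -/
structure IsKeyPower {K L : Type*} [Field K] [Field L] [Algebra K L] (W : ValuationSubring L)
    (x : L) (f : K[X]) (e : ℕ) (g : L) : Prop where
  low : Low W x f g
  valuation_eq : W.valuation (aeval x f ^ e) = W.valuation g
  dvd : ∀ m : ℤ, ∀ a, Low W x f a → W.valuation (aeval x f ^ m) = W.valuation a → (e : ℤ) ∣ m

namespace IsKeyPolynomial

variable {x : L} {f : K[X]}

/-- The admissible exponents form a subgroup of ℤ, and e is its nonnegative generator. It is 0 when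
no nonzero power of f(x) has the value of a low element. -/
theorem exists_isKeyPower (hf : IsKeyPolynomial v W x f) : ∃ e g, IsKeyPower W x f e g := by
  have hF0 := hf.aeval_ne_zero hf.ne_zero
  let H : AddSubgroup ℤ :=
    { carrier := {m | ∃ a, Low W x f a ∧ W.valuation (aeval x f ^ m) = W.valuation a}
      zero_mem' := ⟨1, by simpa using hf.low_algebraMap (one_ne_zero (α := K)), by simp⟩
      add_mem' := by
        rintro m n ⟨a, ha, hma⟩ ⟨b, hb, hnb⟩
        exact ⟨a * b, hf.low_mul ha hb, by rw [zpow_add₀ hF0, map_mul, map_mul, hma, hnb]⟩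
      neg_mem' := by
        rintro m ⟨a, ha, hma⟩
        exact ⟨a⁻¹, hf.low_inv ha, by rw [zpow_neg, map_inv₀, map_inv₀, hma]⟩ }
  obtain ⟨n, hn⟩ := Int.subgroup_cyclic H
  have hmem : ∀ m, m ∈ H ↔ (n.natAbs : ℤ) ∣ m := by
    intro m
    rw [hn, AddSubgroup.mem_closure_singleton, Int.natAbs_dvd]
    simp only [smul_eq_mul]
    exact ⟨fun ⟨k, hk⟩ => ⟨k, by rw [← hk, mul_comm]⟩, fun ⟨k, hk⟩ => ⟨k, by rw [hk, mul_comm]⟩⟩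
  obtain ⟨g, hg, hv⟩ := (hmem n.natAbs).2 dvd_rfl
  exact ⟨n.natAbs, g, hg, by rw [zpow_natCast] at hv; exact hv, fun m a ha hm => (hmem m).1 ⟨a, ha, hm⟩⟩

variable {e : ℕ} {g : L}

theorem valuation_keyPower (he : IsKeyPower W x f e g) :
    W.valuation (aeval x f ^ e / g) = 1 := by
  obtain ⟨r, -, -, h⟩ := he.low
  rw [map_div₀, he.valuation_eq, div_self ((Valuation.ne_zero_iff _).2 h.left_ne_zero)]

/-- If ζ = f(x)^e/g had algebraic residue, then f(x)^e = ζg, and with it f(x), would be residually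
algebraic. -/
theorem transcendental_resid (hf : IsKeyPolynomial v W x f) (he : IsKeyPower W x f e g)
    (hpos : 0 < e) : Transcendental hf.lowField (resid W (aeval x f ^ e / g)) := by
  intro halg
  have := hf.finiteDimensional_lowField
  have h1 := halg.restrictScalars (IsLocalRing.ResidueField v)
  have h2 := ResiduallyAlgebraic.of_isAlgebraic (valuation_keyPower he) h1
  have h3 := hf.residuallyAlgebraic_of_low he.low
  have h4 := h2.mul h3
  rw [div_mul_cancel₀ _ h3.ne_zero] at h4
  exact hf.not_residuallyAlgebraic (h4.of_pow hpos)

/-- Induct on the degree through division by f, comparing the valuation of the remainder with that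
of the quotient term. The dominant one determines the monomial part and the ratio goes into the unit
s. -/
theorem exists_normalForm_aeval (hf : IsKeyPolynomial v W x f) (he : IsKeyPower W x f e g)
    {P : K[X]} (hP : P ≠ 0) :
    ∃ a, Low W x f a ∧ ∃ i : ℕ, ∃ s, W.valuation s = 1 ∧
      (∃ R : hf.lowField[X], aeval (resid W (aeval x f ^ e / g)) R = resid W s) ∧
      aeval x P = a * aeval x f ^ i * s := by
  induction hn : P.natDegree using Nat.strong_induction_on generalizing P with
  | _ n ih =>
  set F := aeval x f with hF
  have hF0 : F ≠ 0 := hf.aeval_ne_zero hf.ne_zero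
  have hdiv := EuclideanDomain.div_add_mod P f
  have hmd := degree_mod_lt P hf.ne_zero
  by_cases hq : P / f = 0
  · rw [hq, mul_zero, zero_add] at hdiv
    rw [hdiv] at hmd
    exact ⟨aeval x P, hf.low_aeval hP hmd, 0, 1, map_one _, ⟨1, by simp⟩, by simp⟩
  have hlt : (P / f).natDegree < n := by
    rw [← hn]
    exact natDegree_lt_natDegree hq (degree_div_lt hP (natDegree_pos_iff_degree_pos.1
      hf.natDegree_pos))
  obtain ⟨b, hb, i, s, hs, ⟨R, hR⟩, hbi⟩ := ih _ hlt hq rfl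
  have hb0 : b ≠ 0 := (hf.residuallyAlgebraic_of_low hb).ne_zero
  have hs0 := ne_zero_of_valuation_eq_one W hs
  have hsW := mem_of_valuation_eq_one W hs
  set T := b * F ^ (i + 1) * s with hT
  have hT0 : T ≠ 0 := mul_ne_zero (mul_ne_zero hb0 (pow_ne_zero _ hF0)) hs0
  have hPT : aeval x P = aeval x (P % f) + T := by
    conv_lhs => rw [← hdiv]
    rw [map_add, map_mul, hbi, hT, pow_succ]; ring
  by_cases ha0 : P % f = 0
  · exact ⟨b, hb, i + 1, s, hs, ⟨R, hR⟩, by rw [hPT, ha0, map_zero, zero_add]⟩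
  set a := aeval x (P % f) with ha
  have haL : Low W x f a := hf.low_aeval ha0 hmd
  have ha0' : a ≠ 0 := hf.aeval_ne_zero ha0
  have hav : W.valuation a ≠ 0 := (Valuation.ne_zero_iff _).2 ha0'
  have hTv : W.valuation T ≠ 0 := (Valuation.ne_zero_iff _).2 hT0
  rcases lt_trichotomy (W.valuation a) (W.valuation T) with hlt | heq | hgt
  · have h1 : W.valuation (a / T) < 1 := by
      rw [map_div₀]; exact (div_lt_one₀ (zero_lt_iff.2 hTv)).2 hlt
    have h1W := mem_of_valuation_lt_one W h1
    have hres : resid W (s * (1 + a / T)) = resid W s := by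
      rw [resid_mul W hsW (add_mem (one_mem W) h1W), resid_add W (one_mem W) h1W,
        resid_of_valuation_lt_one W h1, resid_one, add_zero, mul_one]
    refine ⟨b, hb, i + 1, s * (1 + a / T), ?_, ⟨R, by rw [hres, hR]⟩, ?_⟩
    · rw [← resid_ne_zero_iff, hres]; exact (resid_ne_zero_iff W).2 hs
    · rw [hPT, ← mul_assoc, ← hT]; field_simp; ring
  · set ζ := F ^ e / g with hζ
    have hg0 : g ≠ 0 := (hf.residuallyAlgebraic_of_low he.low).ne_zero
    have hval : W.valuation (F ^ ((i + 1 : ℕ) : ℤ)) = W.valuation (a * b⁻¹) := by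
      rw [map_mul, heq, hT, map_mul, map_mul, hs, mul_one, mul_comm (W.valuation b), mul_assoc,
        ← map_mul, mul_inv_cancel₀ hb0, map_one, mul_one, zpow_natCast]
    -- Equal valuations force e to divide i + 1, so the quotient term becomes the remainder times a
    -- low unit, a power of ζ and s.
    have hdvd := he.dvd _ _ (hf.low_mul haL (hf.low_inv hb)) hval
    obtain ⟨m, hm⟩ := Int.natCast_dvd_natCast.1 hdvd
    have hm0 : m ≠ 0 := by rintro rfl; simp at hm
    have he0 : 0 < e := Nat.pos_of_ne_zero (by rintro rfl; simp at hm)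
    have hζ1 : W.valuation ζ = 1 := valuation_keyPower he
    have hζW := mem_of_valuation_eq_one W hζ1
    have hFζ : F ^ e = ζ * g := by rw [hζ, div_mul_cancel₀ _ hg0]
    set b' := b * g ^ m * a⁻¹ with hb'
    have hb'L : Low W x f b' := hf.low_mul (hf.low_mul hb (hf.low_pow he.low m)) (hf.low_inv haL)
    have hTb : T = a * (b' * ζ ^ m * s) := by
      rw [hT, hm, pow_mul, hFζ, hb', mul_pow]; field_simp
    have hb'1 : W.valuation b' = 1 := by
      rw [hTb, map_mul, map_mul, map_mul, map_pow, hζ1, hs, one_pow, mul_one, mul_one] at heq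
      exact (mul_eq_left₀ hav).1 heq.symm
    have hb'W := mem_of_valuation_eq_one W hb'1
    have hmem : b' * ζ ^ m * s ∈ W := mul_mem (mul_mem hb'W (pow_mem hζW m)) hsW
    have hres : resid W (1 + b' * ζ ^ m * s) =
        aeval (resid W ζ) (1 + C ⟨resid W b', hf.resid_mem_lowField hb'L hb'1⟩ * X ^ m * R) := by
      rw [resid_add W (one_mem W) hmem, resid_one, resid_mul W (mul_mem hb'W (pow_mem hζW m)) hsW,
        resid_mul W hb'W (pow_mem hζW m), resid_pow W hζW, map_add, map_one, map_mul, map_mul,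
        map_pow, aeval_X, aeval_C, hR]
      rfl
    refine ⟨a, haL, 0, 1 + b' * ζ ^ m * s, ?_, ⟨_, hres.symm⟩, ?_⟩
    -- As m is positive, the polynomial in the residue of ζ has constant coefficient 1; it is
    -- nonzero and cannot vanish at a transcendental element.
    · rw [← resid_ne_zero_iff, hres]
      intro h0
      refine hf.transcendental_resid he he0 ⟨_, fun hpoly => ?_, h0⟩
      have := congrArg (fun p => p.coeff 0) hpoly
      rw [show C (⟨resid W b', hf.resid_mem_lowField hb'L hb'1⟩ : hf.lowField) * X ^ m * R =
        X ^ m * (C ⟨resid W b', hf.resid_mem_lowField hb'L hb'1⟩ * R) by ring] at this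
      simp [hm0.symm] at this
    · rw [hPT, hTb, pow_zero]; ring
  · have h1 : W.valuation (T / a) < 1 := by
      rw [map_div₀]; exact (div_lt_one₀ (zero_lt_iff.2 hav)).2 hgt
    have h1W := mem_of_valuation_lt_one W h1
    have hres : resid W (1 + T / a) = 1 := by
      rw [resid_add W (one_mem W) h1W, resid_of_valuation_lt_one W h1, resid_one, add_zero]
    refine ⟨a, haL, 0, 1 + T / a, ?_, ⟨1, by rw [hres, map_one]⟩, ?_⟩
    · rw [← resid_ne_zero_iff, hres]; exact one_ne_zero
    · rw [hPT, pow_zero]; field_simp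

/-- The residue field of `K(x)`, as a subfield of that of `W`. -/
abbrev residueField (hf : IsKeyPolynomial v W x f) (e : ℕ) (g : L) :
    IntermediateField hf.lowField (IsLocalRing.ResidueField W) :=
  IntermediateField.adjoin hf.lowField {resid W (aeval x f ^ e / g)}

theorem exists_normalForm (hf : IsKeyPolynomial v W x f) (he : IsKeyPower W x f e g) {u : L}
    (hu : u ∈ IntermediateField.adjoin K {x}) (hu0 : u ≠ 0) :
    ∃ a, Low W x f a ∧ ∃ i : ℤ, ∃ s, W.valuation s = 1 ∧ resid W s ∈ hf.residueField e g ∧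
      u = a * aeval x f ^ i * s := by
  obtain ⟨p, q, rfl⟩ := (IntermediateField.mem_adjoin_simple_iff K u).1 hu
  have hp : p ≠ 0 := by rintro rfl; simp at hu0
  have hq : q ≠ 0 := by rintro rfl; simp at hu0
  obtain ⟨a, ha, i, s, hs, ⟨R, hR⟩, h⟩ := hf.exists_normalForm_aeval he hp
  obtain ⟨a', ha', i', s', hs', ⟨R', hR'⟩, h'⟩ := hf.exists_normalForm_aeval he hq
  have hmem : ∀ R : hf.lowField[X], aeval (resid W (aeval x f ^ e / g)) R ∈
      hf.residueField e g := fun R =>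
    (IntermediateField.mem_adjoin_simple_iff _ _).2 ⟨R, 1, by simp⟩
  refine ⟨a * a'⁻¹, hf.low_mul ha (hf.low_inv ha'), (i : ℤ) - i', s / s', ?_, ?_, ?_⟩
  · rw [map_div₀, hs, hs', div_one]
  · rw [resid_div W (mem_of_valuation_eq_one W hs) hs', ← hR, ← hR']
    exact div_mem (hmem R) (hmem R')
  · rw [h, h', zpow_sub₀ (hf.aeval_ne_zero hf.ne_zero), zpow_natCast, zpow_natCast]
    field_simp

/-- A unit of the form a f(x)^i has i divisible by e, so replacing f(x)^e by ζg leaves a low unit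
times a power of ζ. -/
theorem exists_resid_low_mul (hf : IsKeyPolynomial v W x f) (he : IsKeyPower W x f e g) {a : L}
    (ha : Low W x f a) {i : ℤ} (h1 : W.valuation (a * aeval x f ^ i) = 1) :
    ∃ c ∈ hf.lowField, c ≠ 0 ∧ ∃ m : ℤ,
      resid W (a * aeval x f ^ i) = c * resid W (aeval x f ^ e / g) ^ m := by
  have hg0 : g ≠ 0 := (hf.residuallyAlgebraic_of_low he.low).ne_zero
  have ha0 : a ≠ 0 := (hf.residuallyAlgebraic_of_low ha).ne_zero
  have hval : W.valuation (aeval x f ^ i) = W.valuation a⁻¹ := by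
    rw [map_inv₀]; rw [map_mul] at h1
    exact eq_inv_of_mul_eq_one_right h1
  obtain ⟨m, rfl⟩ := he.dvd i _ (hf.low_inv ha) hval
  set ζ := aeval x f ^ e / g with hζ
  have hζ1 : W.valuation ζ = 1 := valuation_keyPower he
  have hFζ : aeval x f ^ e = ζ * g := by rw [hζ, div_mul_cancel₀ _ hg0]
  have hkey : a * aeval x f ^ ((e : ℤ) * m) = (a * g ^ m) * ζ ^ m := by
    rw [zpow_mul, zpow_natCast, hFζ, mul_zpow]; ring
  have hζm : W.valuation (ζ ^ m) = 1 := by rw [map_zpow₀, hζ1, one_zpow]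
  rw [hkey] at h1 ⊢
  rw [map_mul, hζm, mul_one] at h1
  have hL := hf.low_mul ha (hf.low_zpow he.low m)
  exact ⟨resid W (a * g ^ m), hf.resid_mem_lowField hL h1, (resid_ne_zero_iff W).2 h1, m, by
    rw [resid_mul W (mem_of_valuation_eq_one W h1) (mem_of_valuation_eq_one W hζm),
      resid_zpow W hζ1]⟩

theorem resid_mem_residueField (hf : IsKeyPolynomial v W x f) (he : IsKeyPower W x f e g) {u : L}
    (hu : u ∈ IntermediateField.adjoin K {x}) : resid W u ∈ hf.residueField e g := by
  by_cases h0 : resid W u = 0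
  · rw [h0]; exact zero_mem _
  have h1 := (resid_ne_zero_iff W).1 h0
  obtain ⟨a, ha, i, s, hs, hsm, rfl⟩ := hf.exists_normalForm he hu (ne_zero_of_valuation_eq_one W h1)
  rw [map_mul, hs, mul_one] at h1
  obtain ⟨c, hc, -, m, hcm⟩ := hf.exists_resid_low_mul he ha h1
  rw [resid_mul W (mem_of_valuation_eq_one W h1) (mem_of_valuation_eq_one W hs), hcm]
  refine mul_mem (mul_mem ?_ (zpow_mem (IntermediateField.mem_adjoin_simple_self _ _) m)) hsm
  exact (hf.residueField e g).algebraMap_mem ⟨c, hc⟩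

/-- The residue field of a simple transcendental extension is ruled. -/
theorem isRuled_of_forall_resid_mem (hf : IsKeyPolynomial v W x f)
    (h : ∀ y : IsLocalRing.ResidueField W, y ∈ hf.residueField e g) :
    IsRuled (IsLocalRing.ResidueField v) (IsLocalRing.ResidueField W) :=
  ⟨hf.lowField, hf.finiteDimensional_lowField, _, eq_top_iff.2 fun y _ => h y⟩

end IsKeyPolynomial
end NormalForm

/-! ### Stability of ruled extensions under change of presentation. -/

section Ruled

variable {k L : Type*} [Field k] [Field L] [Algebra k L]

theorem mem_subfield_of_mem_adjoin {z : L} {S : Subfield L} (h1 : ∀ y : k, algebraMap k L y ∈ S)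
    (hz : z ∈ S) {y : L} (hy : y ∈ IntermediateField.adjoin k {z}) : y ∈ S := by
  induction hy using IntermediateField.adjoin_induction with
  | mem y hy => rw [Set.mem_singleton_iff] at hy; exact hy ▸ hz
  | algebraMap y => exact h1 y
  | add _ _ _ _ h h' => exact add_mem h h'
  | inv _ _ h => exact inv_mem h
  | mul _ _ _ _ h h' => exact mul_mem h h'

theorem IsRuled.of_surjective {k₀ : Type*} [Field k₀] [Algebra k₀ k] [Algebra k₀ L]
    [IsScalarTower k₀ k L] (h : IsRuled k L) (hs : Function.Surjective (algebraMap k₀ k)) :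
    IsRuled k₀ L := by
  obtain ⟨K', hfin, x, hx⟩ := h
  have h1 : Module.Finite k₀ k := Module.Finite.of_surjective (Algebra.linearMap k₀ k) hs
  refine ⟨K'.restrictScalars k₀, Module.Finite.trans (R := k₀) k K', x, ?_⟩
  rw [eq_top_iff]
  intro y _
  refine mem_subfield_of_mem_adjoin (k := K')
    (S := (IntermediateField.adjoin (K'.restrictScalars k₀) {x}).toSubfield) (fun a => ?_)
    (IntermediateField.mem_adjoin_simple_self _ _) (hx ▸ IntermediateField.mem_top : y ∈ _)
  exact (IntermediateField.adjoin (K'.restrictScalars k₀) {x}).algebraMap_mem ⟨a, a.2⟩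

theorem IsRuled.of_algEquiv {L' : Type*} [Field L'] [Algebra k L'] (h : IsRuled k L)
    (e : L ≃ₐ[k] L') : IsRuled k L' := by
  obtain ⟨K', hfin, x, hx⟩ := h
  refine ⟨K'.map (e : L →ₐ[k] L'), LinearEquiv.finiteDimensional
    (K'.intermediateFieldMap e).toLinearEquiv, e x, ?_⟩
  rw [eq_top_iff]
  intro y _
  have := mem_subfield_of_mem_adjoin (k := K') (z := x) (y := e.symm y)
    (S := (IntermediateField.adjoin (K'.map (e : L →ₐ[k] L')) {e x}).toSubfield.comap
      (e : L →+* L')) (fun a => ?_)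
    (IntermediateField.mem_adjoin_simple_self _ (e x)) (hx ▸ IntermediateField.mem_top)
  · have h2 : e (e.symm y) ∈ IntermediateField.adjoin (K'.map (e : L →ₐ[k] L')) {e x} := this
    rwa [e.apply_symm_apply] at h2
  · exact (IntermediateField.adjoin (K'.map (e : L →ₐ[k] L')) {e x}).algebraMap_mem
      ⟨e a, ⟨a, a.2, rfl⟩⟩

end Ruled

/-! ### Residue fields of quadratic extensions of K(x). -/

section Quadratic

variable {K L : Type*} [Field K] [Field L] [Algebra K L]

theorem exists_eq_add_mul_of_sq_mem {x Y : L} (htop : IntermediateField.adjoin K {x, Y} = ⊤)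
    (hY : Y ^ 2 ∈ IntermediateField.adjoin K {x}) (u : L) :
    ∃ p ∈ IntermediateField.adjoin K {x}, ∃ q ∈ IntermediateField.adjoin K {x},
      u = p + q * Y := by
  set M := IntermediateField.adjoin K {x} with hM
  have halg : IsAlgebraic M Y :=
    IsAlgebraic.of_pow two_pos (isAlgebraic_algebraMap (⟨Y ^ 2, hY⟩ : M))
  have hu : u ∈ Algebra.adjoin M {Y} := by
    rw [← IntermediateField.adjoin_simple_toSubalgebra_of_isAlgebraic halg]
    change u ∈ IntermediateField.adjoin M {Y}
    have h1 : IntermediateField.adjoin K {x, Y} ≤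
        (IntermediateField.adjoin M {Y}).restrictScalars K := by
      rw [IntermediateField.adjoin_le_iff]
      rintro a (rfl | rfl)
      · exact (IntermediateField.adjoin M {Y}).algebraMap_mem
          (⟨a, IntermediateField.mem_adjoin_simple_self K a⟩ : M)
      · exact IntermediateField.mem_adjoin_simple_self M a
    rw [htop] at h1
    exact h1 IntermediateField.mem_top
  induction hu using Algebra.adjoin_induction with
  | mem y hy => exact ⟨0, zero_mem _, 1, one_mem _, by rw [Set.mem_singleton_iff.1 hy]; ring⟩
  | algebraMap r => exact ⟨r, r.2, 0, zero_mem _, by rw [zero_mul, add_zero]; rfl⟩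
  | add _ _ _ _ h h' =>
    obtain ⟨p, hp, q, hq, rfl⟩ := h
    obtain ⟨p', hp', q', hq', rfl⟩ := h'
    exact ⟨p + p', add_mem hp hp', q + q', add_mem hq hq', by ring⟩
  | mul _ _ _ _ h h' =>
    obtain ⟨p, hp, q, hq, rfl⟩ := h
    obtain ⟨p', hp', q', hq', rfl⟩ := h'
    exact ⟨p * p' + q * q' * Y ^ 2, add_mem (mul_mem hp hp') (mul_mem (mul_mem hq hq') hY),
      p * q' + q * p', add_mem (mul_mem hp hq') (mul_mem hq hp'), by ring⟩

variable {W : ValuationSubring L}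

/-- The case of a ramified Y: p and qY never share a valuation unless both are zero, and qY has
residue zero. -/
theorem resid_mem_of_valuation_mul_ne_one {M : IntermediateField K L} {Y : L}
    (hY : ∀ s ∈ M, W.valuation (s * Y) ≠ 1) {p q : L} (hp : p ∈ M) (hq : q ∈ M)
    (hu : p + q * Y ∈ W) : resid W (p + q * Y) = resid W p := by
  have hqp : W.valuation p = W.valuation (q * Y) → p = 0 := by
    intro h
    by_contra hp0
    refine hY (q / p) (div_mem hq hp) ?_
    rw [div_mul_eq_mul_div, map_div₀, ← h, div_self ((Valuation.ne_zero_iff _).2 hp0)]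
  have hqW : q * Y ∈ W ∧ p ∈ W := by
    rcases lt_trichotomy (W.valuation p) (W.valuation (q * Y)) with h | h | h
    · rw [← W.valuation_le_one_iff, Valuation.map_add_eq_of_lt_right _ h] at hu
      exact ⟨(W.valuation_le_one_iff _).1 hu, (W.valuation_le_one_iff _).1 (h.le.trans hu)⟩
    · have hp0 := hqp h
      rw [hp0, zero_add] at hu
      exact ⟨hu, hp0 ▸ zero_mem W⟩
    · rw [← W.valuation_le_one_iff, Valuation.map_add_eq_of_lt_left _ h] at hu
      exact ⟨(W.valuation_le_one_iff _).1 (h.le.trans hu), (W.valuation_le_one_iff _).1 hu⟩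
  have h1 : W.valuation (q * Y) < 1 :=
    lt_of_le_of_ne ((W.valuation_le_one_iff _).2 hqW.1) (hY q hq)
  rw [resid_add W hqW.2 hqW.1, resid_of_valuation_lt_one W h1, add_zero]

/-- The case of a new residue: if q were not integral, then -p/q would be an element of M with the
residue of y. -/
theorem mem_of_resid_notMem {M : IntermediateField K L} {y : L} (hy1 : W.valuation y = 1)
    (hy : ∀ t ∈ M, resid W t ≠ resid W y) {p q : L} (hp : p ∈ M) (hq : q ∈ M)
    (hu : p + q * y ∈ W) : p ∈ W ∧ q ∈ W := by
  have hyW := mem_of_valuation_eq_one W hy1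
  by_cases hqW : q ∈ W
  · refine ⟨?_, hqW⟩
    have := sub_mem hu (mul_mem hqW hyW)
    rwa [add_sub_cancel_right] at this
  exfalso
  have hq1 : 1 < W.valuation q := by rw [← not_le, W.valuation_le_one_iff]; exact hqW
  have hq0 : q ≠ 0 := by rintro rfl; exact hqW (zero_mem W)
  have h1 : W.valuation (p / q + y) < 1 := by
    have : p / q + y = (p + q * y) / q := by field_simp
    rw [this, map_div₀, div_lt_one₀ (zero_lt_iff.2 ((Valuation.ne_zero_iff _).2 hq0))]
    exact ((W.valuation_le_one_iff _).2 hu).trans_lt hq1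
  have h2 : p / q ∈ W := by
    have := sub_mem (mem_of_valuation_lt_one W h1) hyW
    rwa [add_sub_cancel_right] at this
  refine hy (-(p / q)) (neg_mem (div_mem hp hq)) ?_
  rw [resid_eq_iff W (neg_mem h2) hyW, ← Valuation.map_neg]
  rwa [show -(-(p / q) - y) = p / q + y by ring]

/-- The immediate case. If q is not integral, c = p/q has residue -1, and c + y = (c² - y²)/(c - y).
The denominator may be replaced by c - 1 in M, as both have residue -2, which is nonzero. -/
theorem exists_resid_eq_of_sq_mem {M : IntermediateField K L} {y : L} (hy : resid W y = 1)
    (hy2 : y ^ 2 ∈ M) (hchar : (2 : IsLocalRing.ResidueField W) ≠ 0) {p q : L} (hp : p ∈ M)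
    (hq : q ∈ M) (hu : p + q * y ∈ W) : ∃ t ∈ M, resid W t = resid W (p + q * y) := by
  have hy1 : W.valuation y = 1 := (resid_ne_zero_iff W).1 (by rw [hy]; exact one_ne_zero)
  have hyW := mem_of_valuation_eq_one W hy1
  by_cases hqW : q ∈ W
  · have hpW : p ∈ W := by
      have := sub_mem hu (mul_mem hqW hyW)
      rwa [add_sub_cancel_right] at this
    exact ⟨p + q, add_mem hp hq, by
      rw [resid_add W hpW hqW, resid_add W hpW (mul_mem hqW hyW), resid_mul W hqW hyW, hy,
        mul_one]⟩
  have hq1 : 1 < W.valuation q := by rw [← not_le, W.valuation_le_one_iff]; exact hqW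
  have hq0 : q ≠ 0 := by rintro rfl; exact hqW (zero_mem W)
  set c := p / q with hc
  have hcM : c ∈ M := div_mem hp hq
  have hu' : p + q * y = q * (c + y) := by rw [hc]; field_simp
  have h1 : W.valuation (c + y) < 1 := by
    have : c + y = (p + q * y) / q := by rw [hu']; field_simp
    rw [this, map_div₀, div_lt_one₀ (zero_lt_iff.2 ((Valuation.ne_zero_iff _).2 hq0))]
    exact ((W.valuation_le_one_iff _).2 hu).trans_lt hq1
  have hcW : c ∈ W := by
    have := sub_mem (mem_of_valuation_lt_one W h1) hyW
    rwa [add_sub_cancel_right] at this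
  have hcr : resid W c = -1 := by
    have := resid_of_valuation_lt_one W h1
    rw [resid_add W hcW hyW, hy] at this
    exact eq_neg_of_add_eq_zero_left this
  have hcy : resid W (c - y) = -2 := by rw [resid_sub W hcW hyW, hcr, hy]; norm_num
  have hc1 : resid W (c - 1) = -2 := by
    rw [resid_sub W hcW (one_mem W), hcr, resid_one]; norm_num
  have hcyv : W.valuation (c - y) = 1 := (resid_ne_zero_iff W).1 (by rw [hcy]; simpa using hchar)
  have hc1v : W.valuation (c - 1) = 1 := (resid_ne_zero_iff W).1 (by rw [hc1]; simpa using hchar)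
  have hcy0 := ne_zero_of_valuation_eq_one W hcyv
  have hu2 : p + q * y = q * (c ^ 2 - y ^ 2) / (c - y) := by
    rw [hu', eq_div_iff hcy0]; ring
  have hnum : q * (c ^ 2 - y ^ 2) ∈ W := by
    rw [← W.valuation_le_one_iff] at hu ⊢
    rwa [hu2, map_div₀, hcyv, div_one] at hu
  refine ⟨q * (c ^ 2 - y ^ 2) / (c - 1), div_mem (mul_mem hq (sub_mem (pow_mem hcM 2) hy2))
    (sub_mem hcM (one_mem _)), ?_⟩
  rw [hu2, resid_div W hnum hc1v, resid_div W hnum hcyv, hcy, hc1]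

/-- The residues in a quadratic extension `M(Y)` of `M`. -/
theorem residue_quadratic {x Y : L} (htop : IntermediateField.adjoin K {x, Y} = ⊤)
    (hY : Y ^ 2 ∈ IntermediateField.adjoin K {x})
    (hchar : (2 : IsLocalRing.ResidueField W) ≠ 0) :
    (∀ y : IsLocalRing.ResidueField W, ∃ t ∈ IntermediateField.adjoin K {x}, resid W t = y) ∨
    ∃ s ∈ IntermediateField.adjoin K {x}, W.valuation (s * Y) = 1 ∧
      ∀ y : IsLocalRing.ResidueField W, ∃ p ∈ IntermediateField.adjoin K {x},
        ∃ q ∈ IntermediateField.adjoin K {x}, y = resid W p + resid W q * resid W (s * Y) := by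
  set M := IntermediateField.adjoin K {x} with hM
  have hdec := exists_eq_add_mul_of_sq_mem htop hY
  by_cases hval : ∀ s ∈ M, W.valuation (s * Y) ≠ 1
  · left
    intro y
    obtain ⟨u, hu, rfl⟩ := exists_resid_eq W y
    obtain ⟨p, hp, q, hq, rfl⟩ := hdec u
    exact ⟨p, hp, (resid_mem_of_valuation_mul_ne_one hval hp hq hu).symm⟩
  push Not at hval
  obtain ⟨s, hs, hs1⟩ := hval
  have hs0 : s ≠ 0 := by rintro rfl; simp at hs1
  by_cases hres : ∀ t ∈ M, resid W t ≠ resid W (s * Y)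
  · right
    refine ⟨s, hs, hs1, fun y => ?_⟩
    obtain ⟨u, hu, rfl⟩ := exists_resid_eq W y
    obtain ⟨p, hp, q, hq, rfl⟩ := hdec u
    have hqs : q * Y = q / s * (s * Y) := by field_simp
    rw [hqs] at hu ⊢
    obtain ⟨hpW, hqW⟩ := mem_of_resid_notMem hs1 hres hp (div_mem hq hs) hu
    have hsW := mem_of_valuation_eq_one W hs1
    exact ⟨p, hp, q / s, div_mem hq hs, by
      rw [resid_add W hpW (mul_mem hqW hsW), resid_mul W hqW hsW]⟩
  · left
    push Not at hres
    obtain ⟨t, ht, hts⟩ := hres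
    have ht1 : W.valuation t = 1 := by
      rw [← resid_ne_zero_iff, hts]; exact (resid_ne_zero_iff W).2 hs1
    have ht0 := ne_zero_of_valuation_eq_one W ht1
    have hy1 : resid W (s * Y / t) = 1 := by
      rw [resid_div W (mem_of_valuation_eq_one W hs1) ht1, hts,
        div_self ((resid_ne_zero_iff W).2 hs1)]
    have hy2 : (s * Y / t) ^ 2 ∈ M := by
      rw [div_pow, mul_pow]
      exact div_mem (mul_mem (pow_mem hs 2) hY) (pow_mem ht 2)
    intro y
    obtain ⟨u, hu, rfl⟩ := exists_resid_eq W y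
    obtain ⟨p, hp, q, hq, rfl⟩ := hdec u
    have hqs : q * Y = q * t / s * (s * Y / t) := by field_simp
    rw [hqs] at hu ⊢
    exact exists_resid_eq_of_sq_mem hy1 hy2 hchar hp (div_mem (mul_mem hq ht) hs) hu

variable {v : ValuationSubring K} [Algebra (IsLocalRing.ResidueField v) (IsLocalRing.ResidueField W)]

/-- The ruled residue theorem for a rational function field. It carries no restriction on the
residue characteristic, which matters when f is linear. -/
theorem isRuled_of_adjoin_simple_eq_top (hk : IsResidueAlgebra v W) {x : L}
    (hx : Transcendental K x) (htop : IntermediateField.adjoin K {x} = ⊤)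
    (htr : ∃ y : IsLocalRing.ResidueField W, ¬ IsAlgebraic (IsLocalRing.ResidueField v) y) :
    IsRuled (IsLocalRing.ResidueField v) (IsLocalRing.ResidueField W) := by
  have hall : ∀ y : IsLocalRing.ResidueField W,
      ∃ t ∈ IntermediateField.adjoin K {x}, resid W t = y := fun y => by
    obtain ⟨t, -, ht⟩ := exists_resid_eq W y
    exact ⟨t, htop ▸ IntermediateField.mem_top, ht⟩
  obtain ⟨y, hy⟩ := htr
  obtain ⟨t, ht, rfl⟩ := hall y
  obtain ⟨f, hf, -⟩ := exists_isKeyPolynomial hk hx ⟨t, ht, hy⟩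
  obtain ⟨e, g, he⟩ := hf.exists_isKeyPower
  refine hf.isRuled_of_forall_resid_mem (e := e) (g := g) fun y => ?_
  obtain ⟨t, ht, rfl⟩ := hall y
  exact hf.resid_mem_residueField he ht

/-- If `k(z, ω)` is generated by an algebraic subextension `k₁`, `z` and an `ω` whose square is a
monomial in `z` over `k₁` up to squares in `k₁(z)`, then it is ruled. -/
theorem isRuled_of_sq_eq_monomial {k L : Type*} [Field k] [Field L] [Algebra k L]
    (k₁ : IntermediateField k L) [FiniteDimensional k k₁] {z ω c ρ : L} {m : ℤ} (hz : z ≠ 0)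
    (hc : c ∈ k₁) (hc0 : c ≠ 0) (hρ : ρ ∈ IntermediateField.adjoin k₁ {z}) (hρ0 : ρ ≠ 0)
    (hω : ω ^ 2 = c * z ^ m * ρ ^ 2)
    (h : ∀ y : L, ∃ p ∈ IntermediateField.adjoin k₁ {z},
      ∃ q ∈ IntermediateField.adjoin k₁ {z}, y = p + q * ω) : IsRuled k L := by
  -- After removal of ρ and the even part of z^m, the square of ω₁ is c or cz. In the first case ω₁
  -- is algebraic over k₁ and z generates; in the second z is a multiple of ω₁² and ω₁ generates.
  obtain ⟨n, hn⟩ := Int.even_or_odd' m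
  set ω₁ := ω / (ρ * z ^ n) with hω₁
  have hωω : ω = ω₁ * (ρ * z ^ n) := by
    rw [hω₁, div_mul_cancel₀ _ (mul_ne_zero hρ0 (zpow_ne_zero _ hz))]
  have hsub : ∀ S : Subfield L, (∀ y ∈ k₁, y ∈ S) → z ∈ S → ω₁ ∈ S → ∀ y, y ∈ S := by
    intro S h1 h2 h3 y
    have h4 : ∀ y ∈ IntermediateField.adjoin k₁ {z}, y ∈ S := fun y hy =>
      mem_subfield_of_mem_adjoin (k := k₁) (fun a => h1 a a.2) h2 hy
    obtain ⟨p, hp, q, hq, rfl⟩ := h y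
    refine add_mem (h4 p hp) (mul_mem (h4 q hq) ?_)
    rw [hωω]
    exact mul_mem h3 (mul_mem (h4 ρ hρ) (zpow_mem h2 n))
  have hsq : ω₁ ^ 2 = c * z ^ (m - 2 * n) := by
    rw [hω₁, div_pow, hω, zpow_sub₀ hz, mul_pow, two_mul, zpow_add₀ hz]
    field_simp
  rcases hn with hn | hn
  · rw [hn, sub_self, zpow_zero, mul_one] at hsq
    have hint : IsIntegral k₁ ω₁ := by
      refine IsIntegral.of_pow two_pos ?_
      rw [hsq]
      exact isIntegral_algebraMap (x := (⟨c, hc⟩ : k₁))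
    have hfin : FiniteDimensional k₁ (IntermediateField.adjoin k₁ {ω₁}) :=
      IntermediateField.adjoin.finiteDimensional hint
    refine ⟨(IntermediateField.adjoin k₁ {ω₁}).restrictScalars k,
      Module.Finite.trans (R := k) k₁ (IntermediateField.adjoin k₁ {ω₁}), z, ?_⟩
    rw [eq_top_iff]
    set T := IntermediateField.adjoin
      ((IntermediateField.adjoin k₁ {ω₁}).restrictScalars k) {z} with hT
    have hmem : ∀ y ∈ IntermediateField.adjoin k₁ {ω₁}, y ∈ T := fun y hy =>
      T.algebraMap_mem ⟨y, hy⟩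
    exact fun y _ => hsub T.toSubfield
      (fun y hy => hmem y ((IntermediateField.adjoin k₁ {ω₁}).algebraMap_mem ⟨y, hy⟩))
      (IntermediateField.mem_adjoin_simple_self _ _)
      (hmem _ (IntermediateField.mem_adjoin_simple_self _ _)) y
  · rw [hn, add_sub_cancel_left, zpow_one] at hsq
    refine ⟨k₁, inferInstance, ω₁, ?_⟩
    rw [eq_top_iff]
    set T := IntermediateField.adjoin k₁ {ω₁} with hT
    have hmem : ∀ y ∈ k₁, y ∈ T := fun y hy => T.algebraMap_mem ⟨y, hy⟩
    have hω₁T : ω₁ ∈ T := IntermediateField.mem_adjoin_simple_self _ _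
    refine fun y _ => hsub T.toSubfield hmem ?_ hω₁T y
    have : z = c⁻¹ * ω₁ ^ 2 := by rw [hsq, inv_mul_cancel_left₀ hc0]
    rw [this]
    exact mul_mem (inv_mem (hmem c hc)) (pow_mem hω₁T 2)

/-- Let `L = K(x)(Y)` with `Y²` residually equal to a monomial in `x`. Then a residually
transcendental extension of valuations has a ruled residue field extension. -/
theorem isRuled_of_sq_sim_monomial (hk : IsResidueAlgebra v W) {x Y : L}
    (hx : Transcendental K x) (htop : IntermediateField.adjoin K {x, Y} = ⊤)
    (hY : Y ^ 2 ∈ IntermediateField.adjoin K {x}) {c : K} {j : ℕ}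
    (hsim : Sim W (Y ^ 2) (algebraMap K L c * x ^ j))
    (hchar : (2 : IsLocalRing.ResidueField W) ≠ 0)
    (htr : ∃ y : IsLocalRing.ResidueField W, ¬ IsAlgebraic (IsLocalRing.ResidueField v) y) :
    IsRuled (IsLocalRing.ResidueField v) (IsLocalRing.ResidueField W) := by
  have hres := residue_quadratic htop hY hchar
  set M := IntermediateField.adjoin K {x} with hM
  -- The residue field is at most quadratic over the residues of K(x), so a transcendental residue
  -- already occurs there.
  have hu : ∃ u ∈ M, ¬ IsAlgebraic (IsLocalRing.ResidueField v) (resid W u) := by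
    by_contra! hall
    obtain ⟨y, hy⟩ := htr
    apply hy
    rcases hres with h | ⟨s, hs, hs1, h⟩
    · obtain ⟨t, ht, rfl⟩ := h y
      exact hall t ht
    · obtain ⟨p, hp, q, hq, rfl⟩ := h y
      have h1 : IsAlgebraic (IsLocalRing.ResidueField v) (resid W (s * Y)) := by
        refine IsAlgebraic.of_pow two_pos ?_
        rw [← resid_pow W (mem_of_valuation_eq_one W hs1), mul_pow]
        exact hall _ (mul_mem (pow_mem hs 2) hY)
      exact (hall p hp).add ((hall q hq).mul h1)
  obtain ⟨f, hf, hfx⟩ := exists_isKeyPolynomial hk hx hu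
  obtain ⟨e, g, he⟩ := hf.exists_isKeyPower
  rcases hres with h | ⟨s, hs, hs1, h⟩
  · refine hf.isRuled_of_forall_resid_mem (e := e) (g := g) fun y => ?_
    obtain ⟨t, ht, rfl⟩ := h y
    exact hf.resid_mem_residueField he ht
  -- Either x is residually algebraic, hence low because 1 < 2 deg f, or f = X and x is f(x); so
  -- every monomial in x is low times a power of f(x).
  obtain ⟨b, hb, ι, hxb⟩ : ∃ b, Low W x f b ∧ ∃ ι : ℕ, x = b * aeval x f ^ ι := by
    rcases hfx with hxa | rfl
    · refine ⟨x, ?_, 0, by simp⟩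
      have := hf.low_of_natDegree_lt (P := X) (by
        rw [natDegree_X]; have := hf.natDegree_pos; omega) (by rwa [aeval_X])
      rwa [aeval_X] at this
    · exact ⟨1, by simpa using hf.low_algebraMap (one_ne_zero (α := K)), 1, by simp⟩
  have hs0 : s ≠ 0 := by rintro rfl; simp at hs1
  have hF0 := hf.aeval_ne_zero hf.ne_zero
  obtain ⟨a, ha, i, s₁, hs₁, hs₁m, hsa⟩ := hf.exists_normalForm he hs hs0
  have hc0 : c ≠ 0 := by
    rintro rfl
    exact hsim.right_ne_zero (by simp)
  have hsim' : Sim W ((s * Y) ^ 2)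
      ((a ^ 2 * algebraMap K L c * b ^ j * aeval x f ^ (2 * i + ι * j)) * s₁ ^ 2) := by
    have h1 := (Sim.refl (W := W) (pow_ne_zero 2 hs0)).mul hsim
    rw [← mul_pow] at h1
    convert h1 using 1
    have h2 : x ^ j = b ^ j * aeval x f ^ ((ι : ℤ) * j) := by
      conv_lhs => rw [hxb]
      rw [mul_pow, ← pow_mul, ← zpow_natCast _ (ι * j)]
      push_cast
      rfl
    have h3 : aeval x f ^ (2 * i) = (aeval x f ^ i) ^ 2 := by
      rw [mul_comm, zpow_mul, zpow_ofNat]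
    rw [h2, zpow_add₀ hF0, h3]
    conv_rhs => rw [hsa]
    ring
  have hsW := mem_of_valuation_eq_one W hs1
  have hs₁W := mem_of_valuation_eq_one W hs₁
  have hv : W.valuation
      (a ^ 2 * algebraMap K L c * b ^ j * aeval x f ^ (2 * i + ι * j)) = 1 := by
    have h1 := hsim'.valuation_eq
    rw [map_pow, hs1, one_pow, map_mul, map_pow _ s₁, hs₁, one_pow, mul_one] at h1
    exact h1.symm
  obtain ⟨d, hd, hd0, m, hdm⟩ := hf.exists_resid_low_mul he
    (hf.low_mul (hf.low_mul (hf.low_pow ha 2) (hf.low_algebraMap hc0)) (hf.low_pow hb j)) hv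
  have hω : resid W (s * Y) ^ 2 =
      d * resid W (aeval x f ^ e / g) ^ m * resid W s₁ ^ 2 := by
    rw [← hdm, ← resid_pow W hsW, ← resid_pow W hs₁W, ← resid_mul W (mem_of_valuation_eq_one W hv)
      (pow_mem hs₁W 2)]
    exact hsim'.resid_eq (by rw [map_mul, hv, map_pow, hs₁, one_pow, one_mul])
  have := hf.finiteDimensional_lowField
  refine isRuled_of_sq_eq_monomial hf.lowField
    ((resid_ne_zero_iff W).2 (IsKeyPolynomial.valuation_keyPower he)) hd hd0 hs₁m
    ((resid_ne_zero_iff W).2 hs₁) hω fun y => ?_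
  obtain ⟨p, hp, q, hq, rfl⟩ := h y
  exact ⟨_, hf.resid_mem_residueField he hp, _, hf.resid_mem_residueField he hq, rfl⟩

end Quadratic

/-! ### Factors with linear reduction, and irreducibility over F. -/

section Factor

variable {K : Type*} [Field K] (v : ValuationSubring K)

/-- A proper factorization can be taken over v by Gauss's lemma. The degrees of the two reductions
add up to 1, so one reduction is a nonzero constant; a lift of this constant is absorbed into the
other factor, and the degree drops. -/
theorem exists_isResidualFactor {P : v[X]} (hP : (reduce v P).natDegree = 1) :
    ∃ Q : v[X], IsResidualFactor v P Q := by
  induction hn : P.natDegree using Nat.strong_induction_on generalizing P with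
  | _ n ih =>
  have hprim : ∀ {R : v[X]}, (reduce v R).natDegree = 1 → IsPrimitivePoly v R := fun h h0 => by
    rw [h0] at h; simp at h
  have aux : ∀ A B : v[X], P = A * B → 0 < B.natDegree → (reduce v A).natDegree = 1 →
      (reduce v B).natDegree = 0 → ∃ Q : v[X], IsResidualFactor v P Q := by
    intro A B hAB hBpos hA hB
    obtain ⟨u, hu⟩ := natDegree_eq_zero.1 hB
    have hPr : reduce v P = reduce v A * C u := by
      rw [hu, hAB, reduce, Polynomial.map_mul]; rfl
    have hu0 : u ≠ 0 := by
      rintro rfl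
      rw [hPr] at hP
      simp at hP
    obtain ⟨a, rfl⟩ := IsLocalRing.residue_surjective u
    have ha : IsUnit a := (IsLocalRing.residue_ne_zero_iff_isUnit a).1 hu0
    have hred : reduce v (A * C a) = reduce v P := by
      rw [hPr, reduce, Polynomial.map_mul, map_C]; rfl
    have hA0 : A ≠ 0 := by rintro rfl; simp [reduce] at hA
    have hB0 : B ≠ 0 := by rintro rfl; simp at hBpos
    obtain ⟨Q, hQ1, hQ2, hQ3, hQ4⟩ := ih (A * C a).natDegree (by
      rw [natDegree_mul_C ha.ne_zero, ← hn, hAB, natDegree_mul hA0 hB0]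
      omega) (by rw [hred]; exact hP) rfl
    refine ⟨Q, hQ1, ?_, hQ3, hQ4.trans hred⟩
    obtain ⟨a', ha'⟩ := ha.exists_right_inv
    have : A * C a ∣ A := ⟨C a', by rw [mul_assoc, ← C_mul, ha', C_1, mul_one]⟩
    exact (hQ2.trans this).trans (Dvd.intro _ hAB.symm)
  by_cases hirr : Irreducible (P.map v.subtype)
  · exact ⟨P, hirr, dvd_rfl, hprim hP, rfl⟩
  have hP0 : P ≠ 0 := by rintro rfl; simp [reduce] at hP
  have hPm0 : P.map v.subtype ≠ 0 := fun h0 =>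
    hP0 (map_subtype_injective v (by rw [h0, Polynomial.map_zero]))
  have hPdeg : 0 < P.natDegree := by
    have : (reduce v P).natDegree ≤ P.natDegree := natDegree_map_le
    omega
  have hnm : ∀ R : v[X], (R.map v.subtype).natDegree = R.natDegree := fun R =>
    natDegree_map_eq_of_injective Subtype.val_injective R
  have hnu : ¬ IsUnit (P.map v.subtype) := fun hu => by
    have := natDegree_eq_zero_of_isUnit hu
    rw [hnm] at this
    omega
  rw [irreducible_iff] at hirr
  push Not at hirr
  obtain ⟨A, B, hAB, hA, hB⟩ := hirr hnu
  have hA0 : A ≠ 0 := by rintro rfl; exact hPm0 (by rw [hAB, zero_mul])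
  have hB0 : B ≠ 0 := by rintro rfl; exact hPm0 (by rw [hAB, mul_zero])
  obtain ⟨d, hd, A', hA', hA'p⟩ := exists_primitive_scaling v hA0
  obtain ⟨B', hB'⟩ := dvd_of_map_dvd_map v (Q := A') (G := P) hA'p (by
    rw [hA', hAB]
    exact ⟨C d⁻¹ * B, by rw [mul_mul_mul_comm, ← C_mul, mul_inv_cancel₀ hd, C_1, one_mul]⟩)
  have hA'deg : 0 < A'.natDegree := by
    rw [← hnm, hA', natDegree_C_mul hd]
    exact natDegree_pos_iff_degree_pos.2 (degree_pos_of_ne_zero_of_nonunit hA0 hA)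
  have hBdeg : 0 < B.natDegree :=
    natDegree_pos_iff_degree_pos.2 (degree_pos_of_ne_zero_of_nonunit hB0 hB)
  have hA'0 : A' ≠ 0 := by rintro rfl; simp at hA'deg
  have hB'0 : B' ≠ 0 := by rintro rfl; exact hP0 (by rw [hB', mul_zero])
  have hB'deg : 0 < B'.natDegree := by
    have h1 : (P.map v.subtype).natDegree = A.natDegree + B.natDegree := by
      rw [hAB, natDegree_mul hA0 hB0]
    rw [hnm, hB', natDegree_mul hA'0 hB'0, ← hnm A', hA', natDegree_C_mul hd] at h1
    omega
  have hsum : (reduce v A').natDegree + (reduce v B').natDegree = 1 := by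
    have hmul : reduce v P = reduce v A' * reduce v B' := by
      rw [hB', reduce, Polynomial.map_mul]; rfl
    rw [← hP, hmul, natDegree_mul hA'p]
    intro h0
    apply hprim hP
    rw [hmul, h0, mul_zero]
  rcases Nat.eq_zero_or_pos (reduce v A').natDegree with h0 | h0
  · exact aux B' A' (by rw [hB', mul_comm]) hA'deg (by omega) h0
  · exact aux A' B' hB' hB'deg (by omega) (by omega)

/-- An irreducible polynomial stays irreducible over an extension field in which the base field is
relatively algebraically closed. -/
theorem irreducible_map_of_forall_isAlgebraic {E F : Type*} [Field E] [Field F] [Algebra E F]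
    (hE : ∀ x : F, IsAlgebraic E x → x ∈ Set.range (algebraMap E F)) {Q : E[X]}
    (hQ : Irreducible Q) : Irreducible (Q.map (algebraMap E F)) := by
  -- The coefficients of a monic factor are integral over E, hence lie in E.
  have key : ∀ A : F[X], A.Monic → A ∣ Q.map (algebraMap E F) →
      ∃ A₀ : E[X], A₀.map (algebraMap E F) = A := by
    intro A hA hdvd
    have hmon : (Q * C Q.leadingCoeff⁻¹).Monic := monic_mul_leadingCoeff_inv hQ.ne_zero
    have h1 := integralClosure.mem_lifts_of_monic_of_dvd_map F hmon hA (by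
      rw [Polynomial.map_mul]; exact Dvd.dvd.mul_right hdvd _)
    rw [lifts_iff_coeff_lifts] at h1
    have h2 : A ∈ lifts (algebraMap E F) := (lifts_iff_coeff_lifts A).2 fun n => by
      obtain ⟨y, hy⟩ := h1 n
      exact hE _ (hy ▸ (IsIntegral.isAlgebraic y.2))
    exact h2
  refine ⟨fun hu => hQ.not_isUnit ?_, fun A B hAB => ?_⟩
  · exact (isUnit_map _).1 hu
  have hQ0 : Q.map (algebraMap E F) ≠ 0 := by
    rw [Ne, Polynomial.map_eq_zero]; exact hQ.ne_zero
  have hA0 : A ≠ 0 := by rintro rfl; exact hQ0 (by rw [hAB, zero_mul])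
  obtain ⟨A₀, hA₀⟩ := key _ (monic_mul_leadingCoeff_inv hA0)
    (hAB ▸ Dvd.dvd.mul_right (by
      have hu : IsUnit (C A.leadingCoeff⁻¹) :=
        isUnit_C.2 (IsUnit.mk0 _ (inv_ne_zero (leadingCoeff_ne_zero.2 hA0)))
      exact (IsUnit.mul_right_dvd hu).2 dvd_rfl) B)
  have hdvd : A₀ ∣ Q := by
    rw [← map_dvd_map' (algebraMap E F), hA₀, hAB]
    refine Dvd.dvd.mul_right ?_ B
    exact (IsUnit.mul_right_dvd (isUnit_C.2 (IsUnit.mk0 _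
      (inv_ne_zero (leadingCoeff_ne_zero.2 hA0))))).2 dvd_rfl
  have hdegA : A₀.natDegree = A.natDegree := by
    rw [← natDegree_map (algebraMap E F), hA₀,
      natDegree_mul_C (inv_ne_zero (leadingCoeff_ne_zero.2 hA0))]
  have hB0 : B ≠ 0 := by rintro rfl; exact hQ0 (by rw [hAB, mul_zero])
  have hunit : ∀ R : F[X], R ≠ 0 → R.natDegree = 0 → IsUnit R := fun R hR h => by
    obtain ⟨a, rfl⟩ := natDegree_eq_zero.1 h
    exact isUnit_C.2 (IsUnit.mk0 a (by rintro rfl; simp at hR))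
  obtain ⟨B₀, hB₀⟩ := hdvd
  rcases hQ.isUnit_or_isUnit hB₀ with h | h
  · exact Or.inl (hunit A hA0 (by rw [← hdegA, natDegree_eq_zero_of_isUnit h]))
  · right
    refine hunit B hB0 ?_
    have h1 : (Q.map (algebraMap E F)).natDegree = A.natDegree + B.natDegree := by
      rw [hAB, natDegree_mul hA0 hB0]
    have hA₀0 : A₀ ≠ 0 := by rintro rfl; exact hQ.ne_zero (by rw [hB₀, zero_mul])
    rw [natDegree_map, hB₀, natDegree_mul hA₀0 h.ne_zero, natDegree_eq_zero_of_isUnit h, hdegA]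
      at h1
    omega

end Factor

/-! ### Polynomials with a root of maximal multiplicity. -/

section RootsOfMaximalMultiplicity

variable {k : Type*} [Field k]

theorem coeff_X_sub_C_pow (x : k) (n i : ℕ) :
    ((X - C x) ^ n).coeff i = (-x) ^ (n - i) * (n.choose i : k) := by
  rw [sub_eq_add_neg, ← C_neg, coeff_X_add_C_pow]

theorem coeff_pred_C_mul_X_sub_C_pow (a x : k) {r : ℕ} (hr : 0 < r) :
    (C a * (X - C x) ^ r).coeff (r - 1) = -(r * x * a) := by
  rw [coeff_C_mul, coeff_X_sub_C_pow, Nat.sub_sub_self hr, pow_one, Nat.choose_symm hr,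
    Nat.choose_one_right]
  ring

/-- Over the algebraic closure p is a constant times (X - ρ)^r, and the coefficient at r - 1
recovers rρ; as r is invertible, ρ lies in k. -/
theorem eq_C_mul_X_sub_C_pow_of_isPurelyInseparablePoly {p : k[X]} {r : ℕ}
    (hr : 0 < r) (hp : IsPurelyInseparablePoly p) (hdeg : p.natDegree = r) (hrk : (r : k) ≠ 0) :
    p = C (p.coeff r) * (X - C (-(p.coeff (r - 1) / (r * p.coeff r)))) ^ r := by
  obtain ⟨ρ, hρ, huniq⟩ := hp
  have hp0 : p ≠ 0 := by rintro rfl; simp at hdeg; omega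
  have hlc : p.coeff r ≠ 0 := by rw [← hdeg]; exact leadingCoeff_ne_zero.2 hp0
  set φ := algebraMap k (AlgebraicClosure k) with hφ
  have hsplit : (p.map φ).Splits := IsAlgClosed.splits _
  have hpm0 : p.map φ ≠ 0 := (Polynomial.map_ne_zero_iff φ.injective).2 hp0
  have hcard : Multiset.card (p.map φ).roots = r := by
    rw [← hsplit.natDegree_eq_card_roots, natDegree_map, hdeg]
  have hroots : (p.map φ).roots = Multiset.replicate r ρ := by
    rw [Multiset.eq_replicate]
    refine ⟨hcard, fun y hy => huniq y ?_⟩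
    have := (mem_roots hpm0).1 hy
    rwa [IsRoot.def, eval_map_algebraMap] at this
  have heq : p.map φ = C (φ (p.coeff r)) * (X - C ρ) ^ r := by
    conv_lhs => rw [hsplit.eq_prod_roots]
    rw [hroots, Multiset.map_replicate, Multiset.prod_replicate, leadingCoeff, natDegree_map,
      coeff_map, hdeg]
  have hpred := congrArg (fun P => P.coeff (r - 1)) heq
  rw [coeff_map, coeff_pred_C_mul_X_sub_C_pow _ _ hr] at hpred
  have hρ' : ρ = φ (-(p.coeff (r - 1) / (r * p.coeff r))) := by
    have h1 : φ (p.coeff r) ≠ 0 := (_root_.map_ne_zero φ).2 hlc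
    have h2 : (r : AlgebraicClosure k) ≠ 0 := by
      rw [← map_natCast φ]; exact (_root_.map_ne_zero φ).2 hrk
    rw [map_neg, map_div₀, map_mul, map_natCast, hpred]
    field_simp
  apply Polynomial.map_injective φ φ.injective
  rw [heq, hρ', Polynomial.map_mul, map_C, Polynomial.map_pow, Polynomial.map_sub, map_X, map_C]

theorem eq_C_mul_X_sub_C_pow_of_le_rootMultiplicity {p : k[X]} {x : k} {r : ℕ} (hp : p ≠ 0)
    (hdeg : p.natDegree ≤ r) (hr : r ≤ p.rootMultiplicity x) :
    p = C (p.coeff r) * (X - C x) ^ r := by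
  obtain ⟨s, hs⟩ := (pow_dvd_pow (X - C x) hr).trans (pow_rootMultiplicity_dvd p x)
  have hs0 : s ≠ 0 := by rintro rfl; exact hp (by rw [hs, mul_zero])
  have hd := congrArg natDegree hs
  rw [natDegree_mul (pow_ne_zero _ (X_sub_C_ne_zero x)) hs0, natDegree_pow, natDegree_X_sub_C,
    mul_one] at hd
  obtain ⟨a, rfl⟩ := natDegree_eq_zero.1 (show s.natDegree = 0 by omega)
  have hcoeff : p.coeff r = a := by
    rw [hs, mul_comm, coeff_C_mul, coeff_X_sub_C_pow, Nat.sub_self, pow_zero, Nat.choose_self,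
      Nat.cast_one, mul_one, mul_one]
  rw [hcoeff, mul_comm]
  exact hs

end RootsOfMaximalMultiplicity

/-! ### Minimal index sets and multiplicities. -/

section MinSet

variable {E F : Type*} [Field E] [Field F] [Algebra E F]

theorem mem_minSet {g : E[X]} {X : F} {w : ValuationSubring F} {i : ℕ} :
    i ∈ minSet g X w ↔ i ≤ g.natDegree ∧ ∀ j ≤ g.natDegree,
      w.valuation (algebraMap E F (g.coeff j) * X ^ j) ≤
        w.valuation (algebraMap E F (g.coeff i) * X ^ i) := by
  classical
  simp [minSet, Finset.mem_filter]

theorem minSet_nonempty (g : E[X]) (X : F) (w : ValuationSubring F) : (minSet g X w).Nonempty := by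
  obtain ⟨i, hi, h⟩ := Finset.exists_max_image (Finset.range (g.natDegree + 1))
    (fun j => w.valuation (algebraMap E F (g.coeff j) * X ^ j)) ⟨0, by simp⟩
  exact ⟨i, mem_minSet.2 ⟨Nat.lt_succ_iff.1 (Finset.mem_range.1 hi), fun j hj =>
    h j (Finset.mem_range.2 (Nat.lt_succ_iff.2 hj))⟩⟩

theorem coeff_ne_zero_of_mem_minSet {g : E[X]} (hg : g ≠ 0) {X : F} (hX : X ≠ 0)
    {w : ValuationSubring F} {i : ℕ} (hi : i ∈ minSet g X w) : g.coeff i ≠ 0 := by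
  intro h0
  have := (mem_minSet.1 hi).2 g.natDegree le_rfl
  rw [h0, map_zero, zero_mul, map_zero] at this
  have h1 : algebraMap E F (g.coeff g.natDegree) * X ^ g.natDegree ≠ 0 :=
    mul_ne_zero ((_root_.map_ne_zero _).2 (leadingCoeff_ne_zero.2 hg)) (pow_ne_zero _ hX)
  exact (Valuation.ne_zero_iff w.valuation).2 h1 (le_antisymm this zero_le)

theorem minIdx_mem {S : Finset ℕ} (hS : S.Nonempty) : minIdx S ∈ S := by
  have := Nat.sInf_mem (s := (S : Set ℕ)) (by simpa using hS)
  simpa [minIdx] using this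

/-- A term beyond r has an integral coefficient and a higher power of an element of the maximal
ideal, so the r-th term strictly dominates it. -/
theorem le_of_mem_minSet {g : E[X]} {X : F} (hX0 : X ≠ 0) {v : ValuationSubring E}
    {w : ValuationSubring F} (h : IsExtension v w) (hX : w.valuation X < 1)
    (hg : ∀ i, g.coeff i ∈ v) {r : ℕ} (hr : v.valuation (g.coeff r) = 1) {i : ℕ}
    (hi : i ∈ minSet g X w) : i ≤ r := by
  by_contra! hlt
  have hrn : r ≤ g.natDegree := le_natDegree_of_ne_zero (ne_zero_of_valuation_eq_one v hr)
  have h1 := (mem_minSet.1 hi).2 r hrn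
  obtain ⟨m, rfl⟩ := Nat.exists_eq_add_of_lt hlt
  rw [map_mul, (h.valuation_eq_one_iff _).2 hr, one_mul, map_mul] at h1
  have h2 : w.valuation (algebraMap E F (g.coeff (r + m + 1))) ≤ 1 :=
    (w.valuation_le_one_iff _).2 ((h.mem_iff _).2 (hg _))
  have h3 : w.valuation (X ^ (r + m + 1)) < w.valuation (X ^ r) := by
    have hpos : 0 < w.valuation X := zero_lt_iff.2 ((Valuation.ne_zero_iff _).2 hX0)
    rw [map_pow, map_pow]
    exact pow_lt_pow_right_of_lt_one₀ hpos hX (by omega)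
  exact absurd h1 (not_le.2 ((mul_le_of_le_one_left zero_le h2).trans_lt h3))

theorem sim_of_minSet_eq_singleton {g : E[X]} (hg : g ≠ 0) {X : F} (hX : X ≠ 0)
    {w : ValuationSubring F} {j : ℕ} (hj : minSet g X w = {j}) :
    Sim w (aeval X g) (algebraMap E F (g.coeff j) * X ^ j) := by
  have hjm : j ∈ minSet g X w := by rw [hj]; exact Finset.mem_singleton_self j
  have hjr : j ∈ Finset.range (g.natDegree + 1) :=
    Finset.mem_range.2 (Nat.lt_succ_iff.2 (mem_minSet.1 hjm).1)
  have hne : algebraMap E F (g.coeff j) * X ^ j ≠ 0 :=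
    mul_ne_zero ((_root_.map_ne_zero _).2 (coeff_ne_zero_of_mem_minSet hg hX hjm))
      (pow_ne_zero _ hX)
  refine Sim.of_sub ?_
  have h1 : aeval X g - algebraMap E F (g.coeff j) * X ^ j =
      ∑ i ∈ (Finset.range (g.natDegree + 1)).erase j, algebraMap E F (g.coeff i) * X ^ i := by
    rw [aeval_eq_sum_range, sub_eq_iff_eq_add]
    simp only [Algebra.smul_def]
    exact (Finset.sum_erase_add _ _ hjr).symm
  rw [h1]
  refine Valuation.map_sum_lt _ ((Valuation.ne_zero_iff _).2 hne) fun i hi => ?_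
  rw [Finset.mem_erase, Finset.mem_range, Nat.lt_succ_iff] at hi
  by_contra! hle
  apply hi.1
  rw [← Finset.mem_singleton, ← hj]
  exact mem_minSet.2 ⟨hi.2, fun l hl => ((mem_minSet.1 hjm).2 l hl).trans hle⟩

theorem residuePoly_natDegree_le (v : ValuationSubring E) {S : Finset ℕ} (g : E[X]) (X : F) (c : E)
    {r : ℕ} (hS : ∀ i ∈ S, (i - minIdx S) / ramIdx v S g X ≤ r) :
    (residuePoly v S g X c).natDegree ≤ r :=
  natDegree_sum_le_of_forall_le _ _ fun i hi => (natDegree_monomial_le _).trans (hS i hi)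

theorem residuePoly_coeff_of_eq_one (v : ValuationSubring E) {S : Finset ℕ} {g : E[X]} {X : F}
    (c : E) (h0 : minIdx S = 0) (h1 : ramIdx v S g X = 1) (j : ℕ) :
    (residuePoly v S g X c).coeff j =
      if j ∈ S then resid v (g.coeff j * (g.coeff 0)⁻¹ * (c ^ j)⁻¹) else 0 := by
  rw [residuePoly, finsetSum_coeff]
  simp only [h0, h1, Nat.sub_zero, Nat.div_one, coeff_monomial]
  exact Finset.sum_ite_eq' S j _

/-- Multiplicity r would leave only a constant times (t - x)^r. As r - 1 is not in S and r is
invertible, x = 0, contradicting the constant coefficient 1. -/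
theorem lt_of_mem_Mult (v : ValuationSubring E) {S : Finset ℕ} {g : E[X]} {X : F} {r : ℕ}
    (hr : 0 < r) (hrk : (r : IsLocalRing.ResidueField v) ≠ 0) (hS : S.Nonempty)
    (hSr : ∀ i ∈ S, i ≤ r) (hpred : r - 1 ∉ S) (hmin : g.coeff (minIdx S) ≠ 0) {m : ℕ}
    (hm : m ∈ Mult v S g X) : m < r := by
  obtain ⟨c, -, x, -, rfl⟩ := hm
  set p := residuePoly v S g X c with hp
  set φ := algebraMap (IsLocalRing.ResidueField v)
    (AlgebraicClosure (IsLocalRing.ResidueField v)) with hφ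
  by_contra! hle
  have hp0 : p.map φ ≠ 0 := by
    intro h0
    rw [h0, rootMultiplicity_zero] at hle
    omega
  have hdeg : p.natDegree ≤ r := residuePoly_natDegree_le v g X c fun i hi =>
    (Nat.div_le_self _ _).trans ((Nat.sub_le _ _).trans (hSr i hi))
  have heq := eq_C_mul_X_sub_C_pow_of_le_rootMultiplicity hp0 (by rwa [natDegree_map]) hle
  have hcr : p.coeff r ≠ 0 := by
    intro h0
    rw [coeff_map, h0, map_zero, C_0, zero_mul] at heq
    exact hp0 heq
  obtain ⟨i, hi, hir⟩ : ∃ i ∈ S, (i - minIdx S) / ramIdx v S g X = r := by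
    by_contra! hne
    apply hcr
    rw [hp, residuePoly, finsetSum_coeff]
    exact Finset.sum_eq_zero fun i hi => by rw [coeff_monomial, if_neg (hne i hi)]
  have h1 := Nat.div_le_self (i - minIdx S) (ramIdx v S g X)
  have h2 := hSr i hi
  have hmin0 : minIdx S = 0 := by omega
  -- Degree r can only arise from i = r, i₀ = 0 and e_S = 1; the default value e_S = 0 would give
  -- exponent 0, which r > 0 excludes.
  have hram : ramIdx v S g X = 1 := by
    have h3 : i - minIdx S = r := by omega
    rw [h3] at hir
    exact (Nat.div_eq_self.1 hir).resolve_left hr.ne'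
  have hcoeff := residuePoly_coeff_of_eq_one v (g := g) (X := X) c hmin0 hram
  have hx0 : x = 0 := by
    have h3 := congrArg (fun P => P.coeff (r - 1)) heq
    rw [coeff_pred_C_mul_X_sub_C_pow _ _ hr, coeff_map, hcoeff, if_neg hpred, map_zero,
      zero_eq_neg, coeff_map] at h3
    have h4 : φ (p.coeff r) ≠ 0 := (_root_.map_ne_zero φ).2 hcr
    have h5 : (r : AlgebraicClosure (IsLocalRing.ResidueField v)) ≠ 0 := by
      rw [← map_natCast φ]; exact (_root_.map_ne_zero φ).2 hrk
    exact ((mul_eq_zero.1 ((mul_eq_zero.1 h3).resolve_right h4))).resolve_left h5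
  have h3 := congrArg (fun P => P.coeff 0) heq
  have h0S : 0 ∈ S := hmin0 ▸ minIdx_mem hS
  rw [hmin0] at hmin
  rw [hx0, C_0, sub_zero, coeff_C_mul, coeff_X_pow, if_neg hr.ne, mul_zero, coeff_map, hcoeff,
    if_pos h0S, mul_inv_cancel₀ hmin, pow_zero, inv_one, mul_one, resid_one, map_one] at h3
  exact one_ne_zero h3

end MinSet

/-! ### The scaled polynomial, its Hasse derivative and the root of p. -/

section Scaled

variable {E F : Type*} [Field E] [Field F] [Algebra E F]

/-- `a₀⁻¹ f(c⁻¹ t)`. -/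
def scaledPoly (f : E[X]) (c : E) : E[X] := C (f.coeff 0)⁻¹ * f.comp (C c⁻¹ * X)

theorem scaledPoly_coeff (f : E[X]) (c : E) (i : ℕ) :
    (scaledPoly f c).coeff i = (f.coeff 0)⁻¹ * (f.coeff i * c⁻¹ ^ i) := by
  rw [scaledPoly, coeff_C_mul, comp_C_mul_X_coeff]

/-- Both 0 and 1 belong to the index set, so d = 1, and a₁/a₀ serves as b and as the element
witnessing order one. -/
theorem ramIdx_range_eq_one {v : ValuationSubring E} {f : E[X]} (hf : f ≠ 0) {X : F} (hX : X ≠ 0)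
    {r : ℕ} (hS : Finset.range (r + 1) ∈ indexSets v f X) :
    ramIdx v (Finset.range (r + 1)) f X = 1 := by
  obtain ⟨-, hcard, w, hw, hwS⟩ := hS
  rw [Finset.card_range] at hcard
  have h0S : 0 ∈ Finset.range (r + 1) := by simp
  have h1S : 1 ∈ Finset.range (r + 1) := by rw [Finset.mem_range]; omega
  have hmin : minIdx (Finset.range (r + 1)) = 0 :=
    Nat.sInf_eq_zero.2 (Or.inl (by exact_mod_cast h0S))
  have hgcd : gcdIdx (Finset.range (r + 1)) = 1 := by
    have := Finset.gcd_dvd (f := fun i => i - minIdx (Finset.range (r + 1))) h1S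
    simp only [hmin, Nat.sub_zero] at this
    rw [gcdIdx, hmin]
    exact Nat.dvd_one.1 this
  have ha0 : f.coeff 0 ≠ 0 := coeff_ne_zero_of_mem_minSet hf hX (hwS ▸ h0S)
  have ha1 : f.coeff 1 ≠ 0 := coeff_ne_zero_of_mem_minSet hf hX (hwS ▸ h1S)
  have hmem : 1 ∈ {e : ℕ | 0 < e ∧ ∃ b : E, b ≠ 0 ∧
      (∀ w ∈ OmegaS v (Finset.range (r + 1)) f X,
        w.valuation (algebraMap E F b * X ^ gcdIdx (Finset.range (r + 1))) = 1) ∧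
      ∃ a : E, a ≠ 0 ∧ v.valuation b ^ e = v.valuation a ^ gcdIdx (Finset.range (r + 1))} := by
    have hb : f.coeff 1 / f.coeff 0 ≠ 0 := div_ne_zero ha1 ha0
    refine ⟨one_pos, f.coeff 1 / f.coeff 0, hb, fun w' hw' => ?_, f.coeff 1 / f.coeff 0, hb, by
      rw [hgcd]⟩
    have hm0 := mem_minSet.1 (hw'.2 ▸ h0S : 0 ∈ minSet f X w')
    have hm1 := mem_minSet.1 (hw'.2 ▸ h1S : 1 ∈ minSet f X w')
    have heq := le_antisymm (hm0.2 1 hm1.1) (hm1.2 0 hm0.1)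
    rw [pow_zero, mul_one, pow_one] at heq
    rw [hgcd, pow_one, map_div₀, div_mul_eq_mul_div, map_div₀, heq]
    exact div_self ((Valuation.ne_zero_iff _).2 ((_root_.map_ne_zero _).2 ha0))
  have h1 : ramIdx v (Finset.range (r + 1)) f X ≤ 1 := Nat.sInf_le hmem
  have h2 := (Nat.sInf_mem ⟨1, hmem⟩).1
  exact le_antisymm h1 h2

/-- The numerical data of the index set `{0, …, r}`. -/
structure IsInitialData (v : ValuationSubring E) (f : E[X]) (X : F) (r : ℕ) (c : E) : Prop where
  pos : 0 < r
  le_natDegree : r ≤ f.natDegree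
  coeff_zero_ne_zero : f.coeff 0 ≠ 0
  ramIdx_eq_one : ramIdx v (Finset.range (r + 1)) f X = 1
  ne_zero : c ≠ 0
  valuation_coeff_eq_one : ∀ i ≤ r, v.valuation ((scaledPoly f c).coeff i) = 1
  valuation_coeff_lt_one : ∀ i, r < i → v.valuation ((scaledPoly f c).coeff i) < 1

/-- Since cX is a unit, b_i has the valuation of a_iX^i divided by that of a₀, and comparison with
the term of index 0 decides membership in the minimal set. -/
theorem isInitialData {v : ValuationSubring E} {f : E[X]} (hf : f ≠ 0) {X : F} (hX : X ≠ 0)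
    {r : ℕ} (hS : Finset.range (r + 1) ∈ indexSets v f X) {c : E}
    (hc : c ∈ scalars v (Finset.range (r + 1)) f X) : IsInitialData v f X r c := by
  have hram := ramIdx_range_eq_one hf hX hS
  obtain ⟨hsub, hcard, w, hw, hwS⟩ := hS
  rw [Finset.card_range] at hcard
  have h0S : 0 ∈ minSet f X w := by rw [hwS]; simp
  have ha0 : f.coeff 0 ≠ 0 := coeff_ne_zero_of_mem_minSet hf hX h0S
  obtain ⟨hc0, hc1⟩ := hc
  rw [hram] at hc1
  simp only [pow_one] at hc1
  have hθ := hc1 w ⟨hw, hwS⟩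
  obtain ⟨hext, -⟩ := hw
  have hkey : ∀ i, w.valuation (algebraMap E F ((scaledPoly f c).coeff i)) =
      w.valuation (algebraMap E F (f.coeff i) * X ^ i) /
        w.valuation (algebraMap E F (f.coeff 0) * X ^ 0) := by
    intro i
    have h1 : algebraMap E F ((scaledPoly f c).coeff i) * (algebraMap E F c * X) ^ i =
        algebraMap E F (f.coeff i) * X ^ i / (algebraMap E F (f.coeff 0) * X ^ 0) := by
      have h2 : algebraMap E F c ≠ 0 := (_root_.map_ne_zero _).2 hc0
      rw [scaledPoly_coeff, map_mul, map_mul, map_pow, map_inv₀, map_inv₀, pow_zero, mul_one,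
        mul_pow, inv_pow]
      field_simp
    rw [← map_div₀, ← h1, map_mul, map_pow, hθ, one_pow, mul_one]
  have hne : w.valuation (algebraMap E F (f.coeff 0) * X ^ 0) ≠ 0 := by
    rw [pow_zero, mul_one]
    exact (Valuation.ne_zero_iff _).2 ((_root_.map_ne_zero _).2 ha0)
  have hm0 := mem_minSet.1 h0S
  refine ⟨by omega, ?_, ha0, hram, hc0, fun i hi => ?_, fun i hi => ?_⟩
  · have := Finset.mem_range.1 (hsub (Finset.mem_range.2 (Nat.lt_succ_self r)))
    omega
  · have hm := mem_minSet.1 (hwS.symm ▸ Finset.mem_range.2 (Nat.lt_succ_of_le hi) :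
      i ∈ minSet f X w)
    rw [← hext.valuation_eq_one_iff, hkey, le_antisymm (hm0.2 i hm.1) (hm.2 0 hm0.1),
      div_self hne]
  · rw [← hext.valuation_lt_one_iff, hkey, div_lt_one₀ (zero_lt_iff.2 hne)]
    by_contra! hle
    by_cases hin : i ≤ f.natDegree
    · have hmem : i ∈ minSet f X w := mem_minSet.2 ⟨hin, fun j hj => (hm0.2 j hj).trans hle⟩
      rw [hwS, Finset.mem_range] at hmem
      omega
    · rw [coeff_eq_zero_of_natDegree_lt (not_le.1 hin), map_zero, zero_mul, map_zero] at hle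
      exact hne (le_antisymm hle zero_le)

theorem natCast_ne_zero_of_le {k : Type*} [Field k] {n : ℕ}
    (hchar : ringChar k = 0 ∨ n < ringChar k) {m : ℕ} (hm : 0 < m) (hmn : m ≤ n) : (m : k) ≠ 0 := by
  intro h
  have hd := (ringChar.spec k m).1 h
  rcases hchar with h0 | h0
  · rw [h0, zero_dvd_iff] at hd; omega
  · have := Nat.le_of_dvd hm hd; omega

namespace IsInitialData

variable {v : ValuationSubring E} {f : E[X]} {X : F} {r : ℕ} {c : E}

theorem exists_lift (h : IsInitialData v f X r c) :
    ∃ H : v[X], H.map v.subtype = scaledPoly f c := by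
  refine exists_map_subtype_eq v fun n => ?_
  rcases le_or_gt n r with hn | hn
  · exact mem_of_valuation_eq_one v (h.valuation_coeff_eq_one n hn)
  · exact mem_of_valuation_lt_one v (h.valuation_coeff_lt_one n hn)

theorem coe_coeff {H : v[X]} (hH : H.map v.subtype = scaledPoly f c) (i : ℕ) :
    (H.coeff i : E) = (scaledPoly f c).coeff i := by
  rw [← hH, coeff_map]; rfl

theorem residuePoly_eq (h : IsInitialData v f X r c) {H : v[X]}
    (hH : H.map v.subtype = scaledPoly f c) :
    residuePoly v (Finset.range (r + 1)) f X c = reduce v H := by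
  have hmin : minIdx (Finset.range (r + 1)) = 0 :=
    Nat.sInf_eq_zero.2 (Or.inl (by simp))
  ext j
  rw [residuePoly_coeff_of_eq_one v c hmin h.ramIdx_eq_one, reduce_coeff, coe_coeff hH]
  split_ifs with hj
  · rw [scaledPoly_coeff, inv_pow, ← mul_assoc, mul_comm (f.coeff 0)⁻¹]
  · rw [Finset.mem_range] at hj
    exact (resid_of_valuation_lt_one v (h.valuation_coeff_lt_one j (by omega))).symm

/-- Recognizing C as a Hasse derivative makes its value at α a Taylor coefficient of the scaled
polynomial. -/
theorem map_hasseDeriv_eq_binomPoly (h : IsInitialData v f X r c) {H : v[X]}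
    (hH : H.map v.subtype = scaledPoly f c) :
    (hasseDeriv (r - 1) H).map v.subtype = binomPoly f c r := by
  ext i
  have h1 := h.le_natDegree
  have h2 := h.pos
  rw [coeff_map, hasseDeriv_coeff, map_mul, map_natCast, ValuationSubring.subtype_apply,
    coe_coeff hH, scaledPoly_coeff, binomPoly, finsetSum_coeff]
  simp only [coeff_monomial]
  rw [Finset.sum_ite_eq', add_comm i (r - 1)]
  split_ifs with hi
  · rw [← Nat.choose_symm_add, inv_pow]
    field_simp
  · rw [Finset.mem_range] at hi
    rw [coeff_eq_zero_of_natDegree_lt (show f.natDegree < r - 1 + i by omega)]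
    simp

theorem reduce_hasseDeriv_coeff (H : v[X]) (j i : ℕ) :
    (reduce v (hasseDeriv j H)).coeff i = ((i + j).choose j : ℕ) * (reduce v H).coeff (i + j) := by
  rw [reduce, coeff_map, hasseDeriv_coeff, map_mul, map_natCast, reduce, coeff_map]

theorem reduce_coeff_ne_zero (h : IsInitialData v f X r c) {H : v[X]}
    (hH : H.map v.subtype = scaledPoly f c) {i : ℕ} (hi : i ≤ r) : (reduce v H).coeff i ≠ 0 := by
  rw [reduce_coeff, coe_coeff hH, resid_ne_zero_iff]
  exact h.valuation_coeff_eq_one i hi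

theorem reduce_coeff_eq_zero (h : IsInitialData v f X r c) {H : v[X]}
    (hH : H.map v.subtype = scaledPoly f c) {i : ℕ} (hi : r < i) : (reduce v H).coeff i = 0 := by
  rw [reduce_coeff, coe_coeff hH]
  exact resid_of_valuation_lt_one v (h.valuation_coeff_lt_one i hi)

theorem reduce_hasseDeriv_coeff_zero (h : IsInitialData v f X r c) {H : v[X]}
    (hH : H.map v.subtype = scaledPoly f c) :
    (reduce v (hasseDeriv (r - 1) H)).coeff 0 = (reduce v H).coeff (r - 1) ∧
      (reduce v (hasseDeriv (r - 1) H)).coeff 0 ≠ 0 := by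
  have h1 : (reduce v (hasseDeriv (r - 1) H)).coeff 0 = (reduce v H).coeff (r - 1) := by
    rw [reduce_hasseDeriv_coeff, zero_add, Nat.choose_self, Nat.cast_one, one_mul]
  exact ⟨h1, h1 ▸ h.reduce_coeff_ne_zero hH (Nat.sub_le r 1)⟩

theorem reduce_hasseDeriv_coeff_one (h : IsInitialData v f X r c) {H : v[X]} :
    (reduce v (hasseDeriv (r - 1) H)).coeff 1 = r * (reduce v H).coeff r := by
  have h2 := h.pos
  rw [reduce_hasseDeriv_coeff, show 1 + (r - 1) = r by omega, Nat.choose_symm h2,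
    Nat.choose_one_right]

/-- Coefficients of index at least 2 come from some b_i with i > r and reduce to zero; the linear
one is r b̄_r. -/
theorem natDegree_reduce_hasseDeriv (h : IsInitialData v f X r c) {H : v[X]}
    (hH : H.map v.subtype = scaledPoly f c) (hrk : (r : IsLocalRing.ResidueField v) ≠ 0) :
    (reduce v (hasseDeriv (r - 1) H)).natDegree = 1 := by
  refine natDegree_eq_of_le_of_coeff_ne_zero ?_ ?_
  · rw [natDegree_le_iff_coeff_eq_zero]
    intro i hi
    rw [reduce_hasseDeriv_coeff, h.reduce_coeff_eq_zero hH (by omega), mul_zero]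
  · rw [h.reduce_hasseDeriv_coeff_one]
    exact mul_ne_zero hrk (h.reduce_coeff_ne_zero hH le_rfl)

/-- The single root of p and the root of the reduction of C are both -b̄_{r-1}/(r b̄_r). -/
theorem eq_X_sub_C_of_mem_irrFac (h : IsInitialData v f X r c) {H : v[X]}
    (hH : H.map v.subtype = scaledPoly f c) (hrk : (r : IsLocalRing.ResidueField v) ≠ 0)
    (hp : IsPurelyInseparablePoly (residuePoly v (Finset.range (r + 1)) f X c))
    (hpdeg : (residuePoly v (Finset.range (r + 1)) f X c).natDegree = r)
    {q : (IsLocalRing.ResidueField v)[X]}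
    (hq : q ∈ irrFac (residuePoly v (Finset.range (r + 1)) f X c)) :
    q = Polynomial.X - C (linearRoot (reduce v (hasseDeriv (r - 1) H))) := by
  have h1 := eq_C_mul_X_sub_C_pow_of_isPurelyInseparablePoly h.pos hp hpdeg hrk
  obtain ⟨hqm, hqi, hqd⟩ := hq
  rw [h1, h.residuePoly_eq hH] at hqd
  have hroot : linearRoot (reduce v (hasseDeriv (r - 1) H)) =
      -((reduce v H).coeff (r - 1) / (r * (reduce v H).coeff r)) := by
    rw [linearRoot, (h.reduce_hasseDeriv_coeff_zero hH).1, h.reduce_hasseDeriv_coeff_one]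
  rw [← hroot] at hqd
  have hu : IsUnit (C ((reduce v H).coeff r)) :=
    isUnit_C.2 (IsUnit.mk0 _ (h.reduce_coeff_ne_zero hH le_rfl))
  have hd := hqi.prime.dvd_of_dvd_pow ((IsUnit.dvd_mul_left hu).1 hqd)
  exact eq_of_monic_of_associated hqm (monic_X_sub_C _)
    (hqi.associated_of_dvd (irreducible_X_sub_C _) hd)

end IsInitialData

theorem isResidueRoot_X_sub_C_iff {v : ValuationSubring E} {w : ValuationSubring F}
    (h : IsExtension v w) {γ : IsLocalRing.ResidueField v} {x : F} :
    IsResidueRoot v w (Polynomial.X - C γ) x ↔ x ∈ w ∧ resid w x = residueMap v w h γ := by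
  unfold IsResidueRoot
  refine and_congr_right fun _ => ⟨fun ⟨_, h2⟩ => ?_, fun h2 => ⟨h, ?_⟩⟩
  · rwa [eval₂_sub, eval₂_X, eval₂_C, sub_eq_zero] at h2
  · rwa [eval₂_sub, eval₂_X, eval₂_C, sub_eq_zero]

theorem resid_natCast (w : ValuationSubring F) (n : ℕ) : resid w (n : F) = n := by
  rw [resid_of_mem w (natCast_mem w n)]
  exact map_natCast (IsLocalRing.residue w) n

/-- In scaled terms the quotient is r b_r θ / b_{r-1}, all of whose factors are integral with known
residues. -/
theorem IsInitialData.resid_mul_div_eq_neg_one {v : ValuationSubring E} {f : E[X]} {X : F} {r : ℕ}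
    {c : E} (h : IsInitialData v f X r c) {H : v[X]} (hH : H.map v.subtype = scaledPoly f c)
    (hrk : (r : IsLocalRing.ResidueField v) ≠ 0) {w : ValuationSubring F} (hw : IsExtension v w)
    (hθw : algebraMap E F c * X ∈ w)
    (hθ : resid w (algebraMap E F c * X) =
      residueMap v w hw (linearRoot (reduce v (hasseDeriv (r - 1) H)))) :
    resid w ((r : F) * algebraMap E F (f.coeff r) * X / algebraMap E F (f.coeff (r - 1))) =
      -1 := by
  have hv := h.valuation_coeff_eq_one (r - 1) (Nat.sub_le r 1)
  have hv' := h.valuation_coeff_eq_one r le_rfl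
  have hw1 := (hw.valuation_eq_one_iff _).2 hv
  have hwr := mem_of_valuation_eq_one w ((hw.valuation_eq_one_iff _).2 hv')
  have h0 := h.coeff_zero_ne_zero
  have hc0 := h.ne_zero
  have hr1 : f.coeff (r - 1) ≠ 0 := by
    intro h1
    rw [scaledPoly_coeff, h1, zero_mul, mul_zero, map_zero] at hv
    exact zero_ne_one hv
  have hkey : (r : F) * algebraMap E F (f.coeff r) * X / algebraMap E F (f.coeff (r - 1)) =
      (r : F) * algebraMap E F ((scaledPoly f c).coeff r) * (algebraMap E F c * X) /
        algebraMap E F ((scaledPoly f c).coeff (r - 1)) := by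
    have h0' : algebraMap E F (f.coeff 0) ≠ 0 := (_root_.map_ne_zero _).2 h0
    have hc0' : algebraMap E F c ≠ 0 := (_root_.map_ne_zero _).2 hc0
    have hr1' : algebraMap E F (f.coeff (r - 1)) ≠ 0 := (_root_.map_ne_zero _).2 hr1
    have hpow : algebraMap E F c ^ r = algebraMap E F c ^ (r - 1) * algebraMap E F c := by
      rw [← pow_succ, Nat.sub_add_cancel h.pos]
    rw [scaledPoly_coeff, scaledPoly_coeff]
    simp only [map_mul, map_pow, map_inv₀, inv_pow, hpow]
    field_simp
  have hrw : (r : F) * algebraMap E F ((scaledPoly f c).coeff r) ∈ w :=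
    mul_mem (natCast_mem w r) hwr
  rw [hkey, resid_div w (mul_mem hrw hθw) hw1, resid_mul w hrw hθw,
    resid_mul w (natCast_mem w r) hwr, resid_natCast, hθ,
    ← residueMap_resid hw (mem_of_valuation_eq_one v hv'),
    ← residueMap_resid hw (mem_of_valuation_eq_one v hv), ← IsInitialData.coe_coeff hH,
    ← IsInitialData.coe_coeff hH, ← reduce_coeff, ← reduce_coeff, linearRoot,
    (h.reduce_hasseDeriv_coeff_zero hH).1, h.reduce_hasseDeriv_coeff_one, ← map_natCast
    (residueMap v w hw) r, ← map_mul, ← map_mul, ← map_div₀, ← map_one (residueMap v w hw),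
    ← map_neg]
  congr 1
  have h2 := h.reduce_coeff_ne_zero hH (le_refl r)
  have h3 := h.reduce_coeff_ne_zero hH (Nat.sub_le r 1)
  field_simp

end Scaled

/-! ### Transfer of residual transcendence and ruledness along residue isomorphisms. -/

section Transfer

variable {E F L : Type*} [Field E] [Field F] [Field L] [Algebra E F] [Algebra F L] [Algebra E L]
  [IsScalarTower E F L] {v : ValuationSubring E} {w : ValuationSubring F}
  {W : ValuationSubring L}

theorem mem_Omega_iff (h : IsExtension v w) :
    w ∈ Omega v F ↔ ∃ y : IsLocalRing.ResidueField w,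
      ∀ p : (IsLocalRing.ResidueField v)[X], p.eval₂ (residueMap v w h) y = 0 → p = 0 := by
  let _ := (residueMap v w h).toAlgebra
  constructor
  · rintro ⟨_, ⟨y, hy⟩⟩
    exact ⟨y, fun p hp => by_contra fun h0 => hy ⟨p, h0, hp⟩⟩
  · rintro ⟨y, hy⟩
    exact ⟨h, ⟨y, fun ⟨p, h0, hp⟩ => h0 (hy p hp)⟩⟩

theorem mem_Omega_of_surjective_left (hvw : IsExtension v w) (hwW : IsExtension w W)
    (hs : Function.Surjective (residueMap v w hvw)) (hW : W ∈ Omega v L) : W ∈ Omega w L := by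
  have hvW := hvw.trans hwW
  rw [mem_Omega_iff hvW] at hW
  rw [mem_Omega_iff hwW]
  obtain ⟨y, hy⟩ := hW
  refine ⟨y, fun p hp => ?_⟩
  obtain ⟨p', rfl⟩ := Polynomial.map_surjective _ hs p
  rw [eval₂_map] at hp
  have hcomp : (residueMap w W hwW).comp (residueMap v w hvw) = residueMap v W hvW :=
    RingHom.ext fun a => (residueMap_comp hvw hwW hvW a).symm
  rw [hcomp] at hp
  rw [hy p' hp, Polynomial.map_zero]

theorem mem_Omega_iff_of_surjective (hvw : IsExtension v w) (hwW : IsExtension w W)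
    (hs : Function.Surjective (residueMap w W hwW)) : w ∈ Omega v F ↔ W ∈ Omega v L := by
  have hvW := hvw.trans hwW
  have hcomp : (residueMap w W hwW).comp (residueMap v w hvw) = residueMap v W hvW :=
    RingHom.ext fun a => (residueMap_comp hvw hwW hvW a).symm
  rw [mem_Omega_iff hvW, mem_Omega_iff hvw, ← hcomp]
  constructor
  · rintro ⟨y, hy⟩
    refine ⟨residueMap w W hwW y, fun p hp => hy p ?_⟩
    rwa [← hom_eval₂, map_eq_zero] at hp
  · rintro ⟨y, hy⟩
    obtain ⟨y, rfl⟩ := hs y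
    refine ⟨y, fun p hp => hy p ?_⟩
    rw [← hom_eval₂, hp, map_zero]

theorem mem_OmegaStar_iff_of_surjective (hvw : IsExtension v w) (hwW : IsExtension w W)
    (hs : Function.Surjective (residueMap w W hwW)) : w ∈ OmegaStar v F ↔ W ∈ OmegaStar v L := by
  have hvW := hvw.trans hwW
  let _ := (residueMap v w hvw).toAlgebra
  let _ := (residueMap v W hvW).toAlgebra
  let e : IsLocalRing.ResidueField w ≃ₐ[IsLocalRing.ResidueField v] IsLocalRing.ResidueField W :=
    AlgEquiv.ofRingEquiv (f := RingEquiv.ofBijective (residueMap w W hwW)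
      ⟨(residueMap w W hwW).injective, hs⟩) fun a => (residueMap_comp hvw hwW hvW a).symm
  refine and_congr (mem_Omega_iff_of_surjective hvw hwW hs) ⟨?_, ?_⟩
  · rintro ⟨_, h⟩
    exact ⟨hvW, fun h' => h (h'.of_algEquiv e.symm)⟩
  · rintro ⟨_, h⟩
    exact ⟨hvw, fun h' => h (h'.of_algEquiv e)⟩

/-- Enlarging the base field without changing its residue field does not change whether the
residue field extension is non-ruled. -/
theorem not_isRuled_of_mem_OmegaStar (hvw : IsExtension v w) (hwW : IsExtension w W)
    (hs : Function.Surjective (residueMap v w hvw)) (hW : W ∈ OmegaStar v L) :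
    letI := (residueMap w W hwW).toAlgebra
    ¬ IsRuled (IsLocalRing.ResidueField w) (IsLocalRing.ResidueField W) := by
  let _ := (residueMap w W hwW).toAlgebra
  obtain ⟨-, hvW, h⟩ := hW
  let _ := (residueMap v w hvw).toAlgebra
  let _ := (residueMap v W hvW).toAlgebra
  have : IsScalarTower (IsLocalRing.ResidueField v) (IsLocalRing.ResidueField w)
      (IsLocalRing.ResidueField W) :=
    IsScalarTower.of_algebraMap_eq fun a => residueMap_comp hvw hwW hvW a
  exact fun h' => h (h'.of_surjective hs)

theorem isResidueAlgebra_residueMap (h : IsExtension v w) :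
    letI := (residueMap v w h).toAlgebra
    IsResidueAlgebra v w :=
  letI := (residueMap v w h).toAlgebra
  ⟨h, fun _ ha => residueMap_resid h ha⟩

theorem exists_not_isAlgebraic_of_mem_Omega (h : IsExtension v w) (hw : w ∈ Omega v F) :
    letI := (residueMap v w h).toAlgebra
    ∃ y : IsLocalRing.ResidueField w, ¬ IsAlgebraic (IsLocalRing.ResidueField v) y := by
  let _ := (residueMap v w h).toAlgebra
  obtain ⟨_, ⟨y, hy⟩⟩ := hw
  exact ⟨y, hy⟩

end Transfer

/-! ### The root α over E and over F. -/

section Lifting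

variable {E F L : Type*} [Field E] [Field F] [Field L] [Algebra E F] [Algebra F L] [Algebra E L]
  [IsScalarTower E F L] {v : ValuationSubring E} {w : ValuationSubring F} {α : L} {Q : v[X]}

/-- `α` generates `L/F` and is a root of the irreducible polynomial `Q` over the valuation ring
of `v`, which stays irreducible over `F` and has linear residue polynomial with nonzero root. -/
structure IsLiftingRoot (F : Type*) [Field F] [Algebra E F] [Algebra F L] (v : ValuationSubring E)
    (Q : v[X]) (α : L) : Prop where
  irreducible : Irreducible (Q.map v.subtype)
  irreducible_overField : Irreducible (overField v F Q)
  aeval_overField : aeval α (overField v F Q) = 0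
  adjoin_eq_top : Algebra.adjoin F {α} = ⊤
  natDegree_reduce : (reduce v Q).natDegree = 1
  coeff_zero_ne_zero : (reduce v Q).coeff 0 ≠ 0

namespace IsLiftingRoot

theorem aeval_map_subtype (h : IsLiftingRoot F v Q α) : aeval α (Q.map v.subtype) = 0 := by
  rw [← h.aeval_overField, overField, ← Polynomial.map_map, aeval_map_algebraMap]

theorem isIntegral (h : IsLiftingRoot F v Q α) : IsIntegral E α :=
  IsAlgebraic.isIntegral ⟨_, h.irreducible.ne_zero, h.aeval_map_subtype⟩

theorem isResiduallyLinearRoot_gen (h : IsLiftingRoot F v Q α) :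
    IsResiduallyLinearRoot v Q (IntermediateField.AdjoinSimple.gen E α) where
  irreducible := h.irreducible
  aeval_eq_zero := by
    have h1 : aeval (IntermediateField.AdjoinSimple.gen E α) (Q.map v.subtype) = 0 := by
      apply (algebraMap (IntermediateField.adjoin E {α}) L).injective
      rw [← aeval_algebraMap_apply, IntermediateField.AdjoinSimple.algebraMap_gen,
        h.aeval_map_subtype, map_zero]
    exact (aeval_map_algebraMap E _ Q).symm.trans h1
  adjoin_eq_top := by
    rw [← IntermediateField.adjoin.powerBasis_gen h.isIntegral]
    exact PowerBasis.adjoin_gen_eq_top _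
  natDegree_reduce := h.natDegree_reduce
  coeff_zero_ne_zero := h.coeff_zero_ne_zero

theorem reduce_map_ringMap (hw : IsExtension v w) :
    reduce w (Q.map (ringMap v w hw)) = (reduce v Q).map (residueMap v w hw) := by
  rw [reduce, reduce, Polynomial.map_map, Polynomial.map_map]
  rfl

theorem isResiduallyLinearRoot {L : Type*} [Field L] [Algebra F L] {α : L}
    (h : IsLiftingRoot F v Q α) (hw : IsExtension v w) :
    IsResiduallyLinearRoot w (Q.map (ringMap v w hw)) α := by
  have hmap : (Q.map (ringMap v w hw)).map w.subtype = overField v F Q := by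
    rw [Polynomial.map_map, overField]; rfl
  refine ⟨by rw [hmap]; exact h.irreducible_overField, ?_, h.adjoin_eq_top, ?_, ?_⟩
  · have h1 := h.aeval_overField
    rw [← hmap] at h1
    exact (aeval_map_algebraMap F α _).symm.trans h1
  · rw [reduce_map_ringMap, natDegree_map]
    exact h.natDegree_reduce
  · rw [reduce_map_ringMap, coeff_map]
    exact (_root_.map_ne_zero _).2 h.coeff_zero_ne_zero

theorem linearRoot_map {k l : Type*} [Field k] [Field l] (φ : k →+* l) (p : k[X]) :
    linearRoot (p.map φ) = φ (linearRoot p) := by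
  rw [linearRoot, linearRoot, coeff_map, coeff_map, map_neg, map_div₀]

theorem resid_eq (h : IsLiftingRoot F v Q α) (hw : IsExtension v w) {W : ValuationSubring L}
    (hW : IsExtension w W) (hα : W.valuation α = 1) :
    resid W α = residueMap w W hW (residueMap v w hw (linearRoot (reduce v Q))) := by
  rw [(h.isResiduallyLinearRoot hw).resid_eq hW (mem_of_valuation_eq_one W hα),
    reduce_map_ringMap, linearRoot_map]

/-- The restriction of W to E(α) extends v and keeps α a unit, so uniqueness over E identifies it
with vQ. -/
theorem isExtension_adjoin (h : IsLiftingRoot F v Q α) (hw : IsExtension v w)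
    {vQ : ValuationSubring (IntermediateField.adjoin E {α})} (hvQ : IsExtension v vQ)
    (hα : vQ.valuation (IntermediateField.AdjoinSimple.gen E α) = 1) {W : ValuationSubring L}
    (hW : IsExtension w W) (hαW : W.valuation α = 1) : IsExtension vQ W := by
  have hvW : IsExtension v W := hw.trans hW
  refine h.isResiduallyLinearRoot_gen.existsUnique_extension.unique ⟨hvW.of_tower, ?_⟩ ⟨hvQ, hα⟩
  rw [← IsExtension.valuation_eq_one_iff (w := W) rfl,
    IntermediateField.AdjoinSimple.algebraMap_gen, hαW]

end IsLiftingRoot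
end Lifting

/-! ### Taylor coefficients of the translated polynomial. -/

section TranslatePoly

variable {E L : Type*} [Field E] [Field L] [Algebra E L] {f : E[X]} {c : E} {α : L}

theorem translate_eq_taylor (f : E[X]) (c : E) (α : L) :
    translate f c α = taylor (IntermediateField.AdjoinSimple.gen E α)
      ((scaledPoly f c).map (algebraMap E (IntermediateField.adjoin E {α}))) := by
  rw [translate, taylor_apply, scaledPoly, Polynomial.map_mul, map_C, Polynomial.map_comp,
    Polynomial.map_mul, map_C, map_X, mul_comp, C_comp, comp_assoc, mul_comp, C_comp, X_comp]

theorem natDegree_scaledPoly (h0 : f.coeff 0 ≠ 0) (hc : c ≠ 0) :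
    (scaledPoly f c).natDegree = f.natDegree := by
  rw [scaledPoly, natDegree_C_mul (inv_ne_zero h0), natDegree_comp,
    natDegree_C_mul_X _ (inv_ne_zero hc), mul_one]

theorem natDegree_translate (h0 : f.coeff 0 ≠ 0) (hc : c ≠ 0) :
    (translate f c α).natDegree = f.natDegree := by
  rw [translate_eq_taylor, natDegree_taylor, natDegree_map, natDegree_scaledPoly h0 hc]

/-- The j-th Taylor coefficient at α is the value there of the j-th Hasse derivative, which Q
divides. -/
theorem translate_coeff_eq_zero {v : ValuationSubring E} {H Q : v[X]}
    (hH : H.map v.subtype = scaledPoly f c) {j : ℕ} (hQ : Q ∣ hasseDeriv j H)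
    (hα : aeval (IntermediateField.AdjoinSimple.gen E α) Q = 0) :
    (translate f c α).coeff j = 0 := by
  rw [translate_eq_taylor, taylor_coeff]
  have h1 : hasseDeriv j ((scaledPoly f c).map (algebraMap E (IntermediateField.adjoin E {α}))) =
      (hasseDeriv j H).map (algebraMap v (IntermediateField.adjoin E {α})) := by
    rw [← hH]
    ext i
    simp only [hasseDeriv_coeff, coeff_map, map_mul, map_natCast]
    rfl
  rw [h1, eval_map_algebraMap]
  obtain ⟨R, hR⟩ := hQ
  rw [hR, map_mul, hα, zero_mul]

theorem aeval_translate (θ : L) :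
    aeval (θ - α) (translate f c α) =
      algebraMap E L (f.coeff 0)⁻¹ * aeval (algebraMap E L c⁻¹ * θ) f := by
  rw [translate, map_mul, aeval_C, aeval_comp, aeval_map_algebraMap, map_mul, aeval_C, map_add,
    aeval_X, aeval_C, IntermediateField.AdjoinSimple.algebraMap_gen, sub_add_cancel,
    ← IsScalarTower.algebraMap_apply, ← IsScalarTower.algebraMap_apply]

variable {F : Type*} [Field F] [Algebra E F] {X : F} {r : ℕ} {v : ValuationSubring E}

/-- Translation by an integral element preserves integrality and commutes with reduction, and it
fixes the leading coefficient of the reduction, which has degree r. -/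
theorem IsInitialData.translate_coeff (h : IsInitialData v f X r c) {H : v[X]}
    (hH : H.map v.subtype = scaledPoly f c)
    (hdeg : (reduce v H).natDegree = r)
    {vQ : ValuationSubring (IntermediateField.adjoin E {α})} (hvQ : IsExtension v vQ)
    (hα : vQ.valuation (IntermediateField.AdjoinSimple.gen E α) = 1) :
    (∀ i, (translate f c α).coeff i ∈ vQ) ∧ vQ.valuation ((translate f c α).coeff r) = 1 := by
  set a : vQ := ⟨_, mem_of_valuation_eq_one vQ hα⟩ with ha
  set G := taylor a (H.map (ringMap v vQ hvQ)) with hG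
  have hmap : G.map vQ.subtype = translate f c α := by
    rw [translate_eq_taylor, ← hH, hG, taylor_apply, taylor_apply, Polynomial.map_comp,
      Polynomial.map_map, Polynomial.map_map, Polynomial.map_add, map_X, map_C]
    rfl
  have hcoeff : ∀ i, (translate f c α).coeff i = G.coeff i := fun i => by
    rw [← hmap, coeff_map]; rfl
  refine ⟨fun i => by rw [hcoeff]; exact (G.coeff i).2, ?_⟩
  rw [hcoeff, ← resid_ne_zero_iff, ← reduce_coeff]
  have hred : reduce vQ G = taylor (IsLocalRing.residue vQ a)
      ((reduce v H).map (residueMap v vQ hvQ)) := by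
    rw [hG, taylor_apply, taylor_apply, reduce, Polynomial.map_comp, Polynomial.map_add, map_X,
      map_C]
    congr 1
    exact IsLiftingRoot.reduce_map_ringMap hvQ
  have hnd : ((reduce v H).map (residueMap v vQ hvQ)).natDegree = r := by rw [natDegree_map, hdeg]
  rw [hred]
  have := coeff_taylor_natDegree (IsLocalRing.residue vQ a)
    ((reduce v H).map (residueMap v vQ hvQ))
  rw [hnd] at this
  rw [this, leadingCoeff_ne_zero, Ne, Polynomial.map_eq_zero]
  intro h0
  rw [h0, natDegree_zero] at hdeg
  exact h.pos.ne hdeg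

end TranslatePoly

/-! ### Nonvanishing of integers in residue extensions. -/

section NatCast

variable {E F : Type*} [Field E] [Field F] [Algebra E F] {v : ValuationSubring E}
  {w : ValuationSubring F}

theorem natCast_ne_zero_of_isExtension (h : IsExtension v w) {n : ℕ} (hn : (n : IsLocalRing.ResidueField v) ≠ 0) :
    (n : IsLocalRing.ResidueField w) ≠ 0 := by
  rw [← map_natCast (residueMap v w h)]
  exact (_root_.map_ne_zero _).2 hn

end NatCast

/-! ### The approximation step from X to cX - α. -/

section SecondStep

variable {E F L : Type*} [Field E] [Field F] [Field L] [Algebra E F] [Algebra F L] [Algebra E L]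
  [IsScalarTower E F L] {v : ValuationSubring E} {w : ValuationSubring F} {α : L} {Q H : v[X]}
  {f : E[X]} {X : F} {r : ℕ} {c : E}

theorem IsInitialData.exists_resid_eq_of_mem_OmegaSq (h : IsInitialData v f X r c)
    {γ : IsLocalRing.ResidueField v}
    (hw : w ∈ OmegaSq v (Finset.range (r + 1)) f X c (Polynomial.X - C γ)) :
    ∃ hvw : IsExtension v w, algebraMap E F c * X ∈ w ∧
      resid w (algebraMap E F c * X) = residueMap v w hvw γ := by
  obtain ⟨⟨⟨hvw, -⟩, -⟩, hq⟩ := hw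
  rw [h.ramIdx_eq_one, pow_one, isResidueRoot_X_sub_C_iff hvw] at hq
  exact ⟨hvw, hq⟩

namespace IsLiftingRoot

theorem resid_eq_resid (hQ : IsLiftingRoot F v Q α) (h : IsInitialData v f X r c)
    (hw : w ∈ OmegaSq v (Finset.range (r + 1)) f X c (Polynomial.X - C (linearRoot (reduce v Q))))
    {W : ValuationSubring L} (hW : IsExtension w W) (hα : W.valuation α = 1) :
    resid W α = resid W (algebraMap F L (algebraMap E F c * X)) ∧
      W.valuation (algebraMap F L (algebraMap E F c * X) - α) < 1 := by
  obtain ⟨hvw, hθ, hres⟩ := h.exists_resid_eq_of_mem_OmegaSq hw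
  have h1 : resid W α = resid W (algebraMap F L (algebraMap E F c * X)) := by
    rw [hQ.resid_eq hvw hW hα, ← residueMap_resid hW hθ, hres]
  exact ⟨h1, (resid_eq_iff W ((hW.mem_iff _).2 hθ) (mem_of_valuation_eq_one W hα)).1 h1.symm⟩

theorem transcendental_sub (hQ : IsLiftingRoot F v Q α) (hX : Transcendental E X) (hc : c ≠ 0) :
    Transcendental (IntermediateField.adjoin E {α})
      (algebraMap F L (algebraMap E F c * X) - α) := by
  intro halg
  have : Algebra.IsAlgebraic E (IntermediateField.adjoin E {α}) :=
    IntermediateField.isAlgebraic_adjoin_simple hQ.isIntegral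
  have h1 := (halg.restrictScalars E).add hQ.isIntegral.isAlgebraic
  rw [sub_add_cancel, isAlgebraic_algebraMap_iff (algebraMap F L).injective] at h1
  have h2 := (isAlgebraic_algebraMap (A := F) (R := E) c⁻¹).mul h1
  rw [← mul_assoc, ← map_mul, inv_mul_cancel₀ hc, map_one, one_mul] at h2
  exact hX h2

/-- The index sets and multiplicities of the translated polynomial. -/
theorem minSet_translate (hQ : IsLiftingRoot F v Q α) (h : IsInitialData v f X r c)
    (hH : H.map v.subtype = scaledPoly f c) (hdvd : Q ∣ hasseDeriv (r - 1) H)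
    (hdeg : (reduce v H).natDegree = r) (hrk : (r : IsLocalRing.ResidueField v) ≠ 0)
    {vQ : ValuationSubring (IntermediateField.adjoin E {α})} (hvQ : IsExtension v vQ)
    (hα : vQ.valuation (IntermediateField.AdjoinSimple.gen E α) = 1)
    {X₁ : L} (hX₁ : X₁ ≠ 0) {W : ValuationSubring L} (hW : IsExtension vQ W)
    (hlt : W.valuation X₁ < 1) :
    (∀ i ∈ minSet (translate f c α) X₁ W, i ≤ r) ∧
      ∀ m ∈ Mult vQ (minSet (translate f c α) X₁ W) (translate f c α) X₁, m < r := by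
  obtain ⟨hmem, hr1⟩ := h.translate_coeff hH hdeg hvQ hα
  have hg : translate f c α ≠ 0 := by
    intro h0
    rw [h0, coeff_zero, map_zero] at hr1
    exact zero_ne_one hr1
  have hle : ∀ i ∈ minSet (translate f c α) X₁ W, i ≤ r := fun i hi =>
    le_of_mem_minSet hX₁ hW hlt hmem hr1 hi
  have hne := minSet_nonempty (translate f c α) X₁ W
  refine ⟨hle, fun m hm => lt_of_mem_Mult vQ h.pos (natCast_ne_zero_of_isExtension hvQ hrk) hne hle
    (fun hpred => coeff_ne_zero_of_mem_minSet hg hX₁ hpred ?_)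
    (coeff_ne_zero_of_mem_minSet hg hX₁ (minIdx_mem hne)) hm⟩
  exact translate_coeff_eq_zero hH hdvd hQ.isResiduallyLinearRoot_gen.aeval_eq_zero

/-- Restriction is a bijection between the non-ruled residually transcendental extensions. -/
theorem nonempty_equiv (hQ : IsLiftingRoot F v Q α) {A : Set (ValuationSubring F)}
    (hA : A ⊆ Omega v F) :
    Nonempty (↥(A ∩ OmegaStar v F) ≃ ↥(liftedSet v A α ∩ OmegaStar v L)) := by
  have hext : ∀ w ∈ A, IsExtension v w := fun w hw => (hA hw).1
  refine ⟨(Equiv.ofBijective (fun W : ↥(liftedSet v A α ∩ OmegaStar v L) =>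
    (⟨W.1.comap (algebraMap F L), W.2.1.2.1,
      (mem_OmegaStar_iff_of_surjective (hext _ W.2.1.2.1) rfl
        ((hQ.isResiduallyLinearRoot (hext _ W.2.1.2.1)).residueMap_surjective rfl
          W.2.1.2.2)).2 W.2.2⟩ : ↥(A ∩ OmegaStar v F))) ⟨?_, ?_⟩).symm⟩
  · intro W W' hWW
    have h1 : W.1.comap (algebraMap F L) = W'.1.comap (algebraMap F L) := congrArg Subtype.val hWW
    -- Injectivity is the uniqueness of the extension with α a unit; surjectivity below is its
    -- existence together with the isomorphism of residue fields.
    exact Subtype.ext ((hQ.isResiduallyLinearRoot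
      (hext _ W.2.1.2.1)).existsUnique_extension.unique ⟨rfl, W.2.1.2.2⟩ ⟨h1.symm, W'.2.1.2.2⟩)
  · rintro ⟨w, hwA, hw⟩
    have hlin := hQ.isResiduallyLinearRoot (hext w hwA)
    obtain ⟨W, hW, hα⟩ := hlin.existsUnique_extension.exists
    have hs := hlin.residueMap_surjective hW hα
    have hWs := (mem_OmegaStar_iff_of_surjective (hext w hwA) hW hs).1 hw
    refine ⟨⟨W, ⟨hWs.1, ?_, hα⟩, hWs⟩, Subtype.ext hW⟩
    rw [show W.comap (algebraMap F L) = w from hW]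
    exact hwA

theorem adjoin_pair_eq_top (hQ : IsLiftingRoot F v Q α) (hc : c ≠ 0) {Y : F}
    (hXY : IntermediateField.adjoin E {X, Y} = ⊤) :
    IntermediateField.adjoin (IntermediateField.adjoin E {α})
      {algebraMap F L (algebraMap E F c * X) - α, algebraMap F L Y} = ⊤ := by
  set M := IntermediateField.adjoin (IntermediateField.adjoin E {α})
    {algebraMap F L (algebraMap E F c * X) - α, algebraMap F L Y} with hM
  have hαM : α ∈ M := by
    have := M.algebraMap_mem (IntermediateField.AdjoinSimple.gen E α)
    rwa [IntermediateField.AdjoinSimple.algebraMap_gen] at this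
  have hEM : ∀ a : E, algebraMap E L a ∈ M := fun a => by
    rw [IsScalarTower.algebraMap_apply E (IntermediateField.adjoin E {α}) L]
    exact M.algebraMap_mem _
  have h1 : algebraMap F L (algebraMap E F c * X) ∈ M := by
    have := add_mem (IntermediateField.subset_adjoin (IntermediateField.adjoin E {α}) _
      (Set.mem_insert _ _) : algebraMap F L (algebraMap E F c * X) - α ∈ M) hαM
    rwa [sub_add_cancel] at this
  have h2 : algebraMap F L X ∈ M := by
    have := mul_mem (hEM c⁻¹) h1
    rwa [IsScalarTower.algebraMap_apply E F L, ← map_mul, ← mul_assoc, ← map_mul,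
      inv_mul_cancel₀ hc, map_one, one_mul] at this
  have h3 : algebraMap F L Y ∈ M :=
    IntermediateField.subset_adjoin (IntermediateField.adjoin E {α}) _ (Or.inr rfl)
  have h4 : IntermediateField.adjoin E {X, Y} ≤
      (M.restrictScalars E).comap (IsScalarTower.toAlgHom E F L) := by
    rw [IntermediateField.adjoin_le_iff]
    rintro z (rfl | rfl)
    · exact h2
    · exact h3
  rw [hXY] at h4
  have h5 : ∀ z : F, algebraMap F L z ∈ M := fun z => h4 IntermediateField.mem_top
  rw [eq_top_iff]
  intro z _
  have hz : z ∈ Algebra.adjoin F {α} := by rw [hQ.adjoin_eq_top]; trivial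
  induction hz using Algebra.adjoin_induction with
  | mem x hx => rw [Set.mem_singleton_iff.1 hx]; exact hαM
  | algebraMap a => exact h5 a
  | add x y _ _ hx hy => exact add_mem (hx trivial) (hy trivial)
  | mul x y _ _ hx hy => exact mul_mem (hx trivial) (hy trivial)

/-- A single minimal term makes Y² = a₀ g(X₁) agree with a monomial in X₁ up to residue one, so the
residue extension over vQ is ruled. Since vQ and v have the same residue field, this contradicts
non-ruledness over v. -/
theorem two_le_card_minSet_translate (hQ : IsLiftingRoot F v Q α) (h : IsInitialData v f X r c)
    (hH : H.map v.subtype = scaledPoly f c) (hdvd : Q ∣ hasseDeriv (r - 1) H)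
    (hX : Transcendental E X)
    (hchar : ringChar (IsLocalRing.ResidueField v) = 0 ∨
      f.natDegree < ringChar (IsLocalRing.ResidueField v))
    (hsqrt : IsSqrtExtension f X)
    {vQ : ValuationSubring (IntermediateField.adjoin E {α})} (hvQ : IsExtension v vQ)
    (hα : vQ.valuation (IntermediateField.AdjoinSimple.gen E α) = 1)
    {W : ValuationSubring L} (hW : IsExtension vQ W) (hWs : W ∈ OmegaStar v L) :
    2 ≤ (minSet (translate f c α)
      (algebraMap F L (algebraMap E F c * X) - α) W).card := by
  obtain ⟨Y, hY, hXY⟩ := hsqrt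
  have hs := hQ.isResiduallyLinearRoot_gen.residueMap_surjective hvQ hα
  have hWQ := mem_Omega_of_surjective_left hvQ hW hs hWs.1
  have htop := hQ.adjoin_pair_eq_top h.ne_zero hXY
  have hX₁ := hQ.transcendental_sub hX h.ne_zero
  have hdeg : (translate f c α).natDegree = f.natDegree :=
    natDegree_translate h.coeff_zero_ne_zero h.ne_zero
  have hYg : algebraMap F L Y ^ 2 =
      algebraMap (IntermediateField.adjoin E {α}) L (algebraMap E _ (f.coeff 0)) *
        aeval (algebraMap F L (algebraMap E F c * X) - α) (translate f c α) := by
    rw [aeval_translate, ← IsScalarTower.algebraMap_apply, ← mul_assoc, ← map_mul,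
      mul_inv_cancel₀ h.coeff_zero_ne_zero, map_one, one_mul, ← map_pow, hY,
      ← aeval_algebraMap_apply, IsScalarTower.algebraMap_apply E F L c⁻¹, ← map_mul, ← mul_assoc,
      ← map_mul, inv_mul_cancel₀ h.ne_zero, map_one, one_mul]
  set X₁ := algebraMap F L (algebraMap E F c * X) - α with hX₁def
  set g := translate f c α with hgdef
  have hX₁0 : X₁ ≠ 0 := fun h0 => hX₁ (by rw [h0]; exact isAlgebraic_zero)
  have hg : g ≠ 0 := by
    intro h0
    rw [h0, natDegree_zero] at hdeg
    have h1 := h.pos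
    have h2 := h.le_natDegree
    omega
  by_contra! hcard
  obtain ⟨j, hj⟩ := Finset.card_eq_one.1 (le_antisymm (Nat.lt_succ_iff.1 hcard)
    (Finset.card_pos.2 (minSet_nonempty g X₁ W)))
  let _ := (residueMap vQ W hW).toAlgebra
  have hk : IsResidueAlgebra vQ W := isResidueAlgebra_residueMap hW
  have htr := exists_not_isAlgebraic_of_mem_Omega hW hWQ
  refine not_isRuled_of_mem_OmegaStar hvQ hW hs hWs ?_
  have hXM : X₁ ∈ IntermediateField.adjoin (IntermediateField.adjoin E {α}) {X₁} :=
    IntermediateField.mem_adjoin_simple_self _ _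
  -- For n ≥ 2 the characteristic hypothesis makes 2 invertible. For n = 1 it may fail to; but then
  -- r = 1, so g is a multiple of t, X₁ is a constant times Y², and the field is generated by Y
  -- alone.
  rcases Nat.lt_or_ge f.natDegree 2 with hn | hn
  · have h1 := h.pos
    have h2 := h.le_natDegree
    have hr : r = 1 := by omega
    have hg0 : g.coeff 0 = 0 := by
      have := translate_coeff_eq_zero (α := α) hH hdvd
        hQ.isResiduallyLinearRoot_gen.aeval_eq_zero
      rwa [hr] at this
    have hg1 : g.coeff 1 ≠ 0 := coeff_one_ne_zero (by omega)
    have hgX : aeval X₁ g = algebraMap (IntermediateField.adjoin E {α}) L (g.coeff 1) * X₁ := by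
      rw [eq_X_add_C_of_natDegree_le_one (show g.natDegree ≤ 1 by omega), hg0]
      simp
    have ha : algebraMap E (IntermediateField.adjoin E {α}) (f.coeff 0) * g.coeff 1 ≠ 0 :=
      mul_ne_zero ((_root_.map_ne_zero _).2 h.coeff_zero_ne_zero) hg1
    have hX₁Y : X₁ = algebraMap (IntermediateField.adjoin E {α}) L
        (algebraMap E (IntermediateField.adjoin E {α}) (f.coeff 0) * g.coeff 1)⁻¹ *
          algebraMap F L Y ^ 2 := by
      rw [hYg, hgX, ← mul_assoc _ _ X₁, ← map_mul, ← mul_assoc, ← map_mul, inv_mul_cancel₀ ha,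
        map_one, one_mul]
    refine isRuled_of_adjoin_simple_eq_top hk (x := algebraMap F L Y) (fun hY' => hX₁ ?_) ?_ htr
    · rw [hX₁Y]
      exact (isAlgebraic_algebraMap _).mul (hY'.pow 2)
    · rw [eq_top_iff, ← htop, IntermediateField.adjoin_le_iff]
      have hYM := IntermediateField.mem_adjoin_simple_self (IntermediateField.adjoin E {α})
        (algebraMap F L Y)
      rintro z (rfl | rfl)
      · rw [hX₁Y]
        exact mul_mem (IntermediateField.algebraMap_mem _ _) (pow_mem hYM 2)
      · exact hYM
  · refine isRuled_of_sq_sim_monomial hk hX₁ htop ?_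
      (c := algebraMap E (IntermediateField.adjoin E {α}) (f.coeff 0) * g.coeff j) (j := j) ?_ ?_
      htr
    · rw [hYg]
      refine mul_mem (IntermediateField.algebraMap_mem _ _) ?_
      rw [aeval_eq_sum_range]
      exact sum_mem fun i _ => IntermediateField.smul_mem _ (pow_mem hXM i)
    · rw [hYg, map_mul, mul_assoc]
      exact (Sim.refl (by
        rw [← IsScalarTower.algebraMap_apply]
        exact (_root_.map_ne_zero _).2 h.coeff_zero_ne_zero)).mul
        (sim_of_minSet_eq_singleton hg hX₁0 hj)
    · have h2 := natCast_ne_zero_of_isExtension (hvQ.trans hW)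
        (natCast_ne_zero_of_le hchar two_pos hn)
      exact_mod_cast h2

/-- The second approximation step, with `X` replaced by `cX - α`. -/
theorem exists_valuationSubring (hQ : IsLiftingRoot F v Q α) (h : IsInitialData v f X r c)
    (hH : H.map v.subtype = scaledPoly f c) (hdvd : Q ∣ hasseDeriv (r - 1) H)
    (hdeg : (reduce v H).natDegree = r) (hX : Transcendental E X)
    (hchar : ringChar (IsLocalRing.ResidueField v) = 0 ∨
      f.natDegree < ringChar (IsLocalRing.ResidueField v))
    {A : Set (ValuationSubring F)}
    (hA : A = OmegaSq v (Finset.range (r + 1)) f X c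
      (Polynomial.X - C (linearRoot (reduce v Q)))) {X₁ : L}
    (hX₁ : X₁ = algebraMap F L (algebraMap E F c * X) - α) :
    ∃ vQ : ValuationSubring (IntermediateField.adjoin E {α}),
      (IsExtension v vQ ∧ vQ.valuation (IntermediateField.AdjoinSimple.gen E α) = 1) ∧
      (∀ w ∈ A, (∃! wQ : ValuationSubring L, IsExtension w wQ ∧ wQ.valuation α = 1) ∧
        ∀ wQ : ValuationSubring L, IsExtension w wQ → wQ.valuation α = 1 →
          IsExtension vQ wQ ∧ resid wQ α = resid wQ (algebraMap F L (algebraMap E F c * X)) ∧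
          wQ.valuation X₁ < 1 ∧
          (∀ i ∈ minSet (translate f c α) X₁ wQ, i ≤ r) ∧
          (2 ≤ (minSet (translate f c α) X₁ wQ).card →
            ∀ m ∈ Mult vQ (minSet (translate f c α) X₁ wQ) (translate f c α) X₁, m < r)) ∧
      Nonempty (↥(A ∩ OmegaStar v F) ≃ ↥(liftedSet v A α ∩ OmegaStar v L)) ∧
      (IsSqrtExtension f X → liftedSet v A α ∩ OmegaStar v L ⊆
        ⋃ S₁ ∈ {S₁ ∈ indexSets vQ (translate f c α) X₁ | S₁ ⊆ Finset.range (r + 1)},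
          OmegaS vQ S₁ (translate f c α) X₁) := by
  have hrk := natCast_ne_zero_of_le hchar h.pos h.le_natDegree
  have hX₁0 : X₁ ≠ 0 := fun h0 => hQ.transcendental_sub hX h.ne_zero (by
    rw [← hX₁, h0]
    exact isAlgebraic_zero)
  obtain ⟨vQ, hvQ, hα⟩ := hQ.isResiduallyLinearRoot_gen.existsUnique_extension.exists
  have hstep : ∀ w ∈ A, ∀ W : ValuationSubring L, IsExtension w W → W.valuation α = 1 →
      IsExtension vQ W ∧ resid W α = resid W (algebraMap F L (algebraMap E F c * X)) ∧
        W.valuation X₁ < 1 := fun w hw W hW hαW => by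
    have h1 := hQ.resid_eq_resid h (hA ▸ hw) hW hαW
    rw [← hX₁] at h1
    exact ⟨hQ.isExtension_adjoin (hA ▸ hw).1.1.1 hvQ hα hW hαW, h1⟩
  refine ⟨vQ, ⟨hvQ, hα⟩, fun w hw => ⟨?_, fun W hW hαW => ?_⟩, ?_, fun hsqrt W hW => ?_⟩
  · exact (hQ.isResiduallyLinearRoot (hA ▸ hw).1.1.1).existsUnique_extension
  · obtain ⟨h1, h2, h3⟩ := hstep w hw W hW hαW
    obtain ⟨h4, h5⟩ := hQ.minSet_translate h hH hdvd hdeg hrk hvQ hα hX₁0 h1 h3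
    exact ⟨h1, h2, h3, h4, fun _ => h5⟩
  · exact hQ.nonempty_equiv fun w hw => (hA ▸ hw).1.1
  · obtain ⟨⟨-, hWA, hαW⟩, hWs⟩ := hW
    obtain ⟨h1, -, h3⟩ := hstep _ hWA W rfl hαW
    have hcard := hQ.two_le_card_minSet_translate h hH hdvd hX hchar hsqrt hvQ hα h1 hWs
    rw [← hX₁] at hcard
    have hWQ := mem_Omega_of_surjective_left hvQ h1
      (hQ.isResiduallyLinearRoot_gen.residueMap_surjective hvQ hα) hWs.1
    have hle := (hQ.minSet_translate h hH hdvd hdeg hrk hvQ hα hX₁0 h1 h3).1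
    refine Set.mem_biUnion (x := minSet (translate f c α) X₁ W) ⟨⟨fun i hi => ?_, hcard, W, hWQ,
      rfl⟩, fun i hi => ?_⟩ ⟨hWQ, rfl⟩
    · exact Finset.mem_range.2 (Nat.lt_succ_iff.2 (mem_minSet.1 hi).1)
    · exact Finset.mem_range.2 (Nat.lt_succ_iff.2 (hle i hi))

end IsLiftingRoot
end SecondStep

end ResidueRuled

end

/-! ### Assembly of the five statements. -/

open ResidueRuled in
theorem mainTheorem5 {E F : Type*} [Field E] [Field F] [Algebra E F]
    (hF : IsRegularFunctionField E F) (v : ValuationSubring E)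
    (f : Polynomial E) (hf : f ≠ 0) (X : F) (hX : X ∉ Set.range (algebraMap E F))
    (hchar : ringChar (IsLocalRing.ResidueField v) = 0 ∨
      f.natDegree < ringChar (IsLocalRing.ResidueField v))
    (r : ℕ) (hS : Finset.range (r + 1) ∈ indexSets v f X)
    (c : E) (hc : c ∈ scalars v (Finset.range (r + 1)) f X)
    (hp : IsPurelyInseparablePoly (residuePoly v (Finset.range (r + 1)) f X c))
    (hpdeg : (residuePoly v (Finset.range (r + 1)) f X c).natDegree = r)
    (q : Polynomial (IsLocalRing.ResidueField v))
    (hq : q ∈ irrFac (residuePoly v (Finset.range (r + 1)) f X c)) :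
    -- (1)
    (∀ w ∈ OmegaSq v (Finset.range (r + 1)) f X c q,
      resid w ((r : F) * algebraMap E F (f.coeff r) * X / algebraMap E F (f.coeff (r - 1))) = -1) ∧
    -- (2)
    ∃ P : Polynomial v, P.map v.subtype = binomPoly f c r ∧
      IsPrimitivePoly v P ∧ (reduce v P).natDegree = 1 ∧
      (∀ w ∈ OmegaSq v (Finset.range (r + 1)) f X c q,
        IsResidueRoot v w (reduce v P) (algebraMap E F c * X)) ∧
      -- (3), (4), (5): such a factor exists, and the rest holds for each of them
      (∃ Q : Polynomial v, IsResidualFactor v P Q) ∧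
      ∀ Q : Polynomial v, IsResidualFactor v P Q →
        ∃ hQ : Irreducible (overField v F Q),
          haveI : Fact (Irreducible (overField v F Q)) := ⟨hQ⟩
          let FQ := AdjoinRoot (overField v F Q)
          let α : FQ := AdjoinRoot.root (overField v F Q)
          let EQ := IntermediateField.adjoin E {α}
          let θ : FQ := algebraMap F FQ (algebraMap E F c * X)
          let X₁ : FQ := θ - α
          let g : Polynomial EQ := translate f c α
          let Ω : Set (ValuationSubring FQ) :=
            liftedSet v (OmegaSq v (Finset.range (r + 1)) f X c q) α
          -- the valuation of `EQ` to which the data `(g, X₁)` refer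
          ∃ vQ : ValuationSubring EQ,
            (IsExtension v vQ ∧ vQ.valuation (IntermediateField.AdjoinSimple.gen E α) = 1) ∧
            (∀ w ∈ OmegaSq v (Finset.range (r + 1)) f X c q,
              -- (3)
              (∃! wQ : ValuationSubring FQ, IsExtension w wQ ∧ wQ.valuation α = 1) ∧
              ∀ wQ : ValuationSubring FQ, IsExtension w wQ → wQ.valuation α = 1 →
                IsExtension vQ wQ ∧ resid wQ α = resid wQ θ ∧ wQ.valuation (θ - α) < 1 ∧
                -- (4)
                (∀ i ∈ minSet g X₁ wQ, i ≤ r) ∧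
                (2 ≤ (minSet g X₁ wQ).card → ∀ m ∈ Mult vQ (minSet g X₁ wQ) g X₁, m < r)) ∧
            -- (5)
            Cardinal.mk ↥(OmegaSq v (Finset.range (r + 1)) f X c q ∩ OmegaStar v F) =
              Cardinal.mk ↥(Ω ∩ OmegaStar v FQ) ∧
            (IsSqrtExtension f X →
              Ω ∩ OmegaStar v FQ ⊆
                ⋃ S₁ ∈ {S₁ ∈ indexSets vQ g X₁ | S₁ ⊆ Finset.range (r + 1)},
                  OmegaS vQ S₁ g X₁) := by
  have hX0 : X ≠ 0 := by
    rintro rfl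
    exact hX ⟨0, map_zero _⟩
  have hXt : Transcendental E X := fun h => hX (hF.2 X h)
  have h := isInitialData hf hX0 hS hc
  have hrk := natCast_ne_zero_of_le hchar h.pos h.le_natDegree
  obtain ⟨H, hH⟩ := h.exists_lift
  -- From here on, the condition that q vanishes at the residue of θ says that this residue is the
  -- root of the reduction of C.
  have hq' := h.eq_X_sub_C_of_mem_irrFac hH hrk hp hpdeg hq
  have hres := h.natDegree_reduce_hasseDeriv hH hrk
  have hdeg : (reduce v H).natDegree = r := by rwa [← h.residuePoly_eq hH]
  refine ⟨fun w hw => ?_, Polynomial.hasseDeriv (r - 1) H, h.map_hasseDeriv_eq_binomPoly hH,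
    fun h0 => ?_, hres, fun w hw => ?_, exists_isResidualFactor v hres, fun Q hQ => ?_⟩
  · obtain ⟨hvw, hθ, hθr⟩ := h.exists_resid_eq_of_mem_OmegaSq (hq' ▸ hw)
    exact h.resid_mul_div_eq_neg_one hH hrk hvw hθ hθr
  · rw [h0, Polynomial.natDegree_zero] at hres
    exact zero_ne_one hres
  · obtain ⟨hvw, hθ, hθr⟩ := h.exists_resid_eq_of_mem_OmegaSq (hq' ▸ hw)
    exact ⟨hθ, hvw, (eval₂_eq_zero_iff_of_natDegree_eq_one _ hres _).2 hθr⟩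
  · obtain ⟨hQirr, hQd, -, hQr⟩ := hQ
    have hirr : Irreducible (overField v F Q) := by
      rw [overField, ← Polynomial.map_map]
      exact irreducible_map_of_forall_isAlgebraic hF.2 hQirr
    have : Fact (Irreducible (overField v F Q)) := ⟨hirr⟩
    have hroot : IsLiftingRoot F v Q (AdjoinRoot.root (overField v F Q)) :=
      { irreducible := hQirr
        irreducible_overField := hirr
        aeval_overField := by rw [AdjoinRoot.aeval_eq, AdjoinRoot.mk_self]
        adjoin_eq_top := AdjoinRoot.adjoinRoot_eq_top
        natDegree_reduce := by rw [hQr, hres]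
        coeff_zero_ne_zero := by rw [hQr]; exact (h.reduce_hasseDeriv_coeff_zero hH).2 }
    obtain ⟨vQ, h1, h2, ⟨e⟩, h3⟩ := hroot.exists_valuationSubring h hH hQd hdeg hXt hchar
      (A := OmegaSq v (Finset.range (r + 1)) f X c q) (by rw [hq', hQr]) rfl
    exact ⟨hirr, vQ, h1, h2, Cardinal.mk_congr e, h3⟩
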